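/- Let $n\geq 1$, let $M$ be a (finite-dimensional, Hausdorff, second countable) smooth manifold with an open cover $\mathcal U=\{U_a\}_{a\in\Lambda}$ (for example a good one), write $\check C_k\,\mathcal U=\bigsqcup_{a_0,\dots,a_k}U_{a_0}\cap\cdots\cap U_{a_k}$, let $\check\delta$ be the Čech differential, and let $TM$ be the $C^\infty(M)$-module of smooth vector fields, i.e. of derivations of $C^\infty(M)$. Let $g$ be a smooth $\mathrm U(1)$-valued Čech $n$-cocycle on $\mathcal U$, with $\mathrm d\log g:=\frac1{2\pi\mathrm i}g^{-1}\mathrm dg$. Let $H\in\Omega^{n+1}(M)$ be closed, and let $\mathcal A=(A^{(1)},\dots,A^{(n)})$, $A^{(p)}\in\Omega^p(\check C_{n-p}\,\mathcal U)$, be a full Čech–Deligne connection on $g$ with curvature $H$, i.e. $$\mathrm d\log g-\check\delta A^{(1)}=0,\qquad \mathrm dA^{(p-1)}+(-1)^p\,\check\delta A^{(p)}=0\quad(2\le p\le n),\qquad \mathrm dA^{(n)}=H|_{\check C_0\mathcal U}$$ (so that $H$ represents, up to the sign convention, the class of $g$ in de Rham cohomology). Let $\mathrm{At}_{n-1}(H)=TM\oplus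 C^\infty(M)[n-1]$, with zero differential, with anchor the projection to $TM$, with binary bracket given by the Lie bracket of vector fields and $[X,f]=\mathcal L_Xf$, with $(n+1)$-ary bracket $[X_1,\dots,X_{n+1}]=H(X_1,\dots,X_{n+1})$ (added to the binary bracket if $n=1$), and no other brackets. Let $\check{\mathrm C}\mathrm{At}(g)$ be the complex with $C^\infty(\check C_k\,\mathcal U)$ in degree $k-(n-1)$ for $0\le k<n-1$ and with $$E_{n-1}(g)=\{(X,f)\in TM\oplus C^\infty(\check C_{n-1}\,\mathcal U)\mid \mathrm d\log(g)(X)=\check\delta f\}$$ in degree $0$, with differential $(-1)^{n-k}\check\delta$ on $C^\infty(\check C_k\,\mathcal U)$ for $k<n-1$ (followed by $f\mapsto(0,f)$ if $k=n-2$), with anchor $(X,f)\mapsto X$, and with only the binary bracket $[(X,f),(Y,h)]=([X,Y],\mathcal L_Xh-\mathcal L_Yf)$ in degree $0$, $[(X,f),h]=\mathcal L_Xh$ for $h$ of negative degree, and zero on pairs of elements of negative degree. Then $\mathrm{At}_{n-1}(H)$ and $\check{\mathrm C}\mathrm{At}(g)$ are $L_\infty$-algebroids over $C^\infty(M)$ (the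 latter is a dg Lie algebroid), and $\mathcal A$ induces an $\infty$-quasi-isomorphism of $L_\infty$-algebroids $$\Phi_{g,\mathcal A}\colon \mathrm{At}_{n-1}(H)\rightsquigarrow\check{\mathrm C}\mathrm{At}(g),$$ that is, a $C^\infty(M)$-linear map $\overline{\mathrm{Sym}}_{C^\infty(M)}(\mathrm{At}_{n-1}(H)[1])\to\check{\mathrm C}\mathrm{At}(g)[1]$ of degree $0$ which satisfies the Maurer–Cartan equation, which is compatible with the anchors, and whose linear part is a quasi-isomorphism. It is the map given by $X\mapsto(X,A^{(1)}(X))$ and $f\mapsto f|_{\check C_0\mathcal U}$ on $\mathrm{At}_{n-1}(H)$, by $(X_1,\dots,X_k)\mapsto A^{(k)}(X_1,\dots,X_k)\in C^\infty(\check C_{n-k}\,\mathcal U)$ for $2\le k\le n$, and by zero on all other products. -/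

import Mathlib

open scoped Manifold ContDiff Topology

noncomputable section

namespace CechAtiyah

section LInfinity

/-- The Koszul sign for rearranging shifted homogeneous elements `x_0, …, x_{k-1}`, where `x_i` has
(unshifted) degree `d i`, in the order prescribed by `p` (elements with equal value of `p` keep
their order): each pair that changes its order contributes `(-1)^((d i - 1) (d j - 1))`. -/
def koszulSign {k : ℕ} {ι : Type*} [LinearOrder ι] (p : Fin k → ι) (d : Fin k → ℤ) : ℤˣ :=
  ∏ i, ∏ j, if i < j ∧ p j < p i then ((d i - 1) * (d j - 1)).negOnePow else 1

/-- The subtuple of `x` with indices in `S`, in increasing order. -/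
def subtuple {V : Type*} {k : ℕ} (x : Fin k → V) (S : Finset (Fin k)) : Fin S.card → V :=
  fun i => x (S.orderEmbOfFin rfl i)

/-- The data underlying an `L_∞`-algebroid over an algebra `A` (in degree zero): a graded
`A`-module, an anchor, and brackets of all arities `k ≥ 1` (the bracket of arity `0` is a dummy),
the unary one being the differential.

The brackets are those of the Chevalley–Eilenberg coalgebra, i.e. the graded symmetric operations of
degree one on `𝔤[1]`. They correspond to graded antisymmetric brackets of degree `2 - k` on `𝔤`
through `bracket (x_1, …, x_k) = (-1)^(∑ (k - i) |x_i|) [x_1, …, x_k]`; in particular both agree on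
tuples in which all elements but the last one have degree zero. -/
structure PreLInftyAlgebroid (A : Type*) [CommRing A] [Algebra ℝ A] where
  carrier : Type*
  [addCommGroup : AddCommGroup carrier]
  [moduleReal : Module ℝ carrier]
  [module : Module A carrier]
  [isScalarTower : IsScalarTower ℝ A carrier]
  /-- the homogeneous elements of (unshifted) degree `i` -/
  deg : ℤ → Submodule A carrier
  bracket : ∀ k : ℕ, (Fin k → carrier) → carrier
  anchor : carrier →ₗ[A] Derivation ℝ A A

attribute [instance] PreLInftyAlgebroid.addCommGroup PreLInftyAlgebroid.moduleReal
  PreLInftyAlgebroid.module PreLInftyAlgebroid.isScalarTower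

variable {A : Type*} [CommRing A] [Algebra ℝ A]

/-- The differential. -/
def PreLInftyAlgebroid.diff (𝔤 : PreLInftyAlgebroid A) (x : 𝔤.carrier) : 𝔤.carrier :=
  𝔤.bracket 1 fun _ => x

/-- The axioms of an `L_∞`-algebroid. -/
structure PreLInftyAlgebroid.IsLInftyAlgebroid (𝔤 : PreLInftyAlgebroid A) : Prop where
  graded : DirectSum.IsInternal 𝔤.deg
  bracket_zero : ∀ x, 𝔤.bracket 0 x = 0
  multilinear : ∀ k, ∃ F : MultilinearMap ℝ (fun _ : Fin k => 𝔤.carrier) 𝔤.carrier,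
    ⇑F = 𝔤.bracket k
  bracket_mem : ∀ (k : ℕ) (d : Fin k → ℤ) (x : Fin k → 𝔤.carrier), (∀ i, x i ∈ 𝔤.deg (d i)) →
    𝔤.bracket k x ∈ 𝔤.deg ((∑ i, d i) + 2 - k)
  symmetric : ∀ (k : ℕ) (d : Fin k → ℤ) (x : Fin k → 𝔤.carrier), (∀ i, x i ∈ 𝔤.deg (d i)) →
    ∀ σ : Equiv.Perm (Fin k), 𝔤.bracket k (x ∘ σ.symm) = koszulSign σ d • 𝔤.bracket k x
  /-- The homotopy Jacobi identities: the sum runs over all ways to choose the arguments of the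
  inner bracket, i.e. over all shuffles. -/
  jacobi : ∀ (k : ℕ) (d : Fin k → ℤ) (x : Fin k → 𝔤.carrier), (∀ i, x i ∈ 𝔤.deg (d i)) →
    ∑ S : Finset (Fin k) with S.Nonempty, koszulSign (fun i => if i ∈ S then 0 else 1) d •
      𝔤.bracket (Sᶜ.card + 1) (Fin.cons (𝔤.bracket S.card (subtuple x S)) (subtuple x Sᶜ)) = 0
  diff_smul : ∀ (a : A) (x : 𝔤.carrier), 𝔤.diff (a • x) = a • 𝔤.diff x
  leibniz : ∀ (a : A) (x y : 𝔤.carrier),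
    𝔤.bracket 2 ![x, a • y] = a • 𝔤.bracket 2 ![x, y] + 𝔤.anchor x a • y
  linear : ∀ k, 3 ≤ k → ∃ F : MultilinearMap A (fun _ : Fin k => 𝔤.carrier) 𝔤.carrier,
    ⇑F = 𝔤.bracket k
  anchor_deg : ∀ i, i ≠ 0 → ∀ x ∈ 𝔤.deg i, 𝔤.anchor x = 0
  anchor_diff : ∀ x, 𝔤.anchor (𝔤.diff x) = 0
  anchor_bracket : ∀ x y, 𝔤.anchor (𝔤.bracket 2 ![x, y]) = ⁅𝔤.anchor x, 𝔤.anchor y⁆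
  anchor_higher : ∀ k, 3 ≤ k → ∀ x, 𝔤.anchor (𝔤.bracket k x) = 0

/-- An `∞`-morphism `𝔤 ⇝ 𝔥` of `L_∞`-algebroids over `A`: graded symmetric `A`-multilinear maps
`φ_k : 𝔤[1]^k → 𝔥[1]` of degree zero, `k ≥ 1` (`φ_0 = 0` is a dummy), i.e. a map
`Sym_A (𝔤[1]) → 𝔥[1]` on the reduced symmetric coalgebra, which satisfies the Maurer–Cartan equation
and is compatible with the anchors. -/
structure InfinityMorphism (𝔤 𝔥 : PreLInftyAlgebroid A) where
  comp : ∀ k : ℕ, (Fin k → 𝔤.carrier) → 𝔥.carrier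
  comp_zero : ∀ x, comp 0 x = 0
  multilinear : ∀ k, ∃ F : MultilinearMap A (fun _ : Fin k => 𝔤.carrier) 𝔥.carrier, ⇑F = comp k
  comp_mem : ∀ (k : ℕ) (d : Fin k → ℤ) (x : Fin k → 𝔤.carrier), (∀ i, x i ∈ 𝔤.deg (d i)) →
    comp k x ∈ 𝔥.deg ((∑ i, d i) + 1 - k)
  symmetric : ∀ (k : ℕ) (d : Fin k → ℤ) (x : Fin k → 𝔤.carrier), (∀ i, x i ∈ 𝔤.deg (d i)) →
    ∀ σ : Equiv.Perm (Fin k), comp k (x ∘ σ.symm) = koszulSign σ d • comp k x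
  /-- The Maurer–Cartan equation, i.e. compatibility with the Chevalley–Eilenberg differentials:
  `∑ l, (1/l!) [φ, …, φ]_l (Δ^{l-1} (x_1 ⋯ x_k)) = φ (δ_CE (x_1 ⋯ x_k))`. The iterated coproduct is
  the sum over all decompositions into `l` nonempty blocks, given by surjections `p`. -/
  maurerCartan : ∀ (k : ℕ) (d : Fin k → ℤ) (x : Fin k → 𝔤.carrier), (∀ i, x i ∈ 𝔤.deg (d i)) →
    ∑ l ∈ Finset.Icc 1 k, ((l.factorial : ℝ)⁻¹) • ∑ p : Fin k → Fin l with Function.Surjective p,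
      koszulSign p d • 𝔥.bracket l (fun b =>
        comp (Finset.univ.filter (p · = b)).card (subtuple x (Finset.univ.filter (p · = b)))) =
    ∑ S : Finset (Fin k) with S.Nonempty, koszulSign (fun i => if i ∈ S then 0 else 1) d •
      comp (Sᶜ.card + 1) (Fin.cons (𝔤.bracket S.card (subtuple x S)) (subtuple x Sᶜ))
  anchor_one : ∀ x : Fin 1 → 𝔤.carrier, 𝔥.anchor (comp 1 x) = 𝔤.anchor (x 0)
  anchor_higher : ∀ k, 2 ≤ k → ∀ x, 𝔥.anchor (comp k x) = 0

/-- The linear part of an `∞`-morphism. -/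
def InfinityMorphism.linearPart {𝔤 𝔥 : PreLInftyAlgebroid A} (Φ : InfinityMorphism 𝔤 𝔥)
    (x : 𝔤.carrier) : 𝔥.carrier :=
  Φ.comp 1 fun _ => x

/-- An `∞`-morphism is an `∞`-quasi-isomorphism if its linear part induces a bijection on the
cohomology of the underlying complexes in every degree; the two fields express injectivity and
surjectivity in terms of representatives. -/
structure InfinityMorphism.IsQuasiIso {𝔤 𝔥 : PreLInftyAlgebroid A}
    (Φ : InfinityMorphism 𝔤 𝔥) : Prop where
  injective : ∀ (i : ℤ), ∀ x ∈ 𝔤.deg i, 𝔤.diff x = 0 →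
    (∃ w ∈ 𝔥.deg (i - 1), Φ.linearPart x = 𝔥.diff w) → ∃ y ∈ 𝔤.deg (i - 1), x = 𝔤.diff y
  surjective : ∀ (i : ℤ), ∀ z ∈ 𝔥.deg i, 𝔥.diff z = 0 →
    ∃ x ∈ 𝔤.deg i, 𝔤.diff x = 0 ∧ ∃ w ∈ 𝔥.deg (i - 1), z = Φ.linearPart x + 𝔥.diff w

end LInfinity

section Manifold

variable (E : Type*) [NormedAddCommGroup E] [NormedSpace ℝ E]

/-- The algebra `C^∞(N)` of smooth real functions on a manifold `N` modelled on `E`. -/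
abbrev SmoothFn (N : Type*) [TopologicalSpace N] [ChartedSpace E N] : Type _ :=
  C^∞⟮modelWithCornersSelf ℝ E, N; ℝ⟯

/-- The `C^∞(N)`-module (and Lie algebra) `T_{C^∞(N)}` of smooth vector fields on `N`: the
derivations of `C^∞(N)`. -/
abbrev VectorFields (N : Type*) [TopologicalSpace N] [ChartedSpace E N] : Type _ :=
  Derivation ℝ (SmoothFn E N) (SmoothFn E N)

/-- Differential `p`-forms on `N`: alternating `C^∞(N)`-multilinear maps from vector fields to
functions. -/
abbrev DiffForm (N : Type*) [TopologicalSpace N] [ChartedSpace E N] (p : ℕ) : Type _ :=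
  VectorFields E N [⋀^Fin p]→ₗ[SmoothFn E N] SmoothFn E N

variable {E}
variable {M : Type*} [TopologicalSpace M] [ChartedSpace E M]

/-- The global (coordinate free) formula for the exterior derivative of a `p`-form, evaluated on
vector fields `X 0, …, X p`:
`∑ i, (-1)^i X_i (η (X_0, …, X̂_i, …, X_p))
  + ∑ i<j, (-1)^j η (X_0, …, [X_i, X_j] in place of X_i, …, X̂_j, …, X_p)`.
Moving the bracket to the front gives the usual sign `(-1)^(i+j)`. -/
def exteriorDeriv {p : ℕ} (η : DiffForm E M p) (X : Fin (p + 1) → VectorFields E M) : SmoothFn E M :=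
  (∑ i : Fin (p + 1), (-1 : ℝ) ^ (i : ℕ) • X i (η (i.removeNth X))) +
  ∑ j : Fin (p + 1), ∑ i ∈ Finset.univ.filter (· < j),
    (-1 : ℝ) ^ (j : ℕ) • η (j.removeNth (Function.update X i ⁅X i, X j⁆))

open TopologicalSpace (Opens)

/-- Restriction of functions from `M` to an open subset. -/
def resFn (U : Opens M) : SmoothFn E M →ₐ[ℝ] SmoothFn E U where
  toFun f := ⟨fun x => f x, f.contMDiff.comp contMDiff_subtype_val⟩
  map_one' := rfl
  map_mul' _ _ := rfl
  map_zero' := rfl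
  map_add' _ _ := rfl
  commutes' _ := rfl

/-- Restriction of functions between open subsets. -/
def resOpen {U V : Opens M} (h : U ≤ V) : SmoothFn E V →ₐ[ℝ] SmoothFn E U where
  toFun f := ⟨fun x => f ⟨x, h x.2⟩, f.contMDiff.comp (contMDiff_inclusion h)⟩
  map_one' := rfl
  map_mul' _ _ := rfl
  map_zero' := rfl
  map_add' _ _ := rfl
  commutes' _ := rfl

/-- Functions on an open subset form a `C^∞(M)`-algebra through restriction. -/
instance (U : Opens M) : Algebra (SmoothFn E M) (SmoothFn E U) := (resFn U).toRingHom.toAlgebra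

instance (U : Opens M) : IsScalarTower ℝ (SmoothFn E M) (SmoothFn E U) :=
  ⟨fun r f h => by ext x; exact mul_assoc r (f x) (h x)⟩

section Restriction

variable [FiniteDimensional ℝ E] [IsManifold (modelWithCornersSelf ℝ E) ∞ M] [T2Space M]

theorem exists_bump (U : Opens M) (x : M) (hx : x ∈ U) :
    ∃ ρ : SmoothFn E M, (∀ᶠ y in 𝓝 x, ρ y = 1) ∧ tsupport ρ ⊆ U := by
  obtain ⟨f, -, hf⟩ := (SmoothBumpFunction.nhds_basis_tsupport
    (I := modelWithCornersSelf ℝ E) x).mem_iff.1 (U.isOpen.mem_nhds hx)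
  exact ⟨⟨f, f.contMDiff⟩, f.eventuallyEq_one, hf⟩

/-- Every germ of a function on an open subset is the germ of a global function. -/
theorem exists_extension (U : Opens M) (f : SmoothFn E U) (x : U) :
    ∃ F : SmoothFn E M, ∀ᶠ y : U in 𝓝 x, F y = f y := by
  obtain ⟨ρ, h1, h2⟩ := exists_bump (E := E) U x x.2
  classical
  let F : M → ℝ := fun y => if h : y ∈ U then ρ y * f ⟨y, h⟩ else 0
  have hF : ∀ y ∈ U, ContMDiffAt (modelWithCornersSelf ℝ E) 𝓘(ℝ, ℝ) ∞ F y := by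
    intro y hy
    rw [← contMDiffAt_subtype_iff (U := U) (x := ⟨y, hy⟩)]
    refine ((resFn U ρ * f).contMDiff ⟨y, hy⟩).congr_of_eventuallyEq (.of_forall fun z => ?_)
    simp only [F, z.2, dite_true]
    rfl
  refine ⟨⟨F, contMDiff_of_tsupport fun y hy => hF y (h2 (closure_mono ?_ hy))⟩, ?_⟩
  · intro z hz
    by_contra h
    apply hz
    simp only [F]
    split_ifs with h'
    · rw [Function.notMem_support.1 h, zero_mul]
    · rfl
  · filter_upwards [continuous_subtype_val.continuousAt.eventually h1] with y hy
    change F y = f y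
    simp only [F, y.2, dite_true, hy, one_mul]

/-- Derivations are local operators. -/
theorem derivation_local (X : VectorFields E M) {F G : SmoothFn E M} {x : M}
    (h : ∀ᶠ y in 𝓝 x, F y = G y) : X F x = X G x := by
  obtain ⟨V, hV, hVo, hxV⟩ := eventually_nhds_iff.1 h
  obtain ⟨ρ, h1, h2⟩ := exists_bump (E := E) ⟨V, hVo⟩ x hxV
  have key : F - G = (1 - ρ) * (F - G) := by
    ext y
    change F y - G y = (1 - ρ y) * (F y - G y)
    by_cases hy : y ∈ V
    · rw [hV y hy]; ring
    · rw [image_eq_zero_of_notMem_tsupport fun hh => hy (h2 hh)]; ring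
  have e := congrArg (fun f => X f x) key
  simp only [Derivation.leibniz, map_sub] at e
  have e' : X F x - X G x =
      (1 - ρ x) * (X F x - X G x) + (F x - G x) * (X 1 x - X ρ x) := e
  rw [h1.self_of_nhds, h.self_of_nhds] at e'
  linarith

/-- The germ of a global function extending `f` near `x`. -/
def extendAt (U : Opens M) (f : SmoothFn E U) (x : U) : SmoothFn E M :=
  (exists_extension U f x).choose

theorem extendAt_spec (U : Opens M) (f : SmoothFn E U) (x : U) :
    ∀ᶠ y : U in 𝓝 x, extendAt U f x y = f y :=
  (exists_extension U f x).choose_spec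

theorem apply_eq_of_germ (X : VectorFields E M) (U : Opens M) (f : SmoothFn E U) (x : U)
    (F : SmoothFn E M) (h : ∀ᶠ y : U in 𝓝 x, F y = f y) : X (extendAt U f x) x = X F x := by
  refine derivation_local X ?_
  have : ∀ᶠ y : U in 𝓝 x, extendAt U f x y = F y := by
    filter_upwards [extendAt_spec U f x, h] with y h1 h2
    rw [h1, h2]
  rw [nhds_subtype_eq_comap, Filter.eventually_comap] at this
  filter_upwards [this, U.isOpen.mem_nhds x.2] with y hy hyU
  exact hy ⟨y, hyU⟩ rfl

theorem smooth_restrict (X : VectorFields E M) (U : Opens M) (f : SmoothFn E U) :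
    ContMDiff (modelWithCornersSelf ℝ E) 𝓘(ℝ, ℝ) ∞ fun x : U => X (extendAt U f x) x := by
  intro x
  refine ((resFn U (X (extendAt U f x))).contMDiff x).congr_of_eventuallyEq ?_
  filter_upwards [(extendAt_spec U f x).eventually_nhds] with y hy
  exact apply_eq_of_germ X U f y _ hy

/-- The restriction `X|_U` of a vector field to an open subset: `(X|_U f)(x) = (X F)(x)` for any
global function `F` that agrees with `f` near `x`. -/
def resVF (U : Opens M) (X : VectorFields E M) : VectorFields E U :=
  Derivation.mk'
    { toFun := fun f => ⟨fun x => X (extendAt U f x) x, smooth_restrict X U f⟩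
      map_add' := fun f h => by
        ext x
        change X (extendAt U (f + h) x) x = X (extendAt U f x) x + X (extendAt U h x) x
        rw [apply_eq_of_germ X U (f + h) x (extendAt U f x + extendAt U h x), map_add]
        · rfl
        · filter_upwards [extendAt_spec U f x, extendAt_spec U h x] with y h1 h2
          exact congrArg₂ (· + ·) h1 h2
      map_smul' := fun c f => by
        ext x
        change X (extendAt U (c • f) x) x = c • X (extendAt U f x) x
        rw [apply_eq_of_germ X U (c • f) x (c • extendAt U f x), Derivation.map_smul]
        · rfl
        · filter_upwards [extendAt_spec U f x] with y h1
          exact congrArg (c • ·) h1 }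
    fun f h => by
      ext x
      change X (extendAt U (f * h) x) x =
        f x * X (extendAt U h x) x + h x * X (extendAt U f x) x
      rw [apply_eq_of_germ X U (f * h) x (extendAt U f x * extendAt U h x), Derivation.leibniz]
      · rw [← (extendAt_spec U f x).self_of_nhds, ← (extendAt_spec U h x).self_of_nhds]
        rfl
      · filter_upwards [extendAt_spec U f x, extendAt_spec U h x] with y h1 h2
        exact congrArg₂ (· * ·) h1 h2

theorem resVF_apply (U : Opens M) (X : VectorFields E M) (f : SmoothFn E U) (x : U)
    (F : SmoothFn E M) (h : ∀ᶠ y : U in 𝓝 x, F y = f y) : resVF U X f x = X F x :=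
  apply_eq_of_germ X U f x F h

theorem resVF_zero (U : Opens M) : resVF U (0 : VectorFields E M) = 0 := rfl

theorem resVF_add (U : Opens M) (X Y : VectorFields E M) :
    resVF U (X + Y) = resVF U X + resVF U Y := rfl

theorem resVF_smul (U : Opens M) (a : SmoothFn E M) (X : VectorFields E M) :
    resVF U (a • X) = resFn U a • resVF U X := rfl

theorem resVF_lie (U : Opens M) (X Y : VectorFields E M) :
    resVF U ⁅X, Y⁆ = ⁅resVF U X, resVF U Y⁆ := by
  ext f x
  have hX : ∀ Z : VectorFields E M, ∀ᶠ y : U in 𝓝 x, Z (extendAt U f x) y = resVF U Z f y := by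
    intro Z
    filter_upwards [(extendAt_spec U f x).eventually_nhds] with y hy
    exact (resVF_apply U Z f y _ hy).symm
  have h := resVF_apply U ⁅X, Y⁆ f x _ (extendAt_spec U f x)
  rw [h, Derivation.commutator_apply, Derivation.commutator_apply]
  change X (Y (extendAt U f x)) x - Y (X (extendAt U f x)) x =
    resVF U X (resVF U Y f) x - resVF U Y (resVF U X f) x
  rw [resVF_apply U X _ x _ (hX Y), resVF_apply U Y _ x _ (hX X)]

/-- Restricting vector fields is compatible with restricting functions between open subsets. -/
theorem resVF_resOpen {U V : Opens M} (h : U ≤ V) (X : VectorFields E M) (f : SmoothFn E V) :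
    resVF U X (resOpen h f) = resOpen h (resVF V X f) := by
  ext x
  change resVF U X (resOpen h f) x = resVF V X f ⟨x, h x.2⟩
  rw [resVF_apply V X f ⟨x, h x.2⟩ _ (extendAt_spec V f ⟨x, h x.2⟩)]
  refine resVF_apply U X _ x _ ?_
  exact (continuous_inclusion h).continuousAt.eventually (extendAt_spec V f ⟨x, h x.2⟩)

end Restriction

section Cech

variable {Λ : Type*} (U : Λ → Opens M)

/-- The finite intersection `U_{a 0} ∩ … ∩ U_{a (k-1)}`. -/
def inter {k : ℕ} (a : Fin k → Λ) : Opens M :=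
  ⟨⋂ i, (U (a i) : Set M), isOpen_iInter_of_finite fun i => (U (a i)).isOpen⟩

theorem inter_le {j k : ℕ} (a : Fin k → Λ) (s : Fin j → Fin k) :
    inter U a ≤ inter U (a ∘ s) := fun _ hx =>
  Set.mem_iInter.2 fun i => Set.mem_iInter.1 hx (s i)

/-- `C^∞(Č_k U)`, where `Č_k U` is the disjoint union of all `(k+1)`-fold intersections. -/
abbrev CechFn (k : ℕ) : Type _ := ∀ a : Fin (k + 1) → Λ, SmoothFn E (inter U a)

/-- `Ω^p(Č_k U)`. -/
abbrev CechForm (E : Type*) [NormedAddCommGroup E] [NormedSpace ℝ E] {M : Type*}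
    [TopologicalSpace M] [ChartedSpace E M] {Λ : Type*} (U : Λ → Opens M) (p k : ℕ) : Type _ :=
  ∀ a : Fin (k + 1) → Λ, DiffForm E (inter U a) p

/-- The Čech differential `(δf)_{a_0 … a_{k+1}} = ∑ i, (-1)^i f_{a_0 … â_i … a_{k+1}}`. -/
def cechDiff (k : ℕ) :
    CechFn (E := E) U k →ₗ[SmoothFn E M] CechFn (E := E) U (k + 1) where
  toFun f a := ∑ i : Fin (k + 2),
    (-1 : ℝ) ^ (i : ℕ) • resOpen (inter_le U a i.succAbove) (f (a ∘ i.succAbove))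
  map_add' f h := by
    ext1 a
    simp only [Pi.add_apply, map_add, smul_add, Finset.sum_add_distrib]
  map_smul' c f := by
    ext1 a
    simp only [Pi.smul_apply, RingHom.id_apply, Finset.smul_sum]
    refine Finset.sum_congr rfl fun i _ => ?_
    rw [smul_comm]
    rfl

theorem alternating_faces {ι : Type*} {k : ℕ} (F : (Fin k → ι) → ℝ) (a : Fin (k + 2) → ι) :
    ∑ i : Fin (k + 2), ∑ j : Fin (k + 1), (-1 : ℝ) ^ (i : ℕ) * ((-1 : ℝ) ^ (j : ℕ) *
      F ((a ∘ i.succAbove) ∘ j.succAbove)) = 0 := by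
  rw [← Finset.sum_product']
  refine Finset.sum_involution (fun p _ => (p.1.succAbove p.2, p.2.predAbove p.1)) ?_ ?_
    (fun _ _ => by simp) ?_
  · rintro ⟨i, j⟩ -
    have h : (a ∘ (i.succAbove j).succAbove) ∘ (j.predAbove i).succAbove =
        (a ∘ i.succAbove) ∘ j.succAbove := by
      funext l
      simp [Fin.succAbove_succAbove_succAbove_predAbove]
    simp only [h]
    rw [← mul_assoc, ← mul_assoc, ← pow_add, ← pow_add, Fin.neg_one_pow_succAbove_add_predAbove,
      pow_add]
    ring
  · rintro ⟨i, j⟩ - - h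
    exact Fin.succAbove_ne i j (congrArg Prod.fst h)
  · rintro ⟨i, j⟩ -
    simp [Fin.succAbove_succAbove_predAbove, Fin.predAbove_predAbove_succAbove]

theorem cechDiff_cechDiff (k : ℕ) (f : CechFn (E := E) U k) :
    cechDiff U (k + 1) (cechDiff U k f) = 0 := by
  classical
  ext a x
  let F : (Fin (k + 1) → Λ) → ℝ := fun b => if h : (x : M) ∈ inter U b then f b ⟨x, h⟩ else 0
  have hF : ∀ (j : ℕ) (b : Fin j → Λ) (hb : (x : M) ∈ inter U b) (s : Fin (k + 1) → Fin j),
      f (b ∘ s) ⟨x, inter_le U b s hb⟩ = F (b ∘ s) := by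
    intro j b hb s
    simp only [F]
    rw [dif_pos (show (x : M) ∈ inter U (b ∘ s) from inter_le U b s hb)]
  refine Eq.trans ?_ (alternating_faces F a)
  let ev (V : Opens M) (z : V) : SmoothFn E V →+ ℝ := ⟨⟨fun f => f z, rfl⟩, fun _ _ => rfl⟩
  change ev _ x _ = _
  simp only [cechDiff, LinearMap.coe_mk, AddHom.coe_mk, map_sum]
  refine Finset.sum_congr rfl fun i _ => ?_
  change (-1 : ℝ) ^ (i : ℕ) * ev (inter U a) x _ = _
  rw [map_sum, Finset.mul_sum]
  refine Finset.sum_congr rfl fun j _ => ?_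
  rw [← hF _ (a ∘ i.succAbove) (inter_le U a i.succAbove x.2) j.succAbove]
  rfl

/-- Restriction `C^∞(M) → C^∞(Č_0 U)`. -/
def augment : SmoothFn E M →ₗ[SmoothFn E M] CechFn (E := E) U 0 where
  toFun f a := resFn (inter U a) f
  map_add' _ _ := rfl
  map_smul' _ _ := rfl

/-- Čech cochains `(h_k)_k`, `h_k ∈ C^∞(Č_k U)`, of all degrees. -/
abbrev CechCochains (E : Type*) [NormedAddCommGroup E] [NormedSpace ℝ E] {M : Type*}
    [TopologicalSpace M] [ChartedSpace E M] {Λ : Type*} (U : Λ → Opens M) : Type _ :=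
  ∀ k : ℕ, CechFn (E := E) U k

/-- The Čech differential on cochains of all degrees, `(δh)_{k+1} = δ(h_k)` and `(δh)_0 = 0`. -/
def totalCechDiff (h : CechCochains E U) : CechCochains E U
  | 0 => 0
  | k + 1 => cechDiff U k (h k)

variable [FiniteDimensional ℝ E] [IsManifold (modelWithCornersSelf ℝ E) ∞ M] [T2Space M]

/-- The Lie derivative of a function on `Č_k U` along a vector field on `M`. -/
def lieCech {k : ℕ} (X : VectorFields E M) (f : CechFn (E := E) U k) : CechFn (E := E) U k :=
  fun a => resVF (inter U a) X (f a)

variable {U}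

/-- Evaluation of a form on `Č_k U` on vector fields on `M`. -/
def CechForm.eval {p k : ℕ} (η : CechForm E U p k) (X : Fin p → VectorFields E M) :
    CechFn (E := E) U k :=
  fun a => η a fun i => resVF (inter U a) (X i)

/-- Evaluation of the exterior derivative of a form on `Č_k U` on vector fields on `M`. -/
def CechForm.extEval {p k : ℕ} (η : CechForm E U p k) (X : Fin (p + 1) → VectorFields E M) :
    CechFn (E := E) U k :=
  fun a => exteriorDeriv (η a) fun i => resVF (inter U a) (X i)

end Cech

section U1

/-- Smooth functions with values in `U(1)`. -/
abbrev CircleFn (E : Type*) [NormedAddCommGroup E] [NormedSpace ℝ E]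
    (N : Type*) [TopologicalSpace N] [ChartedSpace E N] : Type _ :=
  C^∞⟮modelWithCornersSelf ℝ E, N; 𝓡 1, Circle⟯

theorem contMDiff_circle_coe : ContMDiff (𝓡 1) 𝓘(ℝ, ℂ) ∞ (fun z : Circle => (z : ℂ)) :=
  have : Fact (Module.finrank ℝ ℂ = 1 + 1) := finrank_real_complex_fact'
  contMDiff_coe_sphere (E := ℂ)

/-- The real part of a `U(1)`-valued function. -/
def reFn (g : CircleFn E M) : SmoothFn E M :=
  ⟨fun x => (g x : ℂ).re,
    Complex.reCLM.contDiff.contMDiff.comp (contMDiff_circle_coe.comp g.contMDiff)⟩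

/-- The imaginary part of a `U(1)`-valued function. -/
def imFn (g : CircleFn E M) : SmoothFn E M :=
  ⟨fun x => (g x : ℂ).im,
    Complex.imCLM.contDiff.contMDiff.comp (contMDiff_circle_coe.comp g.contMDiff)⟩

theorem re_sq_add_im_sq (g : CircleFn E M) : reFn g * reFn g + imFn g * imFn g = 1 := by
  ext x
  have h := Circle.normSq_coe (g x)
  rw [Complex.normSq_apply] at h
  exact h

/-- The real one-form `d log g = (2πi)⁻¹ g⁻¹ dg`, for `U(1) = ℝ/ℤ`, evaluated on a vector field:
with `g = u + iv` it is `(2π)⁻¹ (u dv - v du)`. -/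
def dlog (g : CircleFn E M) (X : VectorFields E M) : SmoothFn E M :=
  (2 * Real.pi)⁻¹ • (reFn g * X (imFn g) - imFn g * X (reFn g))

theorem dlog_lie (g : CircleFn E M) (X Y : VectorFields E M) :
    dlog g ⁅X, Y⁆ = X (dlog g Y) - Y (dlog g X) := by
  have h := re_sq_add_im_sq g
  have hX := congrArg X h
  have hY := congrArg Y h
  simp only [map_add, Derivation.leibniz, smul_eq_mul, Derivation.map_one_eq_zero] at hX hY
  simp only [dlog, Derivation.map_smul, map_sub, Derivation.leibniz, smul_eq_mul,
    Derivation.commutator_apply]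
  rw [← smul_sub]
  congr 1
  set u := reFn g
  set v := imFn g
  have half : ∀ w : SmoothFn E M, w + w = 0 → w = 0 := by
    intro w hw
    ext x
    have : w x + w x = 0 := congrArg (fun f => f x) hw
    change w x = 0
    linarith
  have eX : u * X u + v * X v = 0 := half _ (by linear_combination hX)
  have eY : u * Y u + v * Y v = 0 := half _ (by linear_combination hY)
  have e : X u * Y v - X v * Y u = 0 := by
    linear_combination (-(X u * Y v - X v * Y u)) * h + (u * Y v - v * Y u) * eX
      + (v * X u - u * X v) * eY
  linear_combination (-2) * e

variable {Λ : Type*} (U : Λ → Opens M)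

/-- `U(1)`-valued Čech `k`-cochains. -/
abbrev CircleCochain (E : Type*) [NormedAddCommGroup E] [NormedSpace ℝ E] {M : Type*}
    [TopologicalSpace M] [ChartedSpace E M] {Λ : Type*} (U : Λ → Opens M) (k : ℕ) : Type _ :=
  ∀ a : Fin (k + 1) → Λ, CircleFn E (inter U a)

variable {U}

/-- The cocycle condition `δg = 1`. -/
def IsCocycle {k : ℕ} (g : CircleCochain E U k) : Prop :=
  ∀ (a : Fin (k + 2) → Λ) (x : M) (hx : x ∈ inter U a),
    ∏ i : Fin (k + 2),
      g (a ∘ i.succAbove) ⟨x, inter_le U a i.succAbove hx⟩ ^ ((-1 : ℤ) ^ (i : ℕ)) = 1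

variable [FiniteDimensional ℝ E] [IsManifold (modelWithCornersSelf ℝ E) ∞ M] [T2Space M]

/-- `d log g` evaluated on a vector field on `M`. -/
def cechDlog {k : ℕ} (g : CircleCochain E U k) : 
    VectorFields E M →ₗ[SmoothFn E M] CechFn (E := E) U k where
  toFun X a := dlog (g a) (resVF (inter U a) X)
  map_add' X Y := by
    ext1 a
    simp only [dlog, resVF_add, Derivation.add_apply, Pi.add_apply, ← smul_add]
    congr 1
    ring
  map_smul' c X := by
    ext1 a
    simp only [dlog, resVF_smul, Derivation.smul_apply, smul_eq_mul, Pi.smul_apply,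
      RingHom.id_apply, Algebra.smul_def]
    change _ = resFn (inter U a) c * _
    ring

theorem cechDlog_lie {k : ℕ} (g : CircleCochain E U k) (X Y : VectorFields E M) :
    cechDlog g ⁅X, Y⁆ = lieCech U X (cechDlog g Y) - lieCech U Y (cechDlog g X) := by
  ext1 a
  change dlog (g a) (resVF (inter U a) ⁅X, Y⁆) = _
  rw [resVF_lie, dlog_lie]
  rfl

theorem lieCech_cechDiff {k : ℕ} (X : VectorFields E M) (f : CechFn (E := E) U k) :
    lieCech U X (cechDiff U k f) = cechDiff U k (lieCech U X f) := by
  ext1 a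
  simp only [lieCech, cechDiff, LinearMap.coe_mk, AddHom.coe_mk, map_sum, Derivation.map_smul]
  refine Finset.sum_congr rfl fun i _ => ?_
  rw [resVF_resOpen]

end U1

section Atiyah

/-- `At_{n-1}(H)` for an `(n+1)`-form `H`, where `n = m + 1`: the graded module
`TM ⊕ C^∞(M)[n-1]` with zero differential, anchor the projection, binary bracket given by the Lie
bracket and `[X, f] = X f` (hence `(-1)^n X f` for the shifted arguments in the order `f, X`), and
`(n+1)`-ary bracket `H(X_1, …, X_{n+1})`. -/
def atiyah {m : ℕ} (H : DiffForm E M (m + 2)) : PreLInftyAlgebroid (SmoothFn E M) where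
  carrier := VectorFields E M × SmoothFn E M
  deg i :=
    { carrier := {x | (i ≠ 0 → x.1 = 0) ∧ (i ≠ -m → x.2 = 0)}
      add_mem' := by
        rintro x y ⟨h1, h2⟩ ⟨h3, h4⟩
        exact ⟨fun h => by simp [h1 h, h3 h], fun h => by simp [h2 h, h4 h]⟩
      zero_mem' := ⟨fun _ => rfl, fun _ => rfl⟩
      smul_mem' := by
        rintro c x ⟨h1, h2⟩
        exact ⟨fun h => by simp [h1 h], fun h => by simp [h2 h]⟩ }
  bracket k x :=
    (if h : k = 2 then
      let v := x (Fin.cast h.symm 0)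
      let w := x (Fin.cast h.symm 1)
      (⁅v.1, w.1⁆, v.1 w.2 + (-1 : ℝ) ^ (m + 1) • w.1 v.2)
    else 0) +
    (if h : k = m + 2 then (0, H fun i => (x (Fin.cast h.symm i)).1) else 0)
  anchor := LinearMap.fst _ _ _

variable {Λ : Type*} {U : Λ → Opens M}
variable [FiniteDimensional ℝ E] [IsManifold (modelWithCornersSelf ℝ E) ∞ M] [T2Space M]

/-- The module underlying `ČAt(g)`, for a `U(1)`-valued Čech `n`-cochain `g`, `n = m + 1`: families
`(X, h_0, …, h_{n-1})` with `h_k ∈ C^∞(Č_k U)` and `d log g (X) = δ h_{n-1}`, i.e. the sum of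
`C^∞(Č_k U)`, `k < n - 1`, and of `E_{n-1}(g)`. -/
def cechAtiyahModule {m : ℕ} (g : CircleCochain E U (m + 1)) :
    Submodule (SmoothFn E M) (VectorFields E M × CechCochains E U) where
  carrier := {x | (∀ k, m < k → x.2 k = 0) ∧ cechDlog g x.1 = cechDiff U m (x.2 m)}
  add_mem' := by
    rintro x y ⟨h1, h2⟩ ⟨h3, h4⟩
    exact ⟨fun k hk => by simp [h1 k hk, h3 k hk], by simp [h2, h4]⟩
  zero_mem' := ⟨fun _ _ => rfl, by simp⟩
  smul_mem' := by
    rintro c x ⟨h1, h2⟩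
    exact ⟨fun k hk => by simp [h1 k hk], by simp [h2]⟩

/-- The differential of `ČAt(g)`: it vanishes on `E_{n-1}(g)` and is `(-1)^(n-k) δ` on
`C^∞(Č_k U)`, `k < n - 1`. In terms of `m = n - 1` and the target index `k`, the sign is
`(-1)^(m+k)`. -/
def cechAtiyahDiff {m : ℕ} (g : CircleCochain E U (m + 1)) (x : cechAtiyahModule g) :
    cechAtiyahModule g :=
  ⟨(0, fun k => if k ≤ m then (-1 : ℝ) ^ (m + k) • totalCechDiff U x.1.2 k else 0), by
    refine ⟨fun k hk => if_neg (not_le.2 hk), ?_⟩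
    rw [map_zero]
    simp only [le_refl, if_true]
    have h : cechDiff U m (totalCechDiff U x.1.2 m) = 0 := by
      cases m with
      | zero => exact map_zero _
      | succ k => exact cechDiff_cechDiff U k _
    rw [LinearMap.map_smul_of_tower, h, smul_zero]⟩

/-- The binary bracket of `ČAt(g)`, on shifted arguments: `[(X, f), (Y, h)] = ([X, Y], X h - Y f)`
in degree zero, `[(X, f), h] = X h` for `h` in negative degree, hence `(-1)^(n-k) X h` for
`h ∈ C^∞(Č_k U)` and the order `h, (X, f)` of the shifted arguments, and zero if both arguments have
negative degree. -/
def cechAtiyahBracket {m : ℕ} (g : CircleCochain E U (m + 1)) (x y : cechAtiyahModule g) :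
    cechAtiyahModule g :=
  ⟨(⁅x.1.1, y.1.1⁆, fun k =>
      lieCech U x.1.1 (y.1.2 k) + (-1 : ℝ) ^ (m + 1 + k) • lieCech U y.1.1 (x.1.2 k)), by
    obtain ⟨⟨X, f⟩, hf, hX⟩ := x
    obtain ⟨⟨Y, h⟩, hh, hY⟩ := y
    dsimp only at hf hX hh hY ⊢
    refine ⟨fun k hk => ?_, ?_⟩
    · have e : ∀ Z : VectorFields E M, lieCech U Z (0 : CechFn (E := E) U k) = 0 := fun Z => by
        ext1 a
        exact map_zero (resVF (inter U a) Z)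
      simp only [hf k hk, hh k hk, e, smul_zero, add_zero]
    · have e : (-1 : ℝ) ^ (m + 1 + m) = -1 := by
        rw [show m + 1 + m = 2 * m + 1 by ring, pow_succ, pow_mul]
        simp
      simp only [e, neg_smul, one_smul]
      rw [cechDlog_lie, hX, hY, lieCech_cechDiff, lieCech_cechDiff, map_add, map_neg,
        sub_eq_add_neg]⟩

/-- The Čech–Atiyah dg Lie algebroid `ČAt(g)` of a `U(1)`-valued Čech `n`-cochain `g`, `n = m + 1`:
`C^∞(Č_k U)` has degree `k - (n - 1)` for `k < n - 1`, and `E_{n-1}(g)` has degree zero. -/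
def cechAtiyah {m : ℕ} (g : CircleCochain E U (m + 1)) :
    PreLInftyAlgebroid (SmoothFn E M) where
  carrier := cechAtiyahModule g
  deg i :=
    { carrier := {x | (i ≠ 0 → x.1.1 = 0) ∧ ∀ k : ℕ, (k : ℤ) ≠ m + i → x.1.2 k = 0}
      add_mem' := by
        rintro x y ⟨h1, h2⟩ ⟨h3, h4⟩
        exact ⟨fun h => by simp [h1 h, h3 h], fun k h => by simp [h2 k h, h4 k h]⟩
      zero_mem' := ⟨fun _ => rfl, fun _ _ => rfl⟩
      smul_mem' := by
        rintro c x ⟨h1, h2⟩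
        exact ⟨fun h => by simp [h1 h], fun k h => by simp [h2 k h]⟩ }
  bracket k x :=
    if h : k = 1 then cechAtiyahDiff g (x (Fin.cast h.symm 0))
    else if h : k = 2 then
      cechAtiyahBracket g (x (Fin.cast h.symm 0)) (x (Fin.cast h.symm 1))
    else 0
  anchor := LinearMap.fst _ _ _ ∘ₗ (cechAtiyahModule g).subtype

/-- A full connection `(A^(1), …, A^(n))`, `A^(p) ∈ Ω^p(Č_{n-p} U)`, on a `U(1)`-valued Čech
`n`-cochain `g`, `n = m + 1`, i.e. an enhancement of `g` to a full Čech–Deligne cochain that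
satisfies `d log g = δ A^(1)` and `d A^(p-1) + (-1)^p δ A^(p) = 0` for `2 ≤ p ≤ n`. Here
`form q k = A^(q+1)`, where `q + k = m`. Forms on open subsets are determined by their values on
restrictions of vector fields on `M`, and the Čech differential of forms satisfies
`(δη)(X_1, …) = δ(η(X_1, …))`. -/
structure FullConnection {m : ℕ} (g : CircleCochain E U (m + 1)) where
  form : ∀ q k : ℕ, q + k = m → CechForm E U (q + 1) k
  dlog_eq : ∀ X : Fin 1 → VectorFields E M,
    cechDlog g (X 0) = cechDiff U m ((form 0 m (zero_add m)).eval X)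
  deligne : ∀ (q k : ℕ) (h : q + (k + 1) = m) (X : Fin (q + 2) → VectorFields E M),
    (form q (k + 1) h).extEval X +
      (-1 : ℝ) ^ (q + 2) • cechDiff U k ((form (q + 1) k (by omega)).eval X) = 0

/-- The connection has curvature `H`: `d A^(n)` is the restriction of `H` to the open cover. -/
def FullConnection.HasCurvature {m : ℕ} {g : CircleCochain E U (m + 1)} (𝒜 : FullConnection g)
    (H : DiffForm E M (m + 2)) : Prop :=
  ∀ X : Fin (m + 2) → VectorFields E M,
    (𝒜.form m 0 (add_zero m)).extEval X = augment U (H X)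

/-- The formula for the maps `At_{n-1}(H)^{⊗ k} → ČAt(g)` induced by a full connection:
`X ↦ (X, A^(1)(X))` and `f ↦ δf ∈ C^∞(Č_0 U)` for `k = 1`, and
`(X_1, …, X_k) ↦ A^(k)(X_1, …, X_k) ∈ C^∞(Č_{n-k} U)` for `2 ≤ k ≤ n`. -/
def FullConnection.inducedMap {m : ℕ} {g : CircleCochain E U (m + 1)} (𝒜 : FullConnection g) :
    ∀ k : ℕ, (Fin k → VectorFields E M × SmoothFn E M) → VectorFields E M × CechCochains E U
  | 0, _ => 0
  | q + 1, x =>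
    (if q = 0 then (x 0).1 else 0, fun j =>
      if h : q + j = m then (𝒜.form q j h).eval fun i => (x i).1 else 0) +
    (0, if q = 0 then Pi.single 0 (augment U (x 0).2) else 0)

end Atiyah
end Manifold
end CechAtiyah

end

/-! The Maurer–Cartan equation of the induced map is the list of Deligne equations, written out on
vector fields. Take arity $q+2$ and the component in $C^\infty(\check C_j\,\mathcal U)$. The
differential applied to $\Phi_{q+2}$ gives $(-1)^q\check\delta A^{(q+2)}$. The brackets of $\Phi_1$
with $\Phi_{q+1}$ give the terms $\pm X_i(A^{(q+1)}(\dots))$ of the global formula for $\mathrm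
dA^{(q+1)}$. On the other side, Lie brackets inserted into $\Phi_{q+1}$ give the negative of the
remaining terms of that formula, and $H$ enters through $\Phi_1$ in arity $n+1$. Forms contribute
only if $q+j=n-1$. There the equation reads $\mathrm dA^{(q+1)}+(-1)^q\check\delta A^{(q+2)}=0$ for
$j>0$ and $\mathrm dA^{(n)}=H$ for $j=0$. The terms that come from functions on $M$ cancel because
restriction commutes with derivations. The equation $\mathrm d\log g=\check\delta A^{(1)}$ plays
another role: it places $(X,A^{(1)}(X))$ in $E_{n-1}(g)$. The pieces are `cechEntry_blockSum`,
`cechEntry_shuffleSum` and `cechEntry_diff_inducedComp`, and they meet in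
`inducedComp_maurerCartan`.

For $\mathrm{At}_{n-1}(H)$ the Jacobi identities split into three parts: the identity for a
semidirect product, the composite of $H$ with itself, which is zero, and the mixed terms, which add
up to $-\mathrm dH$ (`shuffleSum_atiyahLie_atiyahForm`). For $\check{\mathrm C}\mathrm{At}(g)$ one
uses a semidirect product over each intersection (`semidirectBracket_jacobi`), $\check\delta^2=0$,
and the fact that $\check\delta$ commutes with Lie derivatives (`cechAtiyahDiff_bracket`).

Signs stay manageable because forms vanish unless all arguments have a vector field component. On
homogeneous tuples this forces degree zero, where the Koszul sign just counts inversions.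

For the quasi-isomorphism, a partition of unity contracts the Čech complex, which therefore resolves
$C^\infty(M)$ (`cechDiff_exact`, `exists_augment_eq`). Subtracting $(X,A^{(1)}(X))$ from a closed
element leaves a Čech cocycle, which is either exact or the restriction of a function on $M$. -/

noncomputable section

namespace CechAtiyah

/-! ### Koszul signs of tuples of degree zero -/

section Signs

theorem neg_one_pow_units_smul {W : Type*} [AddCommGroup W] [Module ℝ W] (n : ℕ) (w : W) :
    ((-1 : ℤˣ) ^ n) • w = ((-1 : ℝ) ^ n) • w := by
  rcases Nat.even_or_odd n with h | h
  · simp [h.neg_one_pow]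
  · simp [h.neg_one_pow]

theorem koszulSign_of_monotone {k : ℕ} {ι : Type*} [LinearOrder ι] {p : Fin k → ι}
    (hp : Monotone p) (d : Fin k → ℤ) : koszulSign p d = 1 :=
  Finset.prod_eq_one fun _ _ => Finset.prod_eq_one fun _ _ =>
    if_neg fun h => (hp h.1.le).not_gt h.2

/-- Shifted elements of degree zero are odd, so every inversion costs a sign. The later index of a
pair becomes the outer one, as in `Equiv.Perm.sign_eq_prod_prod_Iio`. -/
theorem koszulSign_degree_zero {k : ℕ} {ι : Type*} [LinearOrder ι] (p : Fin k → ι) :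
    koszulSign p 0 = ∏ b, ∏ a, if a < b ∧ p b < p a then (-1 : ℤˣ) else 1 := by
  rw [koszulSign, Finset.prod_comm]
  simp

theorem koszulSign_perm {k : ℕ} (σ : Equiv.Perm (Fin k)) :
    koszulSign σ 0 = Equiv.Perm.sign σ := by
  rw [koszulSign_degree_zero, Equiv.Perm.sign_eq_prod_prod_Iio]
  refine Finset.prod_congr rfl fun b _ => ?_
  rw [← Finset.prod_subset (Finset.subset_univ (Finset.Iio b))]
  · refine Finset.prod_congr rfl fun a ha => ?_
    have hab := Finset.mem_Iio.1 ha
    by_cases h : σ a < σ b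
    · simp [h, h.not_gt]
    · have h' : σ b < σ a := lt_of_le_of_ne (not_lt.1 h) fun e => hab.ne' (σ.injective e)
      simp [h, h', hab]
  · intro a _ ha
    rw [if_neg]
    simpa using fun h : a < b => absurd (Finset.mem_Iio.2 h) ha

theorem prod_ite_lt {k : ℕ} (i : Fin k) :
    (∏ a, if a < i then (-1 : ℤˣ) else 1) = (-1) ^ (i : ℕ) := by
  rw [Finset.prod_ite, Finset.prod_const, Finset.prod_const_one, mul_one]
  congr 1
  rw [← Fin.card_Iio i]
  congr 1
  ext; simp

/-- Moving the `i`-th of several elements of degree zero to the front. -/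
theorem koszulSign_to_front {k : ℕ} {ι : Type*} [LinearOrder ι] {p : Fin k → ι} (i : Fin k)
    (h1 : ∀ a, a ≠ i → p i < p a) (h2 : ∀ a b, a ≠ i → b ≠ i → p a = p b) :
    koszulSign p 0 = (-1) ^ (i : ℕ) := by
  rw [koszulSign_degree_zero, Finset.prod_eq_single i, ← prod_ite_lt]
  · refine Finset.prod_congr rfl fun a _ => ?_
    by_cases h : a < i
    · simp [h, h1 a h.ne]
    · simp [h]
  · intro b _ hb
    refine Finset.prod_eq_one fun a _ => if_neg fun h => ?_
    by_cases ha : a = i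
    · exact (h1 b hb).not_gt (ha ▸ h.2)
    · exact h.2.ne (h2 b a hb ha)
  · simp

/-- Moving the `i`-th of several elements of degree zero to the end. -/
theorem koszulSign_to_end {n : ℕ} {ι : Type*} [LinearOrder ι] {p : Fin (n + 1) → ι}
    (i : Fin (n + 1)) (h1 : ∀ a, a ≠ i → p a < p i) (h2 : ∀ a b, a ≠ i → b ≠ i → p a = p b) :
    koszulSign p 0 = (-1) ^ (n + i : ℕ) := by
  rw [koszulSign_degree_zero, Finset.prod_comm, Finset.prod_eq_single i]
  · have e : ∀ b : Fin (n + 1), (if i < b ∧ p b < p i then (-1 : ℤˣ) else 1) =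
        (if b < i then -1 else 1) * ((if b = i then -1 else 1) * (-1)) := by
      intro b
      rcases lt_trichotomy b i with h | h | h
      · simp [h, h.not_gt, h.ne]
      · simp [h]
      · simp [h, h.not_gt, h.ne', h1 b h.ne']
    simp only [e, Finset.prod_mul_distrib, prod_ite_lt, Finset.prod_ite_eq', Finset.mem_univ,
      if_true, Finset.prod_const, Finset.card_univ, Fintype.card_fin]
    rw [pow_succ, pow_add]
    simp [mul_comm]
  · intro b _ hb
    refine Finset.prod_eq_one fun a _ => if_neg fun h => ?_
    by_cases ha : a = i
    · exact (h1 b hb).not_gt (ha ▸ h.2)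
    · exact h.2.ne (h2 a b ha hb)
  · simp

/-- Moving the `i`-th and the `j`-th of several elements of degree zero to the front. -/
theorem koszulSign_pair {k : ℕ} {i j : Fin k} (hij : i < j) :
    koszulSign (fun a => if a ∈ ({i, j} : Finset (Fin k)) then 0 else 1) 0 =
      -((-1) ^ (i : ℕ) * (-1) ^ (j : ℕ)) := by
  rw [koszulSign_degree_zero, ← Finset.prod_subset (Finset.subset_univ {i, j}),
    Finset.prod_pair hij.ne]
  · have e1 : ∀ a, (if a < i ∧ (if i ∈ ({i, j} : Finset (Fin k)) then 0 else 1) <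
        (if a ∈ ({i, j} : Finset (Fin k)) then 0 else 1) then (-1 : ℤˣ) else 1) =
        if a < i then -1 else 1 := by
      intro a
      by_cases h : a < i
      · simp [h, h.ne, (h.trans hij).ne]
      · simp [h]
    -- The index `i` moves to the front too and stays before `j`, so `j` passes only `j - 1`
    -- elements. The factor for `a = i` corrects the count.
    have e2 : ∀ a, (if a < j ∧ (if j ∈ ({i, j} : Finset (Fin k)) then 0 else 1) <
        (if a ∈ ({i, j} : Finset (Fin k)) then 0 else 1) then (-1 : ℤˣ) else 1) =
        (if a < j then -1 else 1) * (if a = i then -1 else 1) := by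
      intro a
      by_cases h : a < j
      · by_cases h' : a = i
        · simp [h', hij]
        · simp [h, h.ne, h']
      · have : a ≠ i := fun e => h (e ▸ hij)
        simp [h, this]
    simp only [e1, e2, Finset.prod_mul_distrib, prod_ite_lt, Finset.prod_ite_eq',
      Finset.mem_univ, if_true]
    simp
  · intro b _ hb
    refine Finset.prod_eq_one fun a _ => if_neg fun h => ?_
    rw [if_neg hb] at h
    split_ifs at h <;> omega

end Signs

/-! ### Subtuples, and the removal of one or two arguments -/

section Subtuples

variable {V W : Type*}

/-- The arity `S.card` is only propositionally equal to `n`, so values are compared for a whole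
family `B` of operations. The increasing enumeration of `S` is unique. -/
theorem apply_subtuple {k n : ℕ} (B : ∀ k : ℕ, (Fin k → V) → W) (x : Fin k → V)
    (S : Finset (Fin k)) (e : S.card = n) (f : Fin n → Fin k) (hf : StrictMono f)
    (hS : ∀ i, f i ∈ S) : B S.card (subtuple x S) = B n (x ∘ f) := by
  subst e
  rw [Finset.orderEmbOfFin_unique rfl hS hf]
  rfl

theorem apply_subtuple_univ {k : ℕ} (B : ∀ k : ℕ, (Fin k → V) → W) (x : Fin k → V) :
    B (Finset.univ : Finset (Fin k)).card (subtuple x Finset.univ) = B k x :=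
  apply_subtuple B x _ (by simp) id strictMono_id fun _ => Finset.mem_univ _

theorem apply_subtuple_singleton {k : ℕ} (B : ∀ k : ℕ, (Fin k → V) → W) (x : Fin k → V)
    (i : Fin k) : B ({i} : Finset (Fin k)).card (subtuple x {i}) = B 1 fun _ => x i :=
  apply_subtuple B x _ (by simp) (fun _ => i) (Subsingleton.strictMono _) fun _ => by simp

theorem apply_subtuple_pair {k : ℕ} (B : ∀ k : ℕ, (Fin k → V) → W) (x : Fin k → V)
    {i j : Fin k} (hij : i < j) :
    B ({i, j} : Finset (Fin k)).card (subtuple x {i, j}) = B 2 ![x i, x j] := by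
  rw [apply_subtuple B x _ (Finset.card_pair hij.ne) ![i, j]]
  · congr 1
    ext l
    fin_cases l <;> rfl
  · intro a b hab
    fin_cases a <;> fin_cases b <;> first | exact absurd hab (by decide) | exact hij
  · intro l
    fin_cases l <;> simp

theorem apply_subtuple_compl_singleton {n : ℕ} (B : ∀ k : ℕ, (Fin k → V) → W)
    (x : Fin (n + 1) → V) (i : Fin (n + 1)) :
    B ({i}ᶜ : Finset (Fin (n + 1))).card (subtuple x {i}ᶜ) = B n (i.removeNth x) :=
  apply_subtuple B x _ (by simp [Finset.card_compl]) i.succAbove (Fin.strictMono_succAbove i)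
    fun l => by simp [Fin.succAbove_ne]

/-- Writing the second index as `j.succAbove l` turns the complement of the pair into an iterated
removal, the form in which alternating maps move an argument to the front. -/
theorem apply_subtuple_compl_pair {n : ℕ} (B : ∀ k : ℕ, (Fin k → V) → W)
    (x : Fin (n + 2) → V) (j : Fin (n + 2)) (l : Fin (n + 1)) :
    B ({j.succAbove l, j}ᶜ : Finset (Fin (n + 2))).card (subtuple x {j.succAbove l, j}ᶜ) =
      B n (l.removeNth (j.removeNth x)) := by
  refine apply_subtuple B x _ ?_ (j.succAbove ∘ l.succAbove)
    ((Fin.strictMono_succAbove j).comp (Fin.strictMono_succAbove l)) fun i => ?_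
  · rw [Finset.card_compl, Finset.card_pair (Fin.succAbove_ne j l)]
    simp
  · simp [Fin.succAbove_ne]

theorem sum_card_two {N : Type*} [AddCommMonoid N] {k : ℕ} (F : Finset (Fin k) → N) :
    ∑ S : Finset (Fin k) with S.card = 2, F S =
      ∑ j : Fin k, ∑ i ∈ Finset.univ.filter (· < j), F {i, j} := by
  rw [Finset.sum_sigma']
  symm
  refine Finset.sum_bij (fun p _ => {p.2, p.1}) ?_ ?_ ?_ ?_
  · rintro ⟨j, i⟩ h
    have h : i < j := by simpa using h
    simpa using Finset.card_pair h.ne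
  · rintro ⟨j, i⟩ h ⟨j', i'⟩ h' e
    have h : i < j := by simpa using h
    have h' : i' < j' := by simpa using h'
    have e : ({i, j} : Finset (Fin k)) = {i', j'} := e
    have m1 : i ∈ ({i', j'} : Finset (Fin k)) := e ▸ by simp
    have m2 : j ∈ ({i', j'} : Finset (Fin k)) := e ▸ by simp
    have m3 : i' ∈ ({i, j} : Finset (Fin k)) := e ▸ by simp
    have m4 : j' ∈ ({i, j} : Finset (Fin k)) := e ▸ by simp
    simp only [Finset.mem_insert, Finset.mem_singleton] at m1 m2 m3 m4
    have : i = i' ∧ j = j' := by omega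
    obtain ⟨rfl, rfl⟩ := this
    rfl
  · intro S hS
    obtain ⟨a, b, hab, rfl⟩ := Finset.card_eq_two.1 (Finset.mem_filter.1 hS).2
    rcases lt_or_gt_of_ne hab with h | h
    · exact ⟨⟨b, a⟩, by simpa using h, rfl⟩
    · exact ⟨⟨a, b⟩, by simpa using h, Finset.pair_comm _ _⟩
  · intros; rfl

theorem sum_card_compl {N : Type*} [AddCommMonoid N] {n : ℕ} (F : Finset (Fin (n + 1)) → N) :
    ∑ S : Finset (Fin (n + 1)) with S.card = n, F S = ∑ i, F {i}ᶜ := by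
  symm
  refine Finset.sum_bij (fun i _ => {i}ᶜ) ?_ ?_ ?_ ?_
  · intro i _
    simp [Finset.card_compl]
  · intro i _ j _ h
    simpa using h
  · intro S hS
    have h : Sᶜ.card = 1 := by
      rw [Finset.card_compl, (Finset.mem_filter.1 hS).2]
      simp
    obtain ⟨i, hi⟩ := Finset.card_eq_one.1 h
    exact ⟨i, Finset.mem_univ _, by rw [← hi, compl_compl]⟩
  · intros; rfl

/-- The tuple with the `i`-th entry replaced and the `j`-th entry removed, `i < j`, up to moving
the replaced entry to the front. -/
theorem alternating_removeNth_update {R L N : Type*} [CommRing R] [AddCommGroup L] [Module R L]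
    [AddCommGroup N] [Module R N] {n : ℕ} (η : L [⋀^Fin (n + 1)]→ₗ[R] N) (X : Fin (n + 2) → L)
    (j : Fin (n + 2)) (l : Fin (n + 1)) (v : L) :
    η (j.removeNth (Function.update X (j.succAbove l) v)) =
      (-1) ^ (l : ℕ) • η (Fin.cons v (l.removeNth (j.removeNth X))) := by
  have : j.removeNth (Function.update X (j.succAbove l) v) =
      l.insertNth v (l.removeNth (j.removeNth X)) := by
    rw [Fin.insertNth_removeNth]
    funext i
    by_cases h : i = l
    · subst h
      simp [Fin.removeNth]
    · simp [Fin.removeNth, h]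
  rw [this, AlternatingMap.map_insertNth]
  rfl

/-- The signs of the second sum in the formula for the exterior derivative. -/
theorem koszulSign_pair_smul {R L N : Type*} [CommRing R] [AddCommGroup L] [Module R L]
    [AddCommGroup N] [Module R N] [Module ℝ N] {n : ℕ} (η : L [⋀^Fin (n + 1)]→ₗ[R] N)
    (C : ∀ k : ℕ, (Fin k → V) → N) (π : V → L) (hC : ∀ y, C (n + 1) y = η (π ∘ y))
    (x : Fin (n + 2) → V) {i j : Fin (n + 2)} (hij : i < j) (v : V) :
    koszulSign (fun a => if a ∈ ({i, j} : Finset (Fin (n + 2))) then 0 else 1) 0 •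
      C (({i, j}ᶜ : Finset (Fin (n + 2))).card + 1) (Fin.cons v (subtuple x {i, j}ᶜ)) =
    -((-1 : ℝ) ^ (j : ℕ) • η (j.removeNth (Function.update (π ∘ x) i (π v)))) := by
  obtain ⟨l, rfl⟩ := Fin.exists_succAbove_eq hij.ne
  rw [koszulSign_pair hij, apply_subtuple_compl_pair (fun k y => C (k + 1) (Fin.cons v y)), hC,
    alternating_removeNth_update]
  -- Since `i < j`, removing `j` does not change the position of `i`. Hence `(-1)^l` cancels the
  -- `(-1)^i` of the Koszul sign and `-(-1)^j` is left.
  have hl : ((j.succAbove l : Fin (n + 2)) : ℕ) = l := by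
    rw [Fin.succAbove_of_castSucc_lt]
    · rfl
    · by_contra h
      rw [Fin.succAbove_of_le_castSucc _ _ (not_lt.1 h), Fin.lt_def] at hij
      rw [not_lt, Fin.le_def] at h
      simp at hij h
      omega
  have hc : π ∘ (Fin.cons v (l.removeNth (j.removeNth x)) : Fin (n + 1) → V) =
      Fin.cons (π v) (l.removeNth (j.removeNth (π ∘ x))) := by
    funext i
    refine Fin.cases ?_ (fun i => ?_) i <;> rfl
  rw [hl, hc, mul_comm, Units.neg_smul, mul_smul, neg_one_pow_units_smul]
  congr 2

end Subtuples

/-! ### Families of operations and sums over shuffles -/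

section Families

variable {V W : Type*} [AddCommGroup W]

/-- The family of operations whose only nonzero member is the `n`-ary operation `B`. -/
def singleArity (n : ℕ) (B : (Fin n → V) → W) : ∀ k : ℕ, (Fin k → V) → W :=
  fun k x => if h : k = n then B fun i => x (Fin.cast h.symm i) else 0

theorem singleArity_self (n : ℕ) (B : (Fin n → V) → W) : singleArity n B n = B := by
  funext x
  simp [singleArity]

theorem singleArity_ne {n k : ℕ} (B : (Fin n → V) → W) (h : k ≠ n) (x : Fin k → V) :
    singleArity n B k x = 0 := dif_neg h

/-- The sum of two families of operations. -/
def addFamily (B C : ∀ k : ℕ, (Fin k → V) → W) : ∀ k : ℕ, (Fin k → V) → W :=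
  fun k x => B k x + C k x

theorem exists_multilinear_singleArity (R : Type*) [CommRing R] [AddCommGroup V] [Module R V]
    [Module R W] {n : ℕ} {B : (Fin n → V) → W}
    (h : ∃ F : MultilinearMap R (fun _ : Fin n => V) W, ⇑F = B) (k : ℕ) :
    ∃ F : MultilinearMap R (fun _ : Fin k => V) W, ⇑F = singleArity n B k := by
  by_cases hk : k = n
  · subst hk
    rwa [singleArity_self]
  · exact ⟨0, by funext x; exact (singleArity_ne B hk x).symm⟩

theorem exists_multilinear_addFamily (R : Type*) [CommRing R] [AddCommGroup V] [Module R V]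
    [Module R W] {k : ℕ} {B C : ∀ k : ℕ, (Fin k → V) → W}
    (hB : ∃ F : MultilinearMap R (fun _ : Fin k => V) W, ⇑F = B k)
    (hC : ∃ F : MultilinearMap R (fun _ : Fin k => V) W, ⇑F = C k) :
    ∃ F : MultilinearMap R (fun _ : Fin k => V) W, ⇑F = addFamily B C k := by
  obtain ⟨F, hF⟩ := hB
  obtain ⟨G, hG⟩ := hC
  refine ⟨F + G, ?_⟩
  funext x
  rw [addFamily, ← hF, ← hG]
  rfl

theorem exists_multilinear_one (R : Type*) [CommRing R] [AddCommGroup V] [Module R V]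
    [Module R W] (D : V → W) (h1 : ∀ x y, D (x + y) = D x + D y)
    (h2 : ∀ (c : R) x, D (c • x) = c • D x) :
    ∃ F : MultilinearMap R (fun _ : Fin 1 => V) W, ⇑F = fun x => D (x 0) :=
  ⟨MultilinearMap.mk' (fun x => D (x 0))
    (fun x i u v => by simp [Subsingleton.elim i 0, h1])
    (fun x i u v => by simp [Subsingleton.elim i 0, h2]), rfl⟩

theorem exists_multilinear_two (R : Type*) [CommRing R] [AddCommGroup V] [Module R V]
    [Module R W] (B : V → V → W) (h1 : ∀ x y z, B (x + y) z = B x z + B y z)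
    (h2 : ∀ x y z, B x (y + z) = B x y + B x z)
    (h3 : ∀ (c : R) x y, B (c • x) y = c • B x y)
    (h4 : ∀ (c : R) x y, B x (c • y) = c • B x y) :
    ∃ F : MultilinearMap R (fun _ : Fin 2 => V) W, ⇑F = fun x => B (x 0) (x 1) :=
  ⟨MultilinearMap.mk' (fun x => B (x 0) (x 1))
    (fun x i u v => by fin_cases i <;> simp [h1, h2])
    (fun x i u v => by fin_cases i <;> simp [h3, h4]), rfl⟩

theorem cons_add_of_multilinear {R : Type*} [CommRing R] [AddCommGroup V] [Module R V]
    [Module R W] {C : ∀ k : ℕ, (Fin k → V) → W}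
    (h : ∀ k, ∃ F : MultilinearMap R (fun _ : Fin k => V) W, ⇑F = C k) (r : ℕ) (u v : V)
    (y : Fin r → V) :
    C (r + 1) (Fin.cons (u + v) y) = C (r + 1) (Fin.cons u y) + C (r + 1) (Fin.cons v y) := by
  obtain ⟨F, hF⟩ := h (r + 1)
  rw [← hF, MultilinearMap.cons_add]

theorem apply_eq_zero_of_multilinear {R : Type*} [CommRing R] [AddCommGroup V] [Module R V]
    [Module R W] {k : ℕ} {C : (Fin k → V) → W}
    (h : ∃ F : MultilinearMap R (fun _ : Fin k => V) W, ⇑F = C) {x : Fin k → V} (i : Fin k)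
    (hx : x i = 0) : C x = 0 := by
  obtain ⟨F, rfl⟩ := h
  exact F.map_coord_zero i hx

/-- The sum over all shuffles that occurs in the homotopy Jacobi identities and in the
Maurer–Cartan equation. -/
def shuffleSum (B : ∀ k : ℕ, (Fin k → V) → V) (C : ∀ k : ℕ, (Fin k → V) → W) {k : ℕ}
    (d : Fin k → ℤ) (x : Fin k → V) : W :=
  ∑ S : Finset (Fin k) with S.Nonempty, koszulSign (fun i => if i ∈ S then 0 else 1) d •
    C (Sᶜ.card + 1) (Fin.cons (B S.card (subtuple x S)) (subtuple x Sᶜ))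

theorem shuffleSum_add_right (B : ∀ k : ℕ, (Fin k → V) → V) (C D : ∀ k : ℕ, (Fin k → V) → W)
    {k : ℕ} (d : Fin k → ℤ) (x : Fin k → V) :
    shuffleSum B (addFamily C D) d x = shuffleSum B C d x + shuffleSum B D d x := by
  simp only [shuffleSum, addFamily, smul_add, Finset.sum_add_distrib]

/-- Together with `shuffleSum_add_right` this reduces brackets of mixed arity to one inner and one
outer arity at a time. Of the outer operations only additivity in the first argument is needed. -/
theorem shuffleSum_add_left [AddCommGroup V] (A B : ∀ k : ℕ, (Fin k → V) → V)
    {C : ∀ k : ℕ, (Fin k → V) → W}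
    (hC : ∀ r u v (y : Fin r → V),
      C (r + 1) (Fin.cons (u + v) y) = C (r + 1) (Fin.cons u y) + C (r + 1) (Fin.cons v y))
    {k : ℕ} (d : Fin k → ℤ) (x : Fin k → V) :
    shuffleSum (addFamily A B) C d x = shuffleSum A C d x + shuffleSum B C d x := by
  simp only [shuffleSum, addFamily, hC, smul_add, Finset.sum_add_distrib]

theorem map_units_smul {N F : Type*} [AddCommGroup N] [FunLike F W N] [AddMonoidHomClass F W N]
    (π : F) (u : ℤˣ) (w : W) : π (u • w) = u • π w := by
  rw [Units.smul_def, map_zsmul, Units.smul_def]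

theorem map_shuffleSum {N F : Type*} [AddCommGroup N] [FunLike F W N] [AddMonoidHomClass F W N]
    (π : F) (B : ∀ k : ℕ, (Fin k → V) → V) (C : ∀ k : ℕ, (Fin k → V) → W) {k : ℕ}
    (d : Fin k → ℤ) (x : Fin k → V) :
    π (shuffleSum B C d x) = shuffleSum B (fun k x => π (C k x)) d x := by
  simp only [shuffleSum, map_sum, Units.smul_def, map_zsmul]

/-- A subset of any other size feeds a zero into the outer operation. -/
theorem shuffleSum_singleArity_left [AddCommGroup V] {n : ℕ} (hn : 0 < n) (B : (Fin n → V) → V)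
    {C : ∀ k : ℕ, (Fin k → V) → W} (hC : ∀ r (y : Fin r → V), C (r + 1) (Fin.cons 0 y) = 0)
    {k : ℕ} (d : Fin k → ℤ) (x : Fin k → V) :
    shuffleSum (singleArity n B) C d x =
      ∑ S : Finset (Fin k) with S.card = n, koszulSign (fun i => if i ∈ S then 0 else 1) d •
        C (Sᶜ.card + 1) (Fin.cons (singleArity n B S.card (subtuple x S)) (subtuple x Sᶜ)) := by
  symm
  refine Finset.sum_subset_zero_on_sdiff (fun S hS => ?_) (fun S hS => ?_) fun _ _ => rfl
  · simp only [Finset.mem_filter, Finset.mem_univ, true_and] at hS ⊢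
    exact Finset.card_pos.1 (hS ▸ hn)
  · rw [singleArity_ne, hC, smul_zero]
    exact fun h => (Finset.mem_sdiff.1 hS).2 (by simp [h])

theorem shuffleSum_singleArity_of_lt [AddCommGroup V] {n : ℕ} (B : (Fin n → V) → V)
    {C : ∀ k : ℕ, (Fin k → V) → W} (hC : ∀ r (y : Fin r → V), C (r + 1) (Fin.cons 0 y) = 0)
    {k : ℕ} (hk : k < n) (d : Fin k → ℤ) (x : Fin k → V) :
    shuffleSum (singleArity n B) C d x = 0 := by
  rw [shuffleSum_singleArity_left (by omega) B hC]
  refine Finset.sum_eq_zero fun S hS => ?_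
  have := (Finset.mem_filter.1 hS).2 ▸ card_finset_fin_le S
  omega

/-- An `n`-ary operation followed by an `(r + 1)`-ary one consumes exactly `n + r` arguments. -/
theorem shuffleSum_singleArity_of_ne [AddCommGroup V] {n r : ℕ} (hn : 0 < n)
    (B : (Fin n → V) → V) (C : (Fin (r + 1) → V) → W)
    (hC : ∀ y, C (Fin.cons 0 y) = 0) {k : ℕ} (hk : k ≠ n + r)
    (d : Fin k → ℤ) (x : Fin k → V) :
    shuffleSum (singleArity n B) (singleArity (r + 1) C) d x = 0 := by
  rw [shuffleSum_singleArity_left hn]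
  · refine Finset.sum_eq_zero fun S hS => ?_
    rw [singleArity_ne C, smul_zero]
    have h1 := (Finset.mem_filter.1 hS).2
    have h2 := S.card_compl_add_card
    rw [Fintype.card_fin] at h2
    omega
  · intro s y
    by_cases h : s = r
    · subst h
      rw [singleArity_self, hC]
    · rw [singleArity_ne]
      omega

theorem shuffleSum_two [AddCommGroup V] (B : (Fin 2 → V) → V)
    {C : ∀ k : ℕ, (Fin k → V) → W} (hC : ∀ r (y : Fin r → V), C (r + 1) (Fin.cons 0 y) = 0)
    {k : ℕ} (d : Fin k → ℤ) (x : Fin k → V) :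
    shuffleSum (singleArity 2 B) C d x = ∑ j : Fin k, ∑ i ∈ Finset.univ.filter (· < j),
      koszulSign (fun a => if a ∈ ({i, j} : Finset (Fin k)) then 0 else 1) d •
        C (({i, j}ᶜ : Finset (Fin k)).card + 1)
          (Fin.cons (B ![x i, x j]) (subtuple x {i, j}ᶜ)) := by
  rw [shuffleSum_singleArity_left two_pos B hC, sum_card_two]
  refine Finset.sum_congr rfl fun j _ => Finset.sum_congr rfl fun i hi => ?_
  rw [apply_subtuple_pair (singleArity 2 B) x (Finset.mem_filter.1 hi).2, singleArity_self]

theorem shuffleSum_compl_singleton [AddCommGroup V] {n : ℕ} (hn : 0 < n) (B : (Fin n → V) → V)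
    {C : ∀ k : ℕ, (Fin k → V) → W} (hC : ∀ r (y : Fin r → V), C (r + 1) (Fin.cons 0 y) = 0)
    (d : Fin (n + 1) → ℤ) (x : Fin (n + 1) → V) :
    shuffleSum (singleArity n B) C d x = ∑ i : Fin (n + 1),
      koszulSign (fun a => if a ∈ ({i}ᶜ : Finset (Fin (n + 1))) then 0 else 1) d •
        C 2 ![B (i.removeNth x), x i] := by
  rw [shuffleSum_singleArity_left hn B hC, sum_card_compl]
  refine Finset.sum_congr rfl fun i _ => ?_
  rw [apply_subtuple_compl_singleton (singleArity n B), singleArity_self, compl_compl,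
    apply_subtuple_singleton fun k y => C (k + 1) (Fin.cons (B (i.removeNth x)) y)]
  congr 2
  funext l
  refine Fin.cases ?_ (fun l => ?_) l
  · rfl
  · rw [Subsingleton.elim l 0]
    rfl

theorem shuffleSum_univ [AddCommGroup V] {n : ℕ} (hn : 0 < n) (B : (Fin n → V) → V)
    {C : ∀ k : ℕ, (Fin k → V) → W} (hC : ∀ r (y : Fin r → V), C (r + 1) (Fin.cons 0 y) = 0)
    (d : Fin n → ℤ) (x : Fin n → V) :
    shuffleSum (singleArity n B) C d x = C 1 fun _ => B x := by
  rw [shuffleSum_singleArity_left hn B hC]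
  have e : (Finset.univ.filter fun S : Finset (Fin n) => S.card = n) = {Finset.univ} := by
    ext S
    simp [← Finset.card_eq_iff_eq_univ]
  rw [e, Finset.sum_singleton, apply_subtuple_univ (singleArity n B), singleArity_self, Finset.compl_univ,
    koszulSign_of_monotone (by simp [monotone_const]), one_smul,
    apply_subtuple (fun k y => C (k + 1) (Fin.cons (B x) y)) x ∅ Finset.card_empty Fin.elim0
      (Subsingleton.strictMono _) fun i => i.elim0]
  congr 1
  funext l
  exact Fin.cases rfl (fun l => l.elim0) l

/-- The argument left out by the inner bracket passes those behind it: none for `x 2`, only `x 2`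
for `x 1`, and both others for `x 0`. -/
theorem shuffleSum_three [AddCommGroup V] (B : (Fin 2 → V) → V) (C : (Fin 2 → V) → W)
    (hC : ∀ y, C (Fin.cons 0 y) = 0) (d : Fin 3 → ℤ) (x : Fin 3 → V) :
    shuffleSum (singleArity 2 B) (singleArity 2 C) d x =
      C ![B ![x 0, x 1], x 2] +
      ((d 1 - 1) * (d 2 - 1)).negOnePow • C ![B ![x 0, x 2], x 1] +
      (((d 0 - 1) * (d 1 - 1)).negOnePow * ((d 0 - 1) * (d 2 - 1)).negOnePow) •
        C ![B ![x 1, x 2], x 0] := by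
  rw [shuffleSum_compl_singleton two_pos, Fin.sum_univ_three, singleArity_self]
  · have e0 : (0 : Fin 3).removeNth x = ![x 1, x 2] := by
      funext i; fin_cases i <;> rfl
    have e1 : (1 : Fin 3).removeNth x = ![x 0, x 2] := by
      funext i; fin_cases i <;> rfl
    have e2 : (2 : Fin 3).removeNth x = ![x 0, x 1] := by
      funext i; fin_cases i <;> rfl
    rw [e0, e1, e2, add_comm, ← add_assoc, add_right_comm]
    congr 1
    congr 1
    all_goals simp [koszulSign, Fin.prod_univ_three]
  · intro s y
    by_cases h : s = 1
    · subst h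
      rw [singleArity_self, hC]
    · rw [singleArity_ne]
      omega

/-- The terms of the second sum in the formula for the exterior derivative. -/
theorem shuffleSum_two_alternating {R L : Type*} [CommRing R] [AddCommGroup V] [AddCommGroup L]
    [Module R L] [Module R W] [Module ℝ W] {n : ℕ} (η : L [⋀^Fin (n + 1)]→ₗ[R] W)
    (B : (Fin 2 → V) → V) {C : ∀ k : ℕ, (Fin k → V) → W}
    (hC0 : ∀ r (y : Fin r → V), C (r + 1) (Fin.cons 0 y) = 0) (π : V → L)
    (hC : ∀ y, C (n + 1) y = η (π ∘ y)) (β : L → L → L) (hβ : ∀ u v, π (B ![u, v]) = β (π u) (π v))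
    (hl : ∀ v, β 0 v = 0) (hr : ∀ v, β v 0 = 0) {d : Fin (n + 2) → ℤ} {x : Fin (n + 2) → V}
    (hd : ∀ i, d i ≠ 0 → π (x i) = 0) :
    shuffleSum (singleArity 2 B) C d x = -∑ j : Fin (n + 2), ∑ i ∈ Finset.univ.filter (· < j),
      (-1 : ℝ) ^ (j : ℕ) •
        η (j.removeNth (Function.update (π ∘ x) i (β (π (x i)) (π (x j))))) := by
  rw [shuffleSum_two B hC0, ← Finset.sum_neg_distrib]
  refine Finset.sum_congr rfl fun j _ => ?_
  rw [← Finset.sum_neg_distrib]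
  refine Finset.sum_congr rfl fun i hi => ?_
  have hij : i < j := (Finset.mem_filter.1 hi).2
  have key := koszulSign_pair_smul η C π hC x hij (B ![x i, x j])
  rw [hβ] at key
  -- In degree zero the Koszul sign is known. If some `d a ≠ 0`, then `π (x a) = 0` and both sides
  -- vanish.
  by_cases h : d = 0
  · rw [h, key]
  · obtain ⟨a, ha⟩ := Function.ne_iff.1 h
    have h0 : η (j.removeNth (Function.update (π ∘ x) i (β (π (x i)) (π (x j))))) = 0 := by
      have ha := hd a ha
      by_cases hai : a = i ∨ a = j
      · have : β (π (x i)) (π (x j)) = 0 := by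
          rcases hai with rfl | rfl
          · rw [ha, hl]
          · rw [ha, hr]
        obtain ⟨l, rfl⟩ := Fin.exists_succAbove_eq hij.ne
        exact η.map_coord_zero l (by simp [Fin.removeNth, this])
      · rw [not_or] at hai
        obtain ⟨l, rfl⟩ := Fin.exists_succAbove_eq hai.2
        exact η.map_coord_zero l (by simp [Fin.removeNth, Function.update_of_ne hai.1, ha])
    -- `key` carries the sign of degree zero. Its right-hand side is zero, so the value of `C` is
    -- zero and the actual sign does not matter.
    rw [h0, smul_zero, neg_zero] at key ⊢
    rw [(smul_eq_zero_iff_eq _).1 key, smul_zero]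

theorem koszulSign_two (d : Fin 2 → ℤ) :
    koszulSign (fun a => if a ∈ ({0}ᶜ : Finset (Fin 2)) then 0 else 1) d =
      ((d 0 - 1) * (d 1 - 1)).negOnePow := by
  simp [koszulSign]

theorem koszulSign_swap (d : Fin 2 → ℤ) :
    koszulSign (Equiv.swap (0 : Fin 2) 1) d = ((d 0 - 1) * (d 1 - 1)).negOnePow := by
  simp [koszulSign]

/-- Graded symmetry of a binary operation. -/
theorem symmetric_of_swap {k : ℕ} (B : V → V → W) (d : Fin k → ℤ)
    (x : Fin k → V)
    (h : ∀ i j : Fin k, B (x j) (x i) = ((d i - 1) * (d j - 1)).negOnePow • B (x i) (x j))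
    (σ : Equiv.Perm (Fin k)) :
    singleArity 2 (fun y => B (y 0) (y 1)) k (x ∘ σ.symm) =
      koszulSign σ d • singleArity 2 (fun y => B (y 0) (y 1)) k x := by
  by_cases hk : k = 2
  swap
  · rw [singleArity_ne _ hk, singleArity_ne _ hk, smul_zero]
  subst hk
  simp only [singleArity_self, Function.comp]
  have : σ = 1 ∨ σ = Equiv.swap 0 1 := by
    revert σ; decide
  rcases this with rfl | rfl
  · rw [show koszulSign (1 : Equiv.Perm (Fin 2)) d = 1 from koszulSign_of_monotone monotone_id d,
      one_smul]
    rfl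
  · rw [koszulSign_swap, ← h 0 1]
    rfl

/-- A submodule family is internal if it has complementary projections. -/
theorem isInternal_of_projections {R M : Type*} [CommRing R] [AddCommGroup M] [Module R M]
    (D : ℤ → Submodule R M) (π : ℤ → M →+ M) (hmem : ∀ i x, π i x ∈ D i)
    (hid : ∀ i, ∀ x ∈ D i, π i x = x) (hne : ∀ i j, i ≠ j → ∀ x ∈ D j, π i x = 0)
    (s : Finset ℤ) (hs : ∀ x, ∑ i ∈ s, π i x = x) : DirectSum.IsInternal D := by
  classical
  constructor
  · rw [injective_iff_map_eq_zero]
    intro x hx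
    ext i
    -- Since `π i` kills the other summands, each coordinate can be read off from the sum, which
    -- gives injectivity.
    have h : π i (DirectSum.coeAddMonoidHom D x) = x i := by
      rw [DirectSum.coeAddMonoidHom_eq_dfinsuppSum, DFinsupp.sum, map_sum]
      by_cases hi : i ∈ x.support
      · rw [Finset.sum_eq_single_of_mem i hi fun j _ hj => hne i j hj.symm _ (x j).2]
        exact hid i _ (x i).2
      · rw [Finset.sum_eq_zero fun j hj => hne i j (fun e => hi (e ▸ hj)) _ (x j).2]
        rw [DFinsupp.notMem_support_iff.1 hi]
        rfl
    rw [← h, hx, map_zero]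
    rfl
  · intro x
    refine ⟨∑ i ∈ s, DirectSum.of (fun i => D i) i ⟨π i x, hmem i x⟩, ?_⟩
    rw [map_sum]
    simp only [DirectSum.coeAddMonoidHom_of, hs]

end Families

/-! ### The semidirect product of derivations and functions -/

section Derivations

/-- The Lie part of the Jacobi identity for a graded semidirect product. -/
theorem graded_jacobi_lie {L : Type*} [LieRing L] {X Y Z : L} {d0 d1 d2 : ℤ}
    (h0 : d0 ≠ 0 → X = 0) (h1 : d1 ≠ 0 → Y = 0) (h2 : d2 ≠ 0 → Z = 0) :
    ⁅⁅X, Y⁆, Z⁆ + ((d1 - 1) * (d2 - 1)).negOnePow • ⁅⁅X, Z⁆, Y⁆ +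
      (((d0 - 1) * (d1 - 1)).negOnePow * ((d0 - 1) * (d2 - 1)).negOnePow) • ⁅⁅Y, Z⁆, X⁆ = 0 := by
  -- Every term contains all of `X`, `Y`, `Z`, so the sum is zero unless all degrees are zero. In
  -- that case the signs are those of the ordinary Jacobi identity.
  by_cases e0 : d0 = 0
  swap
  · simp [h0 e0]
  by_cases e1 : d1 = 0
  swap
  · simp [h1 e1]
  by_cases e2 : d2 = 0
  swap
  · simp [h2 e2]
  subst e0 e1 e2
  have e : ((0 - 1) * (0 - 1) : ℤ).negOnePow = -1 := rfl
  rw [e, lie_lie X Y Z, ← lie_skew Y ⁅X, Z⁆, ← lie_skew X ⁅Y, Z⁆, Int.units_mul_self, one_smul,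
    Units.smul_def]
  simp

/-- The module part of the Jacobi identity for a graded semidirect product. -/
theorem graded_jacobi_module {R : Type*} [CommRing R] [Algebra ℝ R] {X Y Z : Derivation ℝ R R}
    {u v w : R} {d0 d1 d2 : ℤ} (n : ℕ)
    (h0 : d0 ≠ 0 → X = 0) (h1 : d1 ≠ 0 → Y = 0) (h2 : d2 ≠ 0 → Z = 0)
    (hu : u ≠ 0 → (d0 - 1).negOnePow = (-1) ^ n) (hv : v ≠ 0 → (d1 - 1).negOnePow = (-1) ^ n)
    (hw : w ≠ 0 → (d2 - 1).negOnePow = (-1) ^ n) :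
    ⁅X, Y⁆ w + (-1 : ℝ) ^ n • Z (X v + (-1 : ℝ) ^ n • Y u) +
      ((d1 - 1) * (d2 - 1)).negOnePow • (⁅X, Z⁆ v + (-1 : ℝ) ^ n • Y (X w + (-1 : ℝ) ^ n • Z u)) +
      (((d0 - 1) * (d1 - 1)).negOnePow * ((d0 - 1) * (d2 - 1)).negOnePow) •
        (⁅Y, Z⁆ u + (-1 : ℝ) ^ n • X (Y w + (-1 : ℝ) ^ n • Z v)) = 0 := by
  simp only [← neg_one_pow_units_smul]
  generalize (-1 : ℤˣ) ^ n = ε at *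
  -- The sum splits into parts linear in `w`, `v` and `u`. Each part involves two of the vector
  -- fields, which may be assumed to have degree zero, and one module element, whose shifted degree
  -- has parity `ε`. It then reduces to the definition of the commutator.
  have W : ⁅X, Y⁆ w + ((d1 - 1) * (d2 - 1)).negOnePow • (ε • Y (X w)) +
      (((d0 - 1) * (d1 - 1)).negOnePow * ((d0 - 1) * (d2 - 1)).negOnePow) • (ε • X (Y w)) = 0 := by
    by_cases e0 : d0 = 0
    swap
    · simp [h0 e0]
    by_cases e1 : d1 = 0
    swap
    · simp [h1 e1]
    by_cases e2 : w = 0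
    · simp [e2]
    subst e0 e1
    simp only [zero_sub, neg_one_mul, Int.negOnePow_neg, hw e2]
    rcases Int.units_eq_one_or ε with rfl | rfl <;>
      (simp [Derivation.commutator_apply, Units.smul_def]; try abel)
  have Vv : ε • Z (X v) + ((d1 - 1) * (d2 - 1)).negOnePow • ⁅X, Z⁆ v +
      (((d0 - 1) * (d1 - 1)).negOnePow * ((d0 - 1) * (d2 - 1)).negOnePow) • (X (Z v)) = 0 := by
    by_cases e0 : d0 = 0
    swap
    · simp [h0 e0]
    by_cases e1 : d2 = 0
    swap
    · simp [h2 e1]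
    by_cases e2 : v = 0
    · simp [e2]
    subst e0 e1
    simp only [zero_sub, neg_one_mul, mul_neg_one, Int.negOnePow_neg, hv e2]
    rcases Int.units_eq_one_or ε with rfl | rfl <;>
      (simp [Derivation.commutator_apply, Units.smul_def]; try abel)
  have Uu : Z (Y u) + ((d1 - 1) * (d2 - 1)).negOnePow • Y (Z u) +
      (((d0 - 1) * (d1 - 1)).negOnePow * ((d0 - 1) * (d2 - 1)).negOnePow) • (⁅Y, Z⁆ u) = 0 := by
    by_cases e0 : d1 = 0
    swap
    · simp [h1 e0]
    by_cases e1 : d2 = 0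
    swap
    · simp [h2 e1]
    by_cases e2 : u = 0
    · simp [e2]
    subst e0 e1
    simp only [zero_sub, mul_neg_one, Int.negOnePow_neg, hu e2]
    rcases Int.units_eq_one_or ε with rfl | rfl <;>
      (simp [Derivation.commutator_apply, Units.smul_def]; try abel)
  have hm : ∀ (D : Derivation ℝ R R) (a : R), D (ε • a) = ε • D a := fun D a => by
    rw [Units.smul_def, Units.smul_def, map_zsmul]
  have hεε : ∀ a : R, ε • ε • a = a := fun a => by
    rw [smul_smul, Int.units_mul_self, one_smul]
  simp only [map_add, smul_add, hm, hεε]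
  rw [← add_zero (0 : R), ← add_zero (0 + 0 : R)]
  nth_rewrite 1 [← W]
  nth_rewrite 1 [← Vv]
  nth_rewrite 1 [← Uu]
  abel

variable {R : Type*} [CommRing R] [Algebra ℝ R]

/-- The binary operation `(X, f), (Y, h) ↦ ([X, Y], X h ± Y f)`. -/
def semidirectBracket (n : ℕ) (x y : Derivation ℝ R R × R) : Derivation ℝ R R × R :=
  (⁅x.1, y.1⁆, x.1 y.2 + (-1 : ℝ) ^ n • y.1 x.2)

theorem semidirectBracket_add_left (n : ℕ) (x y z : Derivation ℝ R R × R) :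
    semidirectBracket n (x + y) z = semidirectBracket n x z + semidirectBracket n y z := by
  simp only [semidirectBracket, Prod.fst_add, Prod.snd_add, add_lie, Derivation.add_apply, map_add,
    smul_add, Prod.mk_add_mk]
  congr 1
  abel

theorem semidirectBracket_add_right (n : ℕ) (x y z : Derivation ℝ R R × R) :
    semidirectBracket n x (y + z) = semidirectBracket n x y + semidirectBracket n x z := by
  simp only [semidirectBracket, Prod.fst_add, Prod.snd_add, lie_add, Derivation.add_apply, map_add,
    smul_add, Prod.mk_add_mk]
  congr 1
  abel

theorem semidirectBracket_smul_left (n : ℕ) (c : ℝ) (x y : Derivation ℝ R R × R) :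
    semidirectBracket n (c • x) y = c • semidirectBracket n x y := by
  simp only [semidirectBracket, Prod.smul_fst, Prod.smul_snd, smul_lie, Derivation.smul_apply,
    Derivation.map_smul, Prod.smul_mk, smul_add]
  rw [smul_comm c]

theorem semidirectBracket_smul_right (n : ℕ) (c : ℝ) (x y : Derivation ℝ R R × R) :
    semidirectBracket n x (c • y) = c • semidirectBracket n x y := by
  simp only [semidirectBracket, Prod.smul_fst, Prod.smul_snd, lie_smul, Derivation.smul_apply,
    Derivation.map_smul, Prod.smul_mk, smul_add]
  rw [smul_comm c]

theorem semidirectBracket_leibniz (n : ℕ) (a : R) (x y : Derivation ℝ R R × R) :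
    semidirectBracket n x (a • y) = a • semidirectBracket n x y + x.1 a • y := by
  ext b
  · simp [semidirectBracket, Derivation.commutator_apply]
  · simp only [semidirectBracket, Prod.smul_fst, Prod.smul_snd, Derivation.smul_apply,
      Derivation.leibniz, smul_eq_mul, Prod.snd_add, mul_add, mul_smul_comm]
    ring

/-- The last two hypotheses say that module elements have shifted parity `n`. Vector fields are odd
after the shift, so `(-1)^n` is exactly the Koszul sign for exchanging a function with a vector
field. -/
theorem semidirectBracket_swap (n : ℕ) {x y : Derivation ℝ R R × R} {d e : ℤ}
    (hx : d ≠ 0 → x.1 = 0) (hy : e ≠ 0 → y.1 = 0)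
    (hx' : x.2 ≠ 0 → (d - 1).negOnePow = (-1) ^ n) (hy' : y.2 ≠ 0 → (e - 1).negOnePow = (-1) ^ n) :
    semidirectBracket n y x = ((d - 1) * (e - 1)).negOnePow • semidirectBracket n x y := by
  simp only [semidirectBracket, ← neg_one_pow_units_smul]
  generalize (-1 : ℤˣ) ^ n = ε at *
  have h1 : ⁅y.1, x.1⁆ = ((d - 1) * (e - 1)).negOnePow • ⁅x.1, y.1⁆ := by
    by_cases e0 : d = 0
    swap
    · simp [hx e0]
    by_cases e1 : e = 0
    swap
    · simp [hy e1]
    subst e0 e1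
    simp [Units.smul_def]
  have h2 : ε • x.1 y.2 = ((d - 1) * (e - 1)).negOnePow • x.1 y.2 := by
    by_cases e0 : d = 0
    swap
    · simp [hx e0]
    by_cases e1 : y.2 = 0
    · simp [e1]
    rw [← hy' e1, e0, zero_sub, neg_one_mul, Int.negOnePow_neg]
  have h3 : y.1 x.2 = ((d - 1) * (e - 1)).negOnePow • ε • y.1 x.2 := by
    by_cases e0 : e = 0
    swap
    · simp [hy e0]
    by_cases e1 : x.2 = 0
    · simp [e1]
    rw [← hx' e1, e0, zero_sub, mul_neg_one, Int.negOnePow_neg, smul_smul, Int.units_mul_self,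
      one_smul]
  ext1
  · exact h1
  · change y.1 x.2 + ε • x.1 y.2 = ((d - 1) * (e - 1)).negOnePow • (x.1 y.2 + ε • y.1 x.2)
    rw [smul_add, h2, ← h3, add_comm]

theorem semidirectBracket_jacobi (n : ℕ) {x y z : Derivation ℝ R R × R} {d0 d1 d2 : ℤ}
    (h0 : d0 ≠ 0 → x.1 = 0) (h1 : d1 ≠ 0 → y.1 = 0) (h2 : d2 ≠ 0 → z.1 = 0)
    (hu : x.2 ≠ 0 → (d0 - 1).negOnePow = (-1) ^ n) (hv : y.2 ≠ 0 → (d1 - 1).negOnePow = (-1) ^ n)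
    (hw : z.2 ≠ 0 → (d2 - 1).negOnePow = (-1) ^ n) :
    semidirectBracket n (semidirectBracket n x y) z +
      ((d1 - 1) * (d2 - 1)).negOnePow • semidirectBracket n (semidirectBracket n x z) y +
      (((d0 - 1) * (d1 - 1)).negOnePow * ((d0 - 1) * (d2 - 1)).negOnePow) •
        semidirectBracket n (semidirectBracket n y z) x = 0 :=
  Prod.ext (graded_jacobi_lie h0 h1 h2) (graded_jacobi_module n h0 h1 h2 hu hv hw)

/-- Functions on $\check C_k\,\mathcal U$ have degree `k - m`, so the sign in the bracket is the
parity of their shifted degree. This supplies the sign hypotheses of the semidirect product; for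
$\mathrm{At}_{n-1}(H)$ it is used with `k = 0`. -/
theorem negOnePow_eq_of_deg {m k : ℕ} {d : ℤ} (h : (k : ℤ) = m + d) :
    (d - 1).negOnePow = (-1) ^ (m + 1 + k) := by
  obtain rfl : d = k - m := by omega
  rw [Int.negOnePow_sub, Int.negOnePow_sub, Int.negOnePow_one, Int.negOnePow_def,
    Int.negOnePow_def, zpow_natCast, zpow_natCast, pow_add, pow_succ, mul_comm, mul_comm _ (_ ^ m),
    mul_assoc]
  exact mul_left_comm _ _ _

end Derivations

/-! ### Decompositions into blocks in the Maurer–Cartan equation -/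

section Blocks

variable {V W : Type*} [AddCommGroup W]

/-- The left-hand side of the Maurer–Cartan equation. -/
def blockSum [Module ℝ W] (B : ∀ k : ℕ, (Fin k → W) → W) (φ : ∀ k : ℕ, (Fin k → V) → W) {k : ℕ}
    (d : Fin k → ℤ) (x : Fin k → V) : W :=
  ∑ l ∈ Finset.Icc 1 k, ((l.factorial : ℝ)⁻¹) • ∑ p : Fin k → Fin l with Function.Surjective p,
    koszulSign p d • B l (fun b =>
      φ (Finset.univ.filter (p · = b)).card (subtuple x (Finset.univ.filter (p · = b))))

/-- The contribution of the decompositions into two blocks. -/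
def twoBlockSum (B : (Fin 2 → W) → W) (φ : ∀ k : ℕ, (Fin k → V) → W) {k : ℕ}
    (d : Fin k → ℤ) (x : Fin k → V) : W :=
  ∑ p : Fin k → Fin 2 with Function.Surjective p, koszulSign p d • B fun b =>
    φ (Finset.univ.filter (p · = b)).card (subtuple x (Finset.univ.filter (p · = b)))

theorem twoBlockSum_one (B : (Fin 2 → W) → W) (φ : ∀ k : ℕ, (Fin k → V) → W) (d : Fin 1 → ℤ)
    (x : Fin 1 → V) : twoBlockSum B φ d x = 0 := by
  refine Finset.sum_eq_zero fun p hp => ?_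
  obtain ⟨i, hi⟩ := (Finset.mem_filter.1 hp).2 0
  obtain ⟨j, hj⟩ := (Finset.mem_filter.1 hp).2 1
  rw [show j = i by omega, hi] at hj
  exact absurd hj (by decide)

theorem blockSum_zero [Module ℝ W] (B : ∀ k : ℕ, (Fin k → W) → W) (φ : ∀ k : ℕ, (Fin k → V) → W)
    (d : Fin 0 → ℤ) (x : Fin 0 → V) : blockSum B φ d x = 0 := rfl

theorem blockSum_succ [Module ℝ W] (D : (Fin 1 → W) → W) (B : (Fin 2 → W) → W)
    (φ : ∀ k : ℕ, (Fin k → V) → W) {k : ℕ} (d : Fin (k + 1) → ℤ) (x : Fin (k + 1) → V) :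
    blockSum (addFamily (singleArity 1 D) (singleArity 2 B)) φ d x =
      D (fun _ => φ (k + 1) x) + (2 : ℝ)⁻¹ • twoBlockSum B φ d x := by
  have h1 : ∀ l, l ≠ 1 → l ≠ 2 → ∀ y, addFamily (singleArity 1 D) (singleArity 2 B) l y = 0 :=
    fun l h1 h2 y => by rw [addFamily, singleArity_ne _ h1, singleArity_ne _ h2, add_zero]
  rw [blockSum, ← Finset.add_sum_erase _ _ (Finset.mem_Icc.2 ⟨le_rfl, by omega⟩ : 1 ∈ _)]
  congr 1
  · have e : (Finset.univ.filter fun p : Fin (k + 1) → Fin 1 => Function.Surjective p) =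
        {fun _ => 0} := by
      ext p
      rw [Subsingleton.elim p fun _ => 0]
      simp only [Finset.mem_filter, Finset.mem_univ, true_and, Finset.mem_singleton, iff_true]
      exact fun b => ⟨0, Subsingleton.elim _ _⟩
    rw [e, Finset.sum_singleton, koszulSign_of_monotone monotone_const, one_smul, addFamily,
      singleArity_ne B (by omega), add_zero, singleArity_self, Nat.factorial_one, Nat.cast_one,
      inv_one, one_smul]
    congr 1
    funext b
    have : (Finset.univ.filter fun _ : Fin (k + 1) => (0 : Fin 1) = b) = Finset.univ := by
      ext i
      simp [Subsingleton.elim b 0]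
    rw [this, apply_subtuple_univ φ]
  -- For a single argument `l = 2` lies outside the range of summation; correspondingly, there is no
  -- surjection onto two blocks.
  · by_cases hk : k = 0
    · subst hk
      rw [twoBlockSum_one, Finset.sum_eq_zero, smul_zero]
      intro l hl
      simp only [Finset.mem_erase, Finset.mem_Icc] at hl
      omega
    · rw [Finset.sum_eq_single 2]
      · rw [twoBlockSum, Nat.factorial_two, Nat.cast_ofNat]
        congr 1
        refine Finset.sum_congr rfl fun p _ => ?_
        rw [addFamily, singleArity_ne D (by omega), zero_add, singleArity_self]
      · intro l hl hl2
        rw [Finset.sum_eq_zero, smul_zero]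
        intro p _
        rw [h1 l (Finset.mem_erase.1 hl).1 hl2, smul_zero]
      · intro h
        refine absurd ?_ h
        simp only [Finset.mem_erase, Finset.mem_Icc]
        omega

/-- The two orderings of the blocks contribute equally by graded symmetry, which cancels the factor
1/2. -/
theorem twoBlockSum_two [Module ℝ W] (B : W → W → W) (φ : ∀ k : ℕ, (Fin k → V) → W) (d : Fin 2 → ℤ)
    (x : Fin 2 → V)
    (hB : B (φ 1 fun _ => x 1) (φ 1 fun _ => x 0) =
      ((d 0 - 1) * (d 1 - 1)).negOnePow • B (φ 1 fun _ => x 0) (φ 1 fun _ => x 1)) :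
    (2 : ℝ)⁻¹ • twoBlockSum (fun y => B (y 0) (y 1)) φ d x =
      B (φ 1 fun _ => x 0) (φ 1 fun _ => x 1) := by
  have e : (Finset.univ.filter fun p : Fin 2 → Fin 2 => Function.Surjective p) =
      {id, ⇑(Equiv.swap (0 : Fin 2) 1)} := by decide
  have f : ∀ (p : Fin 2 → Fin 2) (b i : Fin 2), (Finset.univ.filter (p · = b)) = {i} →
      φ (Finset.univ.filter (p · = b)).card (subtuple x (Finset.univ.filter (p · = b))) =
        φ 1 fun _ => x i := by
    intro p b i h
    rw [h, apply_subtuple_singleton φ]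
  rw [twoBlockSum, e, Finset.sum_pair (by decide), koszulSign_of_monotone monotone_id, one_smul,
    koszulSign_swap]
  beta_reduce
  rw [f id 0 0 (by decide), f id 1 1 (by decide),
    f (Equiv.swap 0 1) 0 1 (by decide), f (Equiv.swap 0 1) 1 0 (by decide), hB, smul_smul,
    Int.units_mul_self, one_smul, ← two_smul ℝ, smul_smul]
  norm_num

/-- Decompositions into two blocks one of which is a singleton. -/
theorem sum_surjective_singleton {N : Type*} [AddCommMonoid N] {n : ℕ} {b c : Fin 2} (hbc : b ≠ c)
    (F : (Fin (n + 2) → Fin 2) → N)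
    (hF : ∀ p, (Finset.univ.filter (p · = b)).card ≠ 1 → F p = 0) :
    ∑ p : Fin (n + 2) → Fin 2 with Function.Surjective p, F p =
      ∑ i, F fun a => if a = i then b else c := by
  have hinj : Function.Injective fun (i : Fin (n + 2)) (a : Fin (n + 2)) =>
      if a = i then b else c := by
    intro i j h
    have := congrFun h i
    by_contra hij
    simp [hij, hbc] at this
  rw [← Finset.sum_image (s := Finset.univ) (f := F) fun i _ j _ h => hinj h]
  symm
  refine Finset.sum_subset (fun p hp => ?_) fun p _ hp => hF p fun h => ?_
  · obtain ⟨i, -, rfl⟩ := Finset.mem_image.1 hp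
    simp only [Finset.mem_filter, Finset.mem_univ, true_and]
    intro l
    by_cases hl : l = b
    · exact ⟨i, by simp [hl]⟩
    -- There are at least two arguments, so the value `c` is attained as well.
    · obtain ⟨j, hj⟩ := exists_ne i
      refine ⟨j, ?_⟩
      simp only [hj, if_false]
      omega
  · obtain ⟨i, hi⟩ := Finset.card_eq_one.1 h
    refine hp (Finset.mem_image.2 ⟨i, Finset.mem_univ _, ?_⟩)
    funext a
    have ha : p a = b ↔ a = i := by
      have : a ∈ Finset.univ.filter (p · = b) ↔ a ∈ ({i} : Finset _) := by rw [hi]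
      simpa using this
    by_cases h : a = i
    · simp only [h, if_true]
      exact (h ▸ ha.2 h).symm
    · simp only [h, if_false]
      have := fun e => h (ha.1 e)
      omega

theorem filter_singleton_block {n : ℕ} {b c : Fin 2} (hbc : b ≠ c) (i : Fin (n + 2)) :
    (Finset.univ.filter fun a => (if a = i then b else c) = b) = {i} := by
  ext a
  by_cases h : a = i <;> simp [h, hbc.symm]

theorem filter_compl_block {n : ℕ} {b c : Fin 2} (hbc : b ≠ c) (i : Fin (n + 2)) :
    (Finset.univ.filter fun a => (if a = i then b else c) = c) = {i}ᶜ := by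
  ext a
  by_cases h : a = i <;> simp [h, hbc]

/-- The contribution of the decompositions into two blocks, if the binary operation has two parts
that vanish unless the first, respectively the second block is a singleton. -/
theorem map_twoBlockSum {N F : Type*} [AddCommGroup N] [FunLike F W N]
    [AddMonoidHomClass F W N] (π : F) (B : (Fin 2 → W) → W) (P Q : W → W → N)
    (hB : ∀ y, π (B y) = P (y 0) (y 1) + Q (y 1) (y 0)) (φ : ∀ k : ℕ, (Fin k → V) → W)
    (hP : ∀ k, k ≠ 1 → ∀ y w, P (φ k y) w = 0) (hQ : ∀ k, k ≠ 1 → ∀ y w, Q (φ k y) w = 0) {n : ℕ}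
    (d : Fin (n + 2) → ℤ) (x : Fin (n + 2) → V) :
    π (twoBlockSum B φ d x) =
      ∑ i, (koszulSign (fun a => if a = i then (0 : Fin 2) else 1) d •
        P (φ 1 fun _ => x i) (φ (n + 1) (i.removeNth x)) +
      koszulSign (fun a => if a = i then (1 : Fin 2) else 0) d •
        Q (φ 1 fun _ => x i) (φ (n + 1) (i.removeNth x))) := by
  simp only [twoBlockSum, map_sum, map_units_smul, hB, smul_add, Finset.sum_add_distrib]
  congr 1
  · rw [sum_surjective_singleton (b := 0) (c := 1) (by decide)]
    · refine Finset.sum_congr rfl fun i _ => ?_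
      rw [filter_singleton_block (by decide), filter_compl_block (by decide),
        apply_subtuple_singleton φ, apply_subtuple_compl_singleton φ]
    · intro p hp
      rw [hP _ hp, smul_zero]
  · rw [sum_surjective_singleton (b := 1) (c := 0) (by decide)]
    · refine Finset.sum_congr rfl fun i _ => ?_
      rw [filter_singleton_block (by decide), filter_compl_block (by decide),
        apply_subtuple_singleton φ, apply_subtuple_compl_singleton φ]
    · intro p hp
      rw [hQ _ hp, smul_zero]

end Blocks

variable {E : Type*} [NormedAddCommGroup E] [NormedSpace ℝ E]
variable {M : Type*} [TopologicalSpace M] [ChartedSpace E M] {m : ℕ}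

/-! ### $\mathrm{At}_{n-1}(H)$ is an $L_\infty$-algebroid -/

section AtiyahAlgebroid

/-- The part of the binary bracket of `At_{n-1}(H)` that does not depend on `H`. -/
def atiyahLie (m : ℕ) (v w : VectorFields E M × SmoothFn E M) :
    VectorFields E M × SmoothFn E M :=
  semidirectBracket (m + 1) v w

/-- The bracket of `At_{n-1}(H)` given by `H`. -/
def atiyahForm (H : DiffForm E M (m + 2)) (x : Fin (m + 2) → VectorFields E M × SmoothFn E M) :
    VectorFields E M × SmoothFn E M :=
  (0, H fun i => (x i).1)

/-- As a sum of two families, the case `m = 0`, where both parts are binary, needs no separate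
treatment in the Jacobi identities. -/
theorem atiyah_bracket (H : DiffForm E M (m + 2)) :
    (atiyah H).bracket = addFamily (singleArity 2 fun y => atiyahLie m (y 0) (y 1))
      (singleArity (m + 2) (atiyahForm H)) := rfl

theorem exists_multilinear_atiyahLie : ∃ F : MultilinearMap ℝ
    (fun _ : Fin 2 => VectorFields E M × SmoothFn E M) (VectorFields E M × SmoothFn E M),
    ⇑F = fun y => atiyahLie m (y 0) (y 1) := by
  exact exists_multilinear_two ℝ _ (semidirectBracket_add_left _) (semidirectBracket_add_right _)
    (semidirectBracket_smul_left _) (semidirectBracket_smul_right _)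

theorem exists_multilinear_atiyahForm (H : DiffForm E M (m + 2)) :
    ∃ F : MultilinearMap (SmoothFn E M)
      (fun _ : Fin (m + 2) => VectorFields E M × SmoothFn E M)
      (VectorFields E M × SmoothFn E M), ⇑F = atiyahForm H :=
  ⟨(LinearMap.inr (SmoothFn E M) (VectorFields E M) (SmoothFn E M)).compMultilinearMap
    (H.toMultilinearMap.compLinearMap fun _ =>
      LinearMap.fst (SmoothFn E M) (VectorFields E M) (SmoothFn E M)), rfl⟩

theorem exists_multilinear_restrictScalars {A V W : Type*} [CommRing A] [Algebra ℝ A]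
    [AddCommGroup V] [Module ℝ V] [Module A V] [IsScalarTower ℝ A V]
    [AddCommGroup W] [Module ℝ W] [Module A W] [IsScalarTower ℝ A W]
    {k : ℕ} {B : (Fin k → V) → W}
    (h : ∃ F : MultilinearMap A (fun _ : Fin k => V) W, ⇑F = B) :
    ∃ F : MultilinearMap ℝ (fun _ : Fin k => V) W, ⇑F = B := by
  obtain ⟨F, rfl⟩ := h
  exact ⟨F.restrictScalars ℝ, rfl⟩

theorem exists_multilinear_atiyah (H : DiffForm E M (m + 2)) (k : ℕ) :
    ∃ F : MultilinearMap ℝ (fun _ : Fin k => VectorFields E M × SmoothFn E M)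
      (VectorFields E M × SmoothFn E M), ⇑F = (atiyah H).bracket k := by
  rw [atiyah_bracket]
  exact exists_multilinear_addFamily ℝ (exists_multilinear_singleArity ℝ exists_multilinear_atiyahLie k)
    (exists_multilinear_singleArity ℝ
      (exists_multilinear_restrictScalars (exists_multilinear_atiyahForm H)) k)

theorem atiyah_isInternal (H : DiffForm E M (m + 2)) :
    DirectSum.IsInternal (atiyah H).deg := by
  refine isInternal_of_projections (atiyah H).deg
    (fun i => ((if i = 0 then AddMonoidHom.id _ else 0 : VectorFields E M →+ VectorFields E M).prodMap
      (if i = -m then AddMonoidHom.id _ else 0 : SmoothFn E M →+ SmoothFn E M)))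
    ?_ ?_ ?_ {0, -(m : ℤ)} ?_
  · intro i x
    constructor
    · intro h
      change (if i = 0 then AddMonoidHom.id _ else 0 : VectorFields E M →+ VectorFields E M) x.1 = 0
      rw [if_neg h]
      rfl
    · intro h
      change (if i = -m then AddMonoidHom.id _ else 0 : SmoothFn E M →+ SmoothFn E M) x.2 = 0
      rw [if_neg h]
      rfl
  · rintro i x ⟨h1, h2⟩
    refine Prod.ext ?_ ?_
    · change (if i = 0 then AddMonoidHom.id _ else 0 : VectorFields E M →+ VectorFields E M) x.1 = x.1
      split_ifs with h
      · rfl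
      · rw [h1 h]
        rfl
    · change (if i = -m then AddMonoidHom.id _ else 0 : SmoothFn E M →+ SmoothFn E M) x.2 = x.2
      split_ifs with h
      · rfl
      · rw [h2 h]
        rfl
  · rintro i j hij x ⟨h1, h2⟩
    refine Prod.ext ?_ ?_
    · change (if i = 0 then AddMonoidHom.id _ else 0 : VectorFields E M →+ VectorFields E M) x.1 = 0
      split_ifs with h
      · rw [h1 fun e => hij (h.trans e.symm)]
        rfl
      · rfl
    · change (if i = -m then AddMonoidHom.id _ else 0 : SmoothFn E M →+ SmoothFn E M) x.2 = 0
      split_ifs with h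
      · rw [h2 fun e => hij (h.trans e.symm)]
        rfl
      · rfl
  · rintro ⟨X, f⟩
    -- For `m = 0` both summands sit in degree zero and `{0, -m}` is a singleton.
    by_cases h : m = 0
    · subst h
      simp
      rfl
    · have h' : (0 : ℤ) ≠ -m := by omega
      rw [Finset.sum_pair h']
      refine Prod.ext ?_ ?_
      · change (if (0 : ℤ) = 0 then AddMonoidHom.id _ else 0 : VectorFields E M →+ _) X +
          (if -(m : ℤ) = 0 then AddMonoidHom.id _ else 0 : VectorFields E M →+ _) X = X
        rw [if_pos rfl, if_neg h'.symm]
        exact add_zero X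
      · change (if 0 = -(m : ℤ) then AddMonoidHom.id _ else 0 : SmoothFn E M →+ _) f +
          (if -(m : ℤ) = -m then AddMonoidHom.id _ else 0 : SmoothFn E M →+ _) f = f
        rw [if_pos rfl, if_neg h']
        exact zero_add f

theorem atiyah_sign_of_deg (H : DiffForm E M (m + 2)) {i : ℤ}
    {x : VectorFields E M × SmoothFn E M} (hx : x ∈ (atiyah H).deg i) (h : x.2 ≠ 0) :
    (i - 1).negOnePow = (-1) ^ (m + 1) :=
  negOnePow_eq_of_deg (k := 0) (by
    have : i = -m := by_contra fun hi => h (hx.2 hi)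
    simp [this])

theorem atiyahLie_mem (H : DiffForm E M (m + 2)) {d e : ℤ}
    {x y : VectorFields E M × SmoothFn E M}
    (hx : x ∈ (atiyah H).deg d) (hy : y ∈ (atiyah H).deg e) :
    atiyahLie m x y ∈ (atiyah H).deg (d + e) := by
  have X0 : ∀ {Z : VectorFields E M} {f : SmoothFn E M}, (Z = 0 ∨ f = 0) → Z f = 0 := by
    rintro Z f (h | h)
    · rw [h]
      rfl
    · rw [h, map_zero]
  constructor
  · intro h
    change ⁅x.1, y.1⁆ = 0
    by_cases h1 : d = 0
    · rw [hy.1 (by omega)]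
      exact lie_zero (L := VectorFields E M) (M := VectorFields E M) x.1
    · rw [hx.1 h1]
      exact zero_lie (L := VectorFields E M) (M := VectorFields E M) y.1
  · intro h
    change x.1 y.2 + (-1 : ℝ) ^ (m + 1) • y.1 x.2 = 0
    rw [X0, X0, smul_zero, add_zero]
    · by_cases h1 : e = 0
      · exact Or.inr (hx.2 (by omega))
      · exact Or.inl (hy.1 h1)
    · by_cases h1 : d = 0
      · exact Or.inr (hy.2 (by omega))
      · exact Or.inl (hx.1 h1)

theorem atiyahForm_eq_zero (H : DiffForm E M (m + 2))
    {x : Fin (m + 2) → VectorFields E M × SmoothFn E M} (i : Fin (m + 2)) (hi : (x i).1 = 0) :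
    atiyahForm H x = 0 :=
  Prod.ext rfl (H.map_coord_zero i hi)

theorem atiyah_bracket_mem (H : DiffForm E M (m + 2)) (k : ℕ) (d : Fin k → ℤ)
    (x : Fin k → VectorFields E M × SmoothFn E M) (hx : ∀ i, x i ∈ (atiyah H).deg (d i)) :
    (atiyah H).bracket k x ∈ (atiyah H).deg ((∑ i, d i) + 2 - k) := by
  rw [atiyah_bracket]
  refine Submodule.add_mem _ ?_ ?_
  · by_cases hk : k = 2
    · subst hk
      have := atiyahLie_mem H (hx 0) (hx 1)
      rw [singleArity_self, Fin.sum_univ_two]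
      rwa [show d 0 + d 1 + 2 - (2 : ℕ) = d 0 + d 1 by push_cast; ring]
    · rw [singleArity_ne _ hk]
      exact Submodule.zero_mem _
  · by_cases hk : k = m + 2
    · subst hk
      rw [singleArity_self]
      -- $H$ is nonzero only on tuples of degree zero, and `0 + 2 - (m + 2) = -m` is the degree of
      -- functions.
      by_cases hd : ∀ i, d i = 0
      · simp only [hd, Finset.sum_const_zero]
        refine ⟨fun _ => rfl, fun h => absurd ?_ h⟩
        push_cast
        ring
      · push Not at hd
        obtain ⟨i, hi⟩ := hd
        rw [atiyahForm_eq_zero H i ((hx i).1 hi)]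
        exact Submodule.zero_mem _
    · rw [singleArity_ne _ hk]
      exact Submodule.zero_mem _

/-- In degree zero the Koszul sign is the sign of the permutation. Otherwise one argument is zero,
and so are both sides. -/
theorem alternating_koszul {R L N : Type*} [CommRing R] [AddCommGroup L] [Module R L]
    [AddCommGroup N] [Module R N] {k : ℕ} (η : L [⋀^Fin k]→ₗ[R] N) {d : Fin k → ℤ} {X : Fin k → L}
    (hd : ∀ i, d i ≠ 0 → X i = 0) (σ : Equiv.Perm (Fin k)) :
    η (X ∘ σ.symm) = koszulSign σ d • η X := by
  by_cases h : d = 0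
  · rw [h, koszulSign_perm, ← Equiv.Perm.sign_symm]
    exact η.map_perm X σ.symm
  · obtain ⟨i, hi⟩ := Function.ne_iff.1 h
    rw [η.map_coord_zero i (hd i hi), smul_zero]
    exact η.map_coord_zero (σ i) (by simpa using hd i hi)

theorem atiyah_symmetric (H : DiffForm E M (m + 2)) (k : ℕ) (d : Fin k → ℤ)
    (x : Fin k → VectorFields E M × SmoothFn E M) (hx : ∀ i, x i ∈ (atiyah H).deg (d i))
    (σ : Equiv.Perm (Fin k)) :
    (atiyah H).bracket k (x ∘ σ.symm) = koszulSign σ d • (atiyah H).bracket k x := by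
  rw [atiyah_bracket]
  refine (congrArg₂ (· + ·) (symmetric_of_swap (atiyahLie m) d x (fun i j => ?_) σ) ?_).trans
    (smul_add _ _ _).symm
  · exact semidirectBracket_swap (m + 1) (hx i).1 (hx j).1
      (atiyah_sign_of_deg H (hx i)) (atiyah_sign_of_deg H (hx j))
  · by_cases hk : k = m + 2
    · subst hk
      rw [singleArity_self]
      refine Prod.ext (smul_zero _).symm ?_
      exact alternating_koszul H (X := fun i => (x i).1) (fun i hi => (hx i).1 hi) σ
    · exact (singleArity_ne _ hk _).trans
        ((congrArg (koszulSign σ d • ·) (singleArity_ne _ hk x)).trans (smul_zero _)).symm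

theorem singleArity_atiyahForm_fst (H : DiffForm E M (m + 2)) (k : ℕ)
    (x : Fin k → VectorFields E M × SmoothFn E M) :
    (singleArity (m + 2) (atiyahForm H) k x).1 = 0 := by
  by_cases hk : k = m + 2
  · subst hk
    rw [singleArity_self]
    rfl
  · rw [singleArity_ne _ hk]
    rfl

theorem singleArity_atiyahForm_cons (H : DiffForm E M (m + 2)) (r : ℕ)
    {v : VectorFields E M × SmoothFn E M} (hv : v.1 = 0)
    (y : Fin r → VectorFields E M × SmoothFn E M) :
    singleArity (m + 2) (atiyahForm H) (r + 1) (Fin.cons v y) = 0 := by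
  by_cases hk : r = m + 1
  · subst hk
    rw [singleArity_self]
    exact atiyahForm_eq_zero H 0 hv
  · rw [singleArity_ne _ (by omega)]

theorem atiyahLie_zero_left (w : VectorFields E M × SmoothFn E M) : atiyahLie m 0 w = 0 := by
  have := semidirectBracket_smul_left (m + 1) 0 0 w
  rwa [zero_smul, zero_smul] at this

theorem singleArity_atiyahLie_cons (r : ℕ) (y : Fin r → VectorFields E M × SmoothFn E M) :
    singleArity 2 (fun y => atiyahLie m (y 0) (y 1)) (r + 1) (Fin.cons 0 y) = 0 := by
  by_cases hk : r = 1
  · subst hk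
    rw [singleArity_self]
    exact atiyahLie_zero_left _
  · rw [singleArity_ne _ (by omega)]

theorem shuffleSum_atiyahLie (H : DiffForm E M (m + 2)) (k : ℕ) (d : Fin k → ℤ)
    (x : Fin k → VectorFields E M × SmoothFn E M) (hx : ∀ i, x i ∈ (atiyah H).deg (d i)) :
    shuffleSum (singleArity 2 fun y => atiyahLie m (y 0) (y 1))
      (singleArity 2 fun y => atiyahLie m (y 0) (y 1)) d x = 0 := by
  by_cases hk : k = 3
  · subst hk
    rw [shuffleSum_three _ _ fun y => atiyahLie_zero_left _]
    exact semidirectBracket_jacobi (m + 1) (hx 0).1 (hx 1).1 (hx 2).1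
      (atiyah_sign_of_deg H (hx 0)) (atiyah_sign_of_deg H (hx 1)) (atiyah_sign_of_deg H (hx 2))
  · exact shuffleSum_singleArity_of_ne two_pos _ _ (fun y => atiyahLie_zero_left _) hk d x

/-- $H$ takes values in functions and sees only vector fields, so it cannot be iterated. -/
theorem shuffleSum_atiyahForm (H : DiffForm E M (m + 2)) (k : ℕ) (d : Fin k → ℤ)
    (x : Fin k → VectorFields E M × SmoothFn E M) :
    shuffleSum (singleArity (m + 2) (atiyahForm H)) (singleArity (m + 2) (atiyahForm H)) d x = 0 :=
  Finset.sum_eq_zero fun S _ => by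
    rw [singleArity_atiyahForm_cons H _ (singleArity_atiyahForm_fst H _ _), smul_zero]

/-- The only nontrivial arity is `m + 3`, where the sum is $-\mathrm dH$. A Lie bracket inserted
into $H$ gives the terms with $[X_i,X_j]$, and a value of $H$ inserted into the binary bracket gives
the terms $X_i(H(\dots))$. -/
theorem shuffleSum_atiyahLie_atiyahForm (H : DiffForm E M (m + 2))
    (hH : ∀ X, exteriorDeriv H X = 0) (k : ℕ) (d : Fin k → ℤ)
    (x : Fin k → VectorFields E M × SmoothFn E M) (hx : ∀ i, x i ∈ (atiyah H).deg (d i)) :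
    shuffleSum (singleArity 2 fun y => atiyahLie m (y 0) (y 1))
      (singleArity (m + 2) (atiyahForm H)) d x +
    shuffleSum (singleArity (m + 2) (atiyahForm H))
      (singleArity 2 fun y => atiyahLie m (y 0) (y 1)) d x = 0 := by
  by_cases hk : k = m + 3
  swap
  · rw [shuffleSum_singleArity_of_ne two_pos _ _ (fun y => atiyahForm_eq_zero H 0 rfl) (by omega),
      shuffleSum_singleArity_of_ne (by omega) _ _ (fun y => atiyahLie_zero_left _) (by omega),
      add_zero]
  subst hk
  have h1 : shuffleSum (singleArity 2 fun y => atiyahLie m (y 0) (y 1))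
      (singleArity (m + 2) (atiyahForm H)) d x =
      (0, -∑ j : Fin (m + 3), ∑ i ∈ Finset.univ.filter (· < j), (-1 : ℝ) ^ (j : ℕ) •
        H (j.removeNth (Function.update (fun a => (x a).1) i ⁅(x i).1, (x j).1⁆))) := by
    refine Prod.ext ?_ ?_
    · refine (map_shuffleSum (AddMonoidHom.fst (VectorFields E M) (SmoothFn E M)) _ _ d x).trans
        (Finset.sum_eq_zero fun S _ => ?_)
      exact (congrArg _ (singleArity_atiyahForm_fst H _ _)).trans (smul_zero _)
    · refine (map_shuffleSum (AddMonoidHom.snd (VectorFields E M) (SmoothFn E M)) _ _ d x).trans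
        (shuffleSum_two_alternating H _ ?_ Prod.fst ?_ (fun X Y => ⁅X, Y⁆) ?_ ?_ ?_ fun i => (hx i).1)
      · intro r y
        rw [singleArity_atiyahForm_cons H _ rfl]
        rfl
      · intro y
        rw [singleArity_self]
        rfl
      · intro u v
        rfl
      · intro v
        exact zero_lie v
      · intro v
        exact lie_zero v
  have h2 : shuffleSum (singleArity (m + 2) (atiyahForm H))
      (singleArity 2 fun y => atiyahLie m (y 0) (y 1)) d x =
      (0, -∑ i : Fin (m + 3), (-1 : ℝ) ^ (i : ℕ) •
        (x i).1 (H (i.removeNth fun a => (x a).1))) := by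
    rw [shuffleSum_compl_singleton (by omega) _ singleArity_atiyahLie_cons]
    have e : ∀ i : Fin (m + 3), koszulSign (fun a => if a ∈ ({i}ᶜ : Finset _) then 0 else 1) d •
        singleArity 2 (fun y => atiyahLie m (y 0) (y 1)) 2
          ![atiyahForm H (i.removeNth x), x i] =
        AddMonoidHom.inr (VectorFields E M) (SmoothFn E M) (-((-1 : ℝ) ^ (i : ℕ) •
          (x i).1 (H (i.removeNth fun a => (x a).1)))) := by
      intro i
      rw [singleArity_self]
      have e : atiyahLie m (atiyahForm H (i.removeNth x)) (x i) =
          AddMonoidHom.inr (VectorFields E M) (SmoothFn E M) ((-1 : ℝ) ^ (m + 1) •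
            (x i).1 (H (i.removeNth fun a => (x a).1))) :=
        Prod.ext (zero_lie (x i).1) (zero_add _)
      refine (congrArg _ e).trans ?_
      rw [Units.smul_def, ← map_zsmul, ← Units.smul_def]
      congr 1
      by_cases h : d = 0
      -- Moving `x i` to the end costs `(-1)^(m + 2 + i)`, and the bracket of a function with a
      -- vector field, in this order, costs `(-1)^(m + 1)`. The product is `-(-1)^i`.
      · rw [h, koszulSign_to_end i (by simp +contextual) (by simp +contextual),
          neg_one_pow_units_smul, smul_smul, ← neg_smul]
        congr 1
        rw [← pow_add, show m + 2 + (i : ℕ) + (m + 1) = 2 * (m + 1) + 1 + i by ring, pow_add,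
          pow_succ, pow_mul]
        simp
      · obtain ⟨a, ha⟩ := Function.ne_iff.1 h
        have : (x i).1 (H (i.removeNth fun a => (x a).1)) = 0 := by
          by_cases hai : a = i
          · subst hai
            rw [(hx a).1 ha]
            rfl
          · obtain ⟨l, rfl⟩ := Fin.exists_succAbove_eq hai
            rw [H.map_coord_zero l ((hx _).1 ha), map_zero]
        simp only [this, smul_zero, neg_zero]
    rw [Finset.sum_congr rfl fun i _ => e i, ← map_sum, Finset.sum_neg_distrib]
    rfl
  rw [h1, h2]
  refine Prod.ext (add_zero _) ?_
  have := hH fun i => (x i).1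
  rw [exteriorDeriv] at this
  change -_ + -_ = (0 : SmoothFn E M)
  rw [← neg_add, add_comm, neg_eq_zero]
  exact this

theorem atiyah_jacobi (H : DiffForm E M (m + 2)) (hH : ∀ X, exteriorDeriv H X = 0)
    (k : ℕ) (d : Fin k → ℤ) (x : Fin k → VectorFields E M × SmoothFn E M)
    (hx : ∀ i, x i ∈ (atiyah H).deg (d i)) :
    shuffleSum
      (addFamily (singleArity 2 fun y => atiyahLie m (y 0) (y 1))
        (singleArity (m + 2) (atiyahForm H)))
      (addFamily (singleArity 2 fun y => atiyahLie m (y 0) (y 1))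
        (singleArity (m + 2) (atiyahForm H))) d x = 0 := by
  have hC : ∀ k, ∃ F : MultilinearMap ℝ (fun _ : Fin k => VectorFields E M × SmoothFn E M)
      (VectorFields E M × SmoothFn E M),
      ⇑F = addFamily (singleArity 2 fun y => atiyahLie m (y 0) (y 1))
        (singleArity (m + 2) (atiyahForm H)) k := exists_multilinear_atiyah H
  rw [shuffleSum_add_left _ _ (cons_add_of_multilinear hC),
    shuffleSum_add_right, shuffleSum_add_right, shuffleSum_atiyahLie H k d x hx,
    shuffleSum_atiyahForm, zero_add, add_zero]
  exact shuffleSum_atiyahLie_atiyahForm H hH k d x hx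

theorem atiyah_bracket_of_ne (H : DiffForm E M (m + 2)) {k : ℕ} (hk : k ≠ 2)
    (x : Fin k → VectorFields E M × SmoothFn E M) :
    (atiyah H).bracket k x = singleArity (m + 2) (atiyahForm H) k x := by
  change singleArity 2 (fun y => atiyahLie m (y 0) (y 1)) k x +
    singleArity (m + 2) (atiyahForm H) k x = _
  rw [singleArity_ne _ hk, zero_add]

/-- For `m = 0` the form $H$ is part of the binary bracket. Being linear over functions, it adds
nothing to the anchor term. -/
theorem atiyah_leibniz (H : DiffForm E M (m + 2)) (a : SmoothFn E M)
    (x y : VectorFields E M × SmoothFn E M) :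
    atiyahLie m x (a • y) + singleArity (m + 2) (atiyahForm H) 2 ![x, a • y] =
      a • (atiyahLie m x y + singleArity (m + 2) (atiyahForm H) 2 ![x, y]) + x.1 a • y := by
  have h : singleArity (m + 2) (atiyahForm H) 2 ![x, a • y] =
      a • singleArity (m + 2) (atiyahForm H) 2 ![x, y] := by
    obtain ⟨F, hF⟩ := exists_multilinear_singleArity (SmoothFn E M)
      (exists_multilinear_atiyahForm H) 2
    have := F.map_update_smul ![x, y] 1 a y
    rw [hF] at this
    convert this using 2
    · funext i
      fin_cases i <;> rfl
    · congr 1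
      funext i
      fin_cases i <;> rfl
  rw [h, smul_add]
  refine (congrArg (· + _) (semidirectBracket_leibniz (m + 1) a x y)).trans ?_
  exact add_right_comm _ _ _

theorem atiyah_isLInftyAlgebroid (H : DiffForm E M (m + 2)) (hH : ∀ X, exteriorDeriv H X = 0) :
    (atiyah H).IsLInftyAlgebroid where
  graded := atiyah_isInternal H
  bracket_zero x := by
    rw [atiyah_bracket]
    exact add_zero _
  multilinear := exists_multilinear_atiyah H
  bracket_mem := atiyah_bracket_mem H
  symmetric := atiyah_symmetric H
  jacobi := atiyah_jacobi H hH
  diff_smul a x := by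
    have : ∀ y, (atiyah H).bracket 1 y = 0 := fun y => add_zero _
    rw [PreLInftyAlgebroid.diff, PreLInftyAlgebroid.diff, this, this, smul_zero]
  leibniz a x y := atiyah_leibniz H a x y
  linear k hk := by
    have h : (atiyah H).bracket k = singleArity (m + 2) (atiyahForm H) k :=
      funext (atiyah_bracket_of_ne H (by omega))
    rw [h]
    exact exists_multilinear_singleArity (SmoothFn E M) (exists_multilinear_atiyahForm H) k
  anchor_deg i hi x hx := hx.1 hi
  anchor_diff x := add_zero _
  anchor_bracket x y := by
    exact (congrArg (_ + ·) (singleArity_atiyahForm_fst H _ _)).trans (add_zero _)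
  anchor_higher k hk x := by
    have hk : k ≠ 2 := by omega
    exact (congrArg Prod.fst (atiyah_bracket_of_ne H hk x)).trans (singleArity_atiyahForm_fst H k x)

end AtiyahAlgebroid

/-! ### $\check{\mathrm C}\mathrm{At}(g)$ is a dg Lie algebroid -/

section CechAtiyahAlgebroid

open TopologicalSpace (Opens)

variable {Λ : Type*} {U : Λ → Opens M}

theorem totalCechDiff_add (h h' : CechCochains E U) :
    totalCechDiff U (h + h') = totalCechDiff U h + totalCechDiff U h' := by
  funext k
  cases k with
  | zero => exact (add_zero _).symm
  | succ k => exact map_add (cechDiff U k) (h k) (h' k)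

theorem totalCechDiff_smul (a : SmoothFn E M) (h : CechCochains E U) :
    totalCechDiff U (a • h) = a • totalCechDiff U h := by
  funext k
  cases k with
  | zero => exact (smul_zero a).symm
  | succ k => exact map_smul (cechDiff U k) a (h k)

variable [FiniteDimensional ℝ E] [IsManifold (modelWithCornersSelf ℝ E) ∞ M] [T2Space M]
variable (g : CircleCochain E U (m + 1))

/-- The vector field underlying an element of `ČAt(g)` and one of its components, on an
intersection of members of the cover. -/
def cechSlot (k : ℕ) (a : Fin (k + 1) → Λ) :
    cechAtiyahModule g →ₗ[ℝ] VectorFields E (inter U a) × SmoothFn E (inter U a) where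
  toFun x := (resVF (inter U a) x.1.1, x.1.2 k a)
  map_add' _ _ := rfl
  map_smul' _ _ := rfl

/-- The vector field underlying an element of `ČAt(g)`. -/
def cechField : cechAtiyahModule g →ₗ[SmoothFn E M] VectorFields E M :=
  LinearMap.fst _ _ _ ∘ₗ (cechAtiyahModule g).subtype

variable {g}

/-- Slots see a vector field only through its restrictions to intersections, so the vector field
itself is compared separately. -/
theorem cech_ext {x y : cechAtiyahModule g} (h : cechField g x = cechField g y)
    (h' : ∀ k a, cechSlot g k a x = cechSlot g k a y) : x = y :=
  Subtype.ext (Prod.ext h (funext fun k => funext fun a => congrArg Prod.snd (h' k a)))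

theorem resVF_resFn (V : Opens M) (X : VectorFields E M) (a : SmoothFn E M) :
    resVF V X (resFn V a) = resFn V (X a) := by
  ext x
  exact resVF_apply V X _ x a (.of_forall fun _ => rfl)

theorem cechSlot_smul (k : ℕ) (b : Fin (k + 1) → Λ) (a : SmoothFn E M) (x : cechAtiyahModule g) :
    cechSlot g k b (a • x) = resFn (inter U b) a • cechSlot g k b x := rfl

theorem cechField_bracket (x y : cechAtiyahModule g) :
    cechField g (cechAtiyahBracket g x y) = ⁅cechField g x, cechField g y⁆ := rfl

/-- Restriction of vector fields preserves Lie brackets, so each slot maps to a semidirect product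
over an intersection. Bilinearity, graded symmetry and the Jacobi identity are inherited from there.
-/
theorem cechSlot_bracket (k : ℕ) (a : Fin (k + 1) → Λ) (x y : cechAtiyahModule g) :
    cechSlot g k a (cechAtiyahBracket g x y) =
      semidirectBracket (m + 1 + k) (cechSlot g k a x) (cechSlot g k a y) :=
  Prod.ext (resVF_lie _ _ _) rfl

theorem cechAtiyahBracket_add_left (x y z : cechAtiyahModule g) :
    cechAtiyahBracket g (x + y) z = cechAtiyahBracket g x z + cechAtiyahBracket g y z := by
  refine cech_ext (add_lie (L := VectorFields E M) (M := VectorFields E M) x.1.1 y.1.1 z.1.1)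
    fun k a => ?_
  rw [map_add, cechSlot_bracket, cechSlot_bracket, cechSlot_bracket, map_add]
  exact semidirectBracket_add_left _ _ _ _

theorem cechAtiyahBracket_add_right (x y z : cechAtiyahModule g) :
    cechAtiyahBracket g x (y + z) = cechAtiyahBracket g x y + cechAtiyahBracket g x z := by
  refine cech_ext (lie_add (L := VectorFields E M) (M := VectorFields E M) x.1.1 y.1.1 z.1.1)
    fun k a => ?_
  rw [map_add, cechSlot_bracket, cechSlot_bracket, cechSlot_bracket, map_add]
  exact semidirectBracket_add_right _ _ _ _

theorem cechAtiyahBracket_smul_left (c : ℝ) (x y : cechAtiyahModule g) :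
    cechAtiyahBracket g (c • x) y = c • cechAtiyahBracket g x y := by
  refine cech_ext (smul_lie (L := VectorFields E M) (M := VectorFields E M) c x.1.1 y.1.1)
    fun k a => ?_
  rw [map_smul, cechSlot_bracket, cechSlot_bracket, map_smul]
  exact semidirectBracket_smul_left _ _ _ _

theorem cechAtiyahBracket_smul_right (c : ℝ) (x y : cechAtiyahModule g) :
    cechAtiyahBracket g x (c • y) = c • cechAtiyahBracket g x y := by
  refine cech_ext (lie_smul (L := VectorFields E M) (M := VectorFields E M) c x.1.1 y.1.1)
    fun k a => ?_
  rw [map_smul, cechSlot_bracket, cechSlot_bracket, map_smul]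
  exact semidirectBracket_smul_right _ _ _ _

theorem cechAtiyahBracket_zero_left (y : cechAtiyahModule g) : cechAtiyahBracket g 0 y = 0 := by
  have := cechAtiyahBracket_smul_left 0 0 y
  rwa [zero_smul, zero_smul] at this

theorem cechAtiyahDiff_apply (x : cechAtiyahModule g) (k : ℕ) :
    (cechAtiyahDiff g x).1.2 k =
      if k ≤ m then (-1 : ℝ) ^ (m + k) • totalCechDiff U x.1.2 k else 0 := rfl

theorem cechAtiyahDiff_add (x y : cechAtiyahModule g) :
    cechAtiyahDiff g (x + y) = cechAtiyahDiff g x + cechAtiyahDiff g y := by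
  refine Subtype.ext (Prod.ext (add_zero _).symm (funext fun k => ?_))
  change (if k ≤ m then (-1 : ℝ) ^ (m + k) • totalCechDiff U (x.1.2 + y.1.2) k else 0) =
    (if k ≤ m then (-1 : ℝ) ^ (m + k) • totalCechDiff U x.1.2 k else 0) +
    (if k ≤ m then (-1 : ℝ) ^ (m + k) • totalCechDiff U y.1.2 k else 0)
  split_ifs
  · rw [totalCechDiff_add, Pi.add_apply, smul_add]
  · exact (add_zero _).symm

theorem cechAtiyahDiff_smul (a : SmoothFn E M) (x : cechAtiyahModule g) :
    cechAtiyahDiff g (a • x) = a • cechAtiyahDiff g x := by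
  refine Subtype.ext (Prod.ext (smul_zero _).symm (funext fun k => ?_))
  change (if k ≤ m then (-1 : ℝ) ^ (m + k) • totalCechDiff U (a • x.1.2) k else 0) =
    a • (if k ≤ m then (-1 : ℝ) ^ (m + k) • totalCechDiff U x.1.2 k else 0)
  split_ifs
  · rw [totalCechDiff_smul, Pi.smul_apply, smul_comm]
  · exact (smul_zero _).symm

theorem cechAtiyahDiff_real_smul (c : ℝ) (x : cechAtiyahModule g) :
    cechAtiyahDiff g (c • x) = c • cechAtiyahDiff g x := by
  rw [← algebraMap_smul (SmoothFn E M) c x, cechAtiyahDiff_smul, algebraMap_smul]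

theorem cechAtiyahDiff_zero : cechAtiyahDiff g 0 = 0 := by
  have := cechAtiyahDiff_real_smul 0 (0 : cechAtiyahModule g)
  rwa [zero_smul, zero_smul] at this

variable (g)

theorem cechAtiyah_bracket : (cechAtiyah g).bracket =
    addFamily (singleArity 1 fun y => cechAtiyahDiff g (y 0))
      (singleArity 2 fun y => cechAtiyahBracket g (y 0) (y 1)) := by
  have h : ∀ (k : ℕ) (x : Fin k → cechAtiyahModule g),
      (if h : k = 1 then cechAtiyahDiff g (x (Fin.cast h.symm 0))
        else if h : k = 2 then
          cechAtiyahBracket g (x (Fin.cast h.symm 0)) (x (Fin.cast h.symm 1))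
        else 0) =
      singleArity 1 (fun y => cechAtiyahDiff g (y 0)) k x +
        singleArity 2 (fun y => cechAtiyahBracket g (y 0) (y 1)) k x := by
    intro k x
    by_cases h1 : k = 1
    · rw [dif_pos h1, singleArity_ne _ (by omega : k ≠ 2), add_zero]
      subst h1
      rw [singleArity_self]
      rfl
    · rw [dif_neg h1, singleArity_ne _ h1, zero_add]
      rfl
  exact funext fun k => funext (h k)

theorem exists_multilinear_cechAtiyahDiff :
    ∃ F : MultilinearMap ℝ (fun _ : Fin 1 => cechAtiyahModule g) (cechAtiyahModule g),
      ⇑F = fun x => cechAtiyahDiff g (x 0) :=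
  exists_multilinear_one ℝ (cechAtiyahDiff g) cechAtiyahDiff_add cechAtiyahDiff_real_smul

theorem exists_multilinear_cechAtiyahBracket :
    ∃ F : MultilinearMap ℝ (fun _ : Fin 2 => cechAtiyahModule g) (cechAtiyahModule g),
      ⇑F = fun x => cechAtiyahBracket g (x 0) (x 1) :=
  exists_multilinear_two ℝ (cechAtiyahBracket g) cechAtiyahBracket_add_left
    cechAtiyahBracket_add_right cechAtiyahBracket_smul_left cechAtiyahBracket_smul_right

theorem exists_multilinear_cechAtiyah (k : ℕ) :
    ∃ F : MultilinearMap ℝ (fun _ : Fin k => cechAtiyahModule g) (cechAtiyahModule g),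
      ⇑F = addFamily (singleArity 1 fun y => cechAtiyahDiff g (y 0))
        (singleArity 2 fun y => cechAtiyahBracket g (y 0) (y 1)) k :=
  exists_multilinear_addFamily ℝ (V := cechAtiyahModule g) (W := cechAtiyahModule g)
    (exists_multilinear_singleArity ℝ (V := cechAtiyahModule g) (W := cechAtiyahModule g)
      (exists_multilinear_cechAtiyahDiff g) k)
    (exists_multilinear_singleArity ℝ (V := cechAtiyahModule g) (W := cechAtiyahModule g)
      (exists_multilinear_cechAtiyahBracket g) k)

/-- The homogeneous component of degree `i`. -/
def cechComponent (i : ℤ) : cechAtiyahModule g →+ cechAtiyahModule g where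
  toFun x := ⟨(if i = 0 then x.1.1 else 0, fun k => if (k : ℤ) = m + i then x.1.2 k else 0), by
    refine ⟨fun k hk => ?_, ?_⟩
    · change (if (k : ℤ) = m + i then x.1.2 k else 0) = 0
      rw [x.2.1 k hk, ite_self]
    · change cechDlog g (if i = 0 then x.1.1 else 0) =
        cechDiff U m (if (m : ℤ) = m + i then x.1.2 m else 0)
      -- The condition $\mathrm d\log g(X)=\check\delta f$ links only pieces of degree zero, so it
      -- survives the projection.
      by_cases h : i = 0
      · subst h
        rw [if_pos rfl, if_pos (by simp)]
        exact x.2.2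
      · rw [if_neg h, if_neg (by omega), map_zero, map_zero]⟩
  map_zero' := Subtype.ext (Prod.ext (ite_self _) (funext fun k => ite_self _))
  map_add' x y := by
    refine Subtype.ext (Prod.ext ?_ (funext fun k => ?_))
    · change (if i = 0 then x.1.1 + y.1.1 else 0) =
        (if i = 0 then x.1.1 else 0) + (if i = 0 then y.1.1 else 0)
      split_ifs
      · rfl
      · exact (add_zero _).symm
    · change (if (k : ℤ) = m + i then x.1.2 k + y.1.2 k else 0) =
        (if (k : ℤ) = m + i then x.1.2 k else 0) + (if (k : ℤ) = m + i then y.1.2 k else 0)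
      split_ifs
      · rfl
      · exact (add_zero _).symm

theorem cechAtiyah_isInternal : DirectSum.IsInternal (cechAtiyah g).deg := by
  refine isInternal_of_projections (cechAtiyah g).deg (cechComponent g) ?_ ?_ ?_
    (Finset.Icc (-m : ℤ) 0) ?_
  · intro i x
    exact ⟨fun h => if_neg h, fun k h => if_neg h⟩
  · rintro i x ⟨h1, h2⟩
    refine Subtype.ext (Prod.ext ?_ (funext fun k => ?_))
    · change (if i = 0 then x.1.1 else 0) = x.1.1
      split_ifs with h
      · rfl
      · exact (h1 h).symm
    · change (if (k : ℤ) = m + i then x.1.2 k else 0) = x.1.2 k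
      split_ifs with h
      · rfl
      · exact (h2 k h).symm
  · rintro i j hij x ⟨h1, h2⟩
    refine Subtype.ext (Prod.ext ?_ (funext fun k => ?_))
    · change (if i = 0 then x.1.1 else 0) = 0
      split_ifs with h
      · exact h1 fun e => hij (h.trans e.symm)
      · rfl
    · change (if (k : ℤ) = m + i then x.1.2 k else 0) = 0
      split_ifs with h
      · exact h2 k fun e => hij (by omega)
      · rfl
  · intro x
    refine Subtype.ext (Prod.ext ?_ (funext fun k => ?_))
    · refine (map_sum (cechField g) _ _).trans ?_
      change ∑ i ∈ Finset.Icc (-m : ℤ) 0, (if i = 0 then x.1.1 else 0) = x.1.1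
      rw [Finset.sum_ite_eq', if_pos (by simp)]
    · refine (map_sum (LinearMap.proj k ∘ₗ LinearMap.snd (SmoothFn E M) (VectorFields E M)
        (CechCochains E U) ∘ₗ (cechAtiyahModule g).subtype) _ _).trans ?_
      change ∑ i ∈ Finset.Icc (-m : ℤ) 0, (if (k : ℤ) = m + i then x.1.2 k else 0) = x.1.2 k
      by_cases hk : k ≤ m
      · rw [Finset.sum_eq_single (k - m : ℤ), if_pos (by ring)]
        · intro i _ hi
          exact if_neg fun h => hi (by omega)
        · intro h
          exact absurd (Finset.mem_Icc.2 ⟨by omega, by omega⟩) h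
      · rw [x.2.1 k (by omega)]
        exact Finset.sum_eq_zero fun i _ => ite_self _

variable {g}

theorem cech_sign_of_deg {i : ℤ} {x : cechAtiyahModule g} (hx : x ∈ (cechAtiyah g).deg i)
    {k : ℕ} {a : Fin (k + 1) → Λ} (h : (cechSlot g k a x).2 ≠ 0) :
    (i - 1).negOnePow = (-1) ^ (m + 1 + k) :=
  negOnePow_eq_of_deg (by_contra fun hk => h (congrFun (hx.2 k hk) a))

theorem cechSlot_fst_of_deg {i : ℤ} {x : cechAtiyahModule g} (hx : x ∈ (cechAtiyah g).deg i)
    (k : ℕ) (a : Fin (k + 1) → Λ) (h : i ≠ 0) : (cechSlot g k a x).1 = 0 :=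
  (congrArg (resVF (inter U a)) (hx.1 h)).trans (resVF_zero _)

theorem cechAtiyahBracket_mem {d e : ℤ} {x y : cechAtiyahModule g}
    (hx : x ∈ (cechAtiyah g).deg d) (hy : y ∈ (cechAtiyah g).deg e) :
    cechAtiyahBracket g x y ∈ (cechAtiyah g).deg (d + e) := by
  constructor
  · intro h
    change ⁅x.1.1, y.1.1⁆ = 0
    by_cases h1 : d = 0
    · rw [hy.1 (by omega)]
      exact lie_zero (L := VectorFields E M) (M := VectorFields E M) x.1.1
    · rw [hx.1 h1]
      exact zero_lie (L := VectorFields E M) (M := VectorFields E M) y.1.1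
  · intro k h
    funext a
    have X0 : ∀ {Z : VectorFields E (inter U a)} {f : SmoothFn E (inter U a)},
        (Z = 0 ∨ f = 0) → Z f = 0 := by
      rintro Z f (h | h)
      · rw [h]
        rfl
      · rw [h, map_zero]
    change resVF (inter U a) x.1.1 (y.1.2 k a) +
      (-1 : ℝ) ^ (m + 1 + k) • resVF (inter U a) y.1.1 (x.1.2 k a) = 0
    rw [X0, X0, smul_zero, add_zero]
    · by_cases h1 : e = 0
      · exact Or.inr (congrFun (hx.2 k (by omega)) a)
      · exact Or.inl (cechSlot_fst_of_deg hy k a h1)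
    · by_cases h1 : d = 0
      · exact Or.inr (congrFun (hy.2 k (by omega)) a)
      · exact Or.inl (cechSlot_fst_of_deg hx k a h1)

theorem cechAtiyahDiff_mem {d : ℤ} {x : cechAtiyahModule g} (hx : x ∈ (cechAtiyah g).deg d) :
    cechAtiyahDiff g x ∈ (cechAtiyah g).deg (d + 1) := by
  refine ⟨fun _ => rfl, fun k hk => ?_⟩
  rw [cechAtiyahDiff_apply]
  split_ifs
  · cases k with
    | zero => exact smul_zero _
    | succ k =>
      change _ • cechDiff U k (x.1.2 k) = 0
      rw [hx.2 k (by push_cast at hk; omega), map_zero, smul_zero]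
  · rfl

variable (g)

theorem cechAtiyah_bracket_mem (k : ℕ) (d : Fin k → ℤ) (x : Fin k → cechAtiyahModule g)
    (hx : ∀ i, x i ∈ (cechAtiyah g).deg (d i)) :
    (cechAtiyah g).bracket k x ∈ (cechAtiyah g).deg ((∑ i, d i) + 2 - k) := by
  rw [cechAtiyah_bracket]
  refine Submodule.add_mem _ ?_ ?_
  · by_cases hk : k = 1
    · subst hk
      have := cechAtiyahDiff_mem (hx 0)
      rw [singleArity_self, Fin.sum_univ_one]
      rwa [show d 0 + 2 - (1 : ℕ) = d 0 + 1 by push_cast; ring]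
    · rw [singleArity_ne _ hk]
      exact Submodule.zero_mem _
  · by_cases hk : k = 2
    · subst hk
      have := cechAtiyahBracket_mem (hx 0) (hx 1)
      rw [singleArity_self, Fin.sum_univ_two]
      rwa [show d 0 + d 1 + 2 - (2 : ℕ) = d 0 + d 1 by push_cast; ring]
    · rw [singleArity_ne _ hk]
      exact Submodule.zero_mem _

variable {g}

theorem cechAtiyahBracket_swap {d e : ℤ} {x y : cechAtiyahModule g}
    (hx : x ∈ (cechAtiyah g).deg d) (hy : y ∈ (cechAtiyah g).deg e) :
    cechAtiyahBracket g y x = ((d - 1) * (e - 1)).negOnePow • cechAtiyahBracket g x y := by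
  refine cech_ext ?_ fun k a => ?_
  · refine Eq.trans ?_ (map_units_smul (cechField g) _ (cechAtiyahBracket g x y)).symm
    change ⁅y.1.1, x.1.1⁆ = _ • ⁅x.1.1, y.1.1⁆
    by_cases e0 : d = 0
    swap
    · rw [hx.1 e0]
      refine (lie_zero (L := VectorFields E M) (M := VectorFields E M) y.1.1).trans ?_
      rw [show ⁅(0 : VectorFields E M), y.1.1⁆ = 0 from
        zero_lie (L := VectorFields E M) (M := VectorFields E M) y.1.1, smul_zero]
    by_cases e1 : e = 0
    swap
    · rw [hy.1 e1]
      refine (zero_lie (L := VectorFields E M) (M := VectorFields E M) x.1.1).trans ?_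
      rw [show ⁅x.1.1, (0 : VectorFields E M)⁆ = 0 from
        lie_zero (L := VectorFields E M) (M := VectorFields E M) x.1.1, smul_zero]
    subst e0 e1
    rw [show ((0 - 1) * (0 - 1) : ℤ).negOnePow = -1 from rfl, Units.neg_smul, one_smul]
    exact (lie_skew (L := VectorFields E M) y.1.1 x.1.1).symm
  · refine Eq.trans ?_ (map_units_smul (cechSlot g k a) _ (cechAtiyahBracket g x y)).symm
    rw [cechSlot_bracket, cechSlot_bracket]
    exact semidirectBracket_swap _ (cechSlot_fst_of_deg hx k a) (cechSlot_fst_of_deg hy k a)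
      (cech_sign_of_deg hx) (cech_sign_of_deg hy)

variable (g)

theorem cechAtiyah_symmetric (k : ℕ) (d : Fin k → ℤ) (x : Fin k → cechAtiyahModule g)
    (hx : ∀ i, x i ∈ (cechAtiyah g).deg (d i)) (σ : Equiv.Perm (Fin k)) :
    (cechAtiyah g).bracket k (x ∘ σ.symm) = koszulSign σ d • (cechAtiyah g).bracket k x := by
  rw [cechAtiyah_bracket]
  refine (congrArg₂ (· + ·) ?_ (symmetric_of_swap (cechAtiyahBracket g) d x
    (fun i j => cechAtiyahBracket_swap (hx i) (hx j)) σ)).trans (smul_add _ _ _).symm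
  by_cases hk : k = 1
  · subst hk
    rw [Subsingleton.elim σ 1, show koszulSign (1 : Equiv.Perm (Fin 1)) d = 1 from
      koszulSign_of_monotone monotone_id d]
    exact (one_smul ℤˣ (singleArity 1 (fun y => cechAtiyahDiff g (y 0)) 1 x)).symm
  · exact (singleArity_ne _ hk _).trans
      ((congrArg (koszulSign σ d • ·) (singleArity_ne _ hk x)).trans (smul_zero _)).symm

variable {g}

theorem cechAtiyahDiff_cechAtiyahDiff (x : cechAtiyahModule g) :
    cechAtiyahDiff g (cechAtiyahDiff g x) = 0 := by
  refine Subtype.ext (Prod.ext rfl (funext fun k => ?_))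
  rw [cechAtiyahDiff_apply]
  split_ifs with h
  · rcases k with _ | _ | k
    · exact smul_zero _
    · change _ • cechDiff U 0 ((cechAtiyahDiff g x).1.2 0) = 0
      rw [cechAtiyahDiff_apply, if_pos (by omega)]
      change _ • cechDiff U 0 (_ • 0) = 0
      rw [smul_zero, map_zero, smul_zero]
    · change _ • cechDiff U (k + 1) ((cechAtiyahDiff g x).1.2 (k + 1)) = 0
      rw [cechAtiyahDiff_apply, if_pos (by omega), LinearMap.map_smul_of_tower]
      change _ • _ • cechDiff U (k + 1) (cechDiff U k _) = 0
      rw [cechDiff_cechDiff, smul_zero, smul_zero]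
  · rfl

theorem lieCech_zero_right {k : ℕ} (X : VectorFields E M) :
    lieCech U X (0 : CechFn (E := E) U k) = 0 :=
  funext fun a => map_zero (resVF (inter U a) X)

theorem lieCech_zero_left {k : ℕ} (f : CechFn (E := E) U k) : lieCech U 0 f = 0 := rfl

theorem lieCech_smul_right {k : ℕ} (X : VectorFields E M) (c : ℝ) (f : CechFn (E := E) U k) :
    lieCech U X (c • f) = c • lieCech U X f :=
  funext fun a => (resVF (inter U a) X).map_smul c _

/-- The differential of `ČAt(g)` is a derivation of the bracket. -/
theorem cechAtiyahDiff_bracket {d e : ℤ} {x y : cechAtiyahModule g}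
    (hx : x ∈ (cechAtiyah g).deg d) (hy : y ∈ (cechAtiyah g).deg e) :
    cechAtiyahBracket g (cechAtiyahDiff g x) y +
      ((d - 1) * (e - 1)).negOnePow • cechAtiyahBracket g (cechAtiyahDiff g y) x +
      cechAtiyahDiff g (cechAtiyahBracket g x y) = 0 := by
  have z : ∀ X : VectorFields E M, ⁅(0 : VectorFields E M), X⁆ = 0 := fun X =>
    zero_lie (L := VectorFields E M) (M := VectorFields E M) X
  refine Subtype.ext (Prod.ext ?_ (funext fun k => ?_))
  · change ⁅(0 : VectorFields E M), y.1.1⁆ + ((d - 1) * (e - 1)).negOnePow •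
      ⁅(0 : VectorFields E M), x.1.1⁆ + 0 = 0
    rw [z, z, smul_zero, add_zero, add_zero]
  · change (lieCech U 0 (y.1.2 k) +
        (-1 : ℝ) ^ (m + 1 + k) • lieCech U y.1.1 ((cechAtiyahDiff g x).1.2 k)) +
      ((d - 1) * (e - 1)).negOnePow • (lieCech U 0 (x.1.2 k) +
        (-1 : ℝ) ^ (m + 1 + k) • lieCech U x.1.1 ((cechAtiyahDiff g y).1.2 k)) +
      (cechAtiyahDiff g (cechAtiyahBracket g x y)).1.2 k = 0
    rw [lieCech_zero_left, lieCech_zero_left, zero_add, zero_add, cechAtiyahDiff_apply,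
      cechAtiyahDiff_apply, cechAtiyahDiff_apply]
    split_ifs with hk
    swap
    · simp only [lieCech_zero_right, smul_zero, add_zero]
    cases k with
    | zero =>
      change _ • lieCech U _ (_ • 0) + _ • (_ • lieCech U _ (_ • 0)) + _ • 0 = 0
      simp only [smul_zero, lieCech_zero_right, add_zero]
    | succ k =>
      change _ • lieCech U _ (_ • cechDiff U k (x.1.2 k)) +
        _ • (_ • lieCech U _ (_ • cechDiff U k (y.1.2 k))) +
        _ • cechDiff U k (lieCech U x.1.1 (y.1.2 k) +
          (-1 : ℝ) ^ (m + 1 + k) • lieCech U y.1.1 (x.1.2 k)) = 0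
      -- The signs `s` and `s'` are opposite, so the two terms with the Lie derivative along the
      -- vector field of `y` cancel.
      have s : (-1 : ℝ) ^ (m + 1 + (k + 1)) * (-1) ^ (m + (k + 1)) = -1 := by
        rw [← pow_add, show m + 1 + (k + 1) + (m + (k + 1)) = 2 * (m + k + 1) + 1 by ring, pow_succ,
          pow_mul]
        simp
      have s' : (-1 : ℝ) ^ (m + (k + 1)) * (-1) ^ (m + 1 + k) = 1 := by
        rw [← pow_add, show m + (k + 1) + (m + 1 + k) = 2 * (m + k + 1) by ring, pow_mul]
        simp
      rw [lieCech_smul_right, lieCech_smul_right, smul_smul, smul_smul, s, map_add,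
        LinearMap.map_smul_of_tower, smul_add, smul_smul, s', one_smul, neg_one_smul, neg_one_smul,
        lieCech_cechDiff, lieCech_cechDiff]
      -- The other two terms carry the Koszul sign and the sign of the differential. These agree
      -- whenever the term is nonzero, since then `d = 0` and `k = m + e`.
      have key : ((d - 1) * (e - 1)).negOnePow • cechDiff U k (lieCech U x.1.1 (y.1.2 k)) =
          (-1 : ℝ) ^ (m + (k + 1)) • cechDiff U k (lieCech U x.1.1 (y.1.2 k)) := by
        by_cases h0 : d = 0
        swap
        · rw [hx.1 h0, lieCech_zero_left, map_zero, smul_zero, smul_zero]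
        by_cases h1 : (k : ℤ) = m + e
        swap
        · rw [hy.2 k h1, lieCech_zero_right, map_zero, smul_zero, smul_zero]
        rw [h0, zero_sub, neg_one_mul, Int.negOnePow_neg, negOnePow_eq_of_deg h1,
          neg_one_pow_units_smul, show m + 1 + k = m + (k + 1) by ring]
      rw [smul_neg, key]
      abel

variable (g)

theorem singleArity_cechAtiyahDiff_cons (r : ℕ) (y : Fin r → cechAtiyahModule g) :
    singleArity 1 (fun y => cechAtiyahDiff g (y 0)) (r + 1) (Fin.cons 0 y) = 0 := by
  by_cases hr : r = 0
  · subst hr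
    rw [singleArity_self]
    exact cechAtiyahDiff_zero
  · rw [singleArity_ne _ (by omega)]

theorem singleArity_cechAtiyahBracket_cons (r : ℕ) (y : Fin r → cechAtiyahModule g) :
    singleArity 2 (fun y => cechAtiyahBracket g (y 0) (y 1)) (r + 1) (Fin.cons 0 y) = 0 := by
  by_cases hr : r = 1
  · subst hr
    rw [singleArity_self]
    exact cechAtiyahBracket_zero_left _
  · rw [singleArity_ne _ (by omega)]

theorem shuffleSum_cechAtiyahDiff (k : ℕ) (d : Fin k → ℤ) (x : Fin k → cechAtiyahModule g) :
    shuffleSum (singleArity 1 fun y => cechAtiyahDiff g (y 0))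
      (singleArity 1 fun y => cechAtiyahDiff g (y 0)) d x = 0 := by
  by_cases h1 : k = 1
  · subst h1
    rw [shuffleSum_univ one_pos _ (singleArity_cechAtiyahDiff_cons g), singleArity_self]
    exact cechAtiyahDiff_cechAtiyahDiff _
  · exact shuffleSum_singleArity_of_ne one_pos _ _ (fun y => cechAtiyahDiff_zero) (by omega) d x

theorem shuffleSum_cechAtiyahDiff_bracket (k : ℕ) (d : Fin k → ℤ) (x : Fin k → cechAtiyahModule g)
    (hx : ∀ i, x i ∈ (cechAtiyah g).deg (d i)) :
    shuffleSum (singleArity 1 fun y => cechAtiyahDiff g (y 0))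
        (singleArity 2 fun y => cechAtiyahBracket g (y 0) (y 1)) d x +
      shuffleSum (singleArity 2 fun y => cechAtiyahBracket g (y 0) (y 1))
        (singleArity 1 fun y => cechAtiyahDiff g (y 0)) d x = 0 := by
  by_cases h2 : k = 2
  · subst h2
    rw [shuffleSum_compl_singleton one_pos _ (singleArity_cechAtiyahBracket_cons g),
      shuffleSum_univ two_pos _ (singleArity_cechAtiyahDiff_cons g), Fin.sum_univ_two,
      koszulSign_two, koszulSign_of_monotone (by decide), one_smul, singleArity_self,
      singleArity_self, add_comm (_ • _)]
    exact cechAtiyahDiff_bracket (hx 0) (hx 1)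
  · rw [shuffleSum_singleArity_of_ne one_pos _ _ (fun y => cechAtiyahBracket_zero_left _)
      (by omega), shuffleSum_singleArity_of_ne two_pos _ _ (fun y => cechAtiyahDiff_zero)
      (by omega), add_zero]

theorem cechSlot_bracket_bracket (k : ℕ) (a : Fin (k + 1) → Λ) (u v w : cechAtiyahModule g) :
    cechSlot g k a (cechAtiyahBracket g (cechAtiyahBracket g u v) w) =
      semidirectBracket (m + 1 + k)
        (semidirectBracket (m + 1 + k) (cechSlot g k a u) (cechSlot g k a v))
        (cechSlot g k a w) := by
  rw [cechSlot_bracket, cechSlot_bracket]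

theorem shuffleSum_cechAtiyahBracket (k : ℕ) (d : Fin k → ℤ) (x : Fin k → cechAtiyahModule g)
    (hx : ∀ i, x i ∈ (cechAtiyah g).deg (d i)) :
    shuffleSum (singleArity 2 fun y => cechAtiyahBracket g (y 0) (y 1))
      (singleArity 2 fun y => cechAtiyahBracket g (y 0) (y 1)) d x = 0 := by
  by_cases h3 : k = 3
  · subst h3
    rw [shuffleSum_three _ _ fun y => cechAtiyahBracket_zero_left _]
    simp only [Matrix.cons_val_zero, Matrix.cons_val_one]
    refine cech_ext ?_ fun k a => ?_
    · rw [map_add, map_add, map_units_smul, map_units_smul, map_zero]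
      exact graded_jacobi_lie (hx 0).1 (hx 1).1 (hx 2).1
    · rw [map_add, map_add, map_units_smul, map_units_smul, map_zero, cechSlot_bracket_bracket,
        cechSlot_bracket_bracket, cechSlot_bracket_bracket]
      exact semidirectBracket_jacobi (m + 1 + k) (cechSlot_fst_of_deg (hx 0) k a)
        (cechSlot_fst_of_deg (hx 1) k a) (cechSlot_fst_of_deg (hx 2) k a)
        (cech_sign_of_deg (hx 0)) (cech_sign_of_deg (hx 1)) (cech_sign_of_deg (hx 2))
  · exact shuffleSum_singleArity_of_ne two_pos _ _ (fun y => cechAtiyahBracket_zero_left _) h3 d x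

theorem cechAtiyah_jacobi (k : ℕ) (d : Fin k → ℤ) (x : Fin k → cechAtiyahModule g)
    (hx : ∀ i, x i ∈ (cechAtiyah g).deg (d i)) :
    shuffleSum
      (addFamily (singleArity 1 fun y => cechAtiyahDiff g (y 0))
        (singleArity 2 fun y => cechAtiyahBracket g (y 0) (y 1)))
      (addFamily (singleArity 1 fun y => cechAtiyahDiff g (y 0))
        (singleArity 2 fun y => cechAtiyahBracket g (y 0) (y 1))) d x = 0 := by
  have hC := cons_add_of_multilinear (V := cechAtiyahModule g) (W := cechAtiyahModule g)
    (C := addFamily (singleArity 1 fun y => cechAtiyahDiff g (y 0))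
      (singleArity 2 fun y => cechAtiyahBracket g (y 0) (y 1)))
    (exists_multilinear_cechAtiyah g)
  rw [shuffleSum_add_left _ _ hC, shuffleSum_add_right, shuffleSum_add_right,
    shuffleSum_cechAtiyahDiff, shuffleSum_cechAtiyahBracket g k d x hx, zero_add, add_zero]
  exact shuffleSum_cechAtiyahDiff_bracket g k d x hx

theorem cechAtiyahBracket_leibniz (a : SmoothFn E M) (x y : cechAtiyahModule g) :
    cechAtiyahBracket g x (a • y) =
      a • cechAtiyahBracket g x y + cechField g x a • y := by
  refine cech_ext ?_ fun k b => ?_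
  · change ⁅x.1.1, a • y.1.1⁆ = a • ⁅x.1.1, y.1.1⁆ + x.1.1 a • y.1.1
    exact congrArg Prod.fst (semidirectBracket_leibniz 0 a (x.1.1, 0) (y.1.1, 0))
  · rw [map_add, cechSlot_smul, cechSlot_smul, cechSlot_bracket, cechSlot_bracket, cechSlot_smul,
      ← resVF_resFn]
    exact semidirectBracket_leibniz _ _ _ _

theorem cechAtiyah_isLInftyAlgebroid : (cechAtiyah g).IsLInftyAlgebroid where
  graded := cechAtiyah_isInternal g
  bracket_zero x := rfl
  multilinear k := by
    rw [cechAtiyah_bracket]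
    exact exists_multilinear_cechAtiyah g k
  bracket_mem := cechAtiyah_bracket_mem g
  symmetric := cechAtiyah_symmetric g
  jacobi k d x hx := by
    change shuffleSum (cechAtiyah g).bracket (cechAtiyah g).bracket d x = 0
    rw [cechAtiyah_bracket]
    exact cechAtiyah_jacobi g k d x hx
  diff_smul a x := cechAtiyahDiff_smul a x
  leibniz a x y := cechAtiyahBracket_leibniz g a x y
  linear k hk := ⟨0, by
    rw [cechAtiyah_bracket]
    funext x
    have h1 : k ≠ 1 := by omega
    have h2 : k ≠ 2 := by omega
    exact ((congrArg₂ (· + ·) (singleArity_ne _ h1 x) (singleArity_ne _ h2 x)).trans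
      (add_zero _)).symm⟩
  anchor_deg i hi x hx := hx.1 hi
  anchor_diff x := rfl
  anchor_bracket x y := rfl
  anchor_higher k hk x := by
    have h1 : k ≠ 1 := by omega
    have h2 : k ≠ 2 := by omega
    have : (cechAtiyah g).bracket k x = 0 := by
      rw [cechAtiyah_bracket]
      exact (congrArg₂ (· + ·) (singleArity_ne _ h1 x) (singleArity_ne _ h2 x)).trans
        (add_zero _)
    rw [this, map_zero]

end CechAtiyahAlgebroid

/-! ### Exactness of the Čech complex by a partition of unity -/

section CechExactness

open TopologicalSpace (Opens)

variable {Λ : Type*} {U : Λ → Opens M}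

/-- The value of a function on `V` at a point of `M`, extended by zero. -/
def extendByZero (V : Opens M) (f : SmoothFn E V) (x : M) : ℝ :=
  open Classical in if h : x ∈ V then f ⟨x, h⟩ else 0

theorem extendByZero_of_mem {V : Opens M} (f : SmoothFn E V) {x : M} (h : x ∈ V) :
    extendByZero V f x = f ⟨x, h⟩ := dif_pos h

theorem contMDiffAt_extendByZero {V : Opens M} (f : SmoothFn E V) {x : M} (h : x ∈ V) :
    ContMDiffAt (modelWithCornersSelf ℝ E) 𝓘(ℝ, ℝ) ∞ (extendByZero V f) x := by
  rw [← contMDiffAt_subtype_iff (U := V) (x := ⟨x, h⟩)]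
  exact (f.contMDiff ⟨x, h⟩).congr_of_eventuallyEq
    (.of_forall fun z => extendByZero_of_mem f z.2)

/-- The values of a Čech cochain at a point of `M`, extended by zero. -/
def cechValue {k : ℕ} (f : CechFn (E := E) U k) (x : M) (a : Fin (k + 1) → Λ) : ℝ :=
  extendByZero (inter U a) (f a) x

theorem cechValue_of_mem {k : ℕ} (f : CechFn (E := E) U k) {x : M} {a : Fin (k + 1) → Λ}
    (h : x ∈ inter U a) : cechValue f x a = f a ⟨x, h⟩ := extendByZero_of_mem _ h

theorem mem_inter {k : ℕ} {a : Fin k → Λ} {x : M} : x ∈ inter U a ↔ ∀ i, x ∈ U (a i) :=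
  Set.mem_iInter

/-- Extension by zero makes this an alternating sum of real numbers whose terms no longer live on
domains that vary with the multi-index. -/
theorem cechDiff_apply_point {k : ℕ} (f : CechFn (E := E) U k) (a : Fin (k + 2) → Λ) {x : M}
    (hx : x ∈ inter U a) : cechDiff U k f a ⟨x, hx⟩ =
      ∑ i : Fin (k + 2), (-1 : ℝ) ^ (i : ℕ) *
        cechValue f x (a ∘ i.succAbove) := by
  let ev : SmoothFn E (inter U a) →+ ℝ := ⟨⟨fun f => f ⟨x, hx⟩, rfl⟩, fun _ _ => rfl⟩
  change ev (∑ i : Fin (k + 2), (-1 : ℝ) ^ (i : ℕ) •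
    resOpen (inter_le U a i.succAbove) (f (a ∘ i.succAbove))) = _
  rw [map_sum]
  refine Finset.sum_congr rfl fun i _ => ?_
  rw [cechValue_of_mem f (inter_le U a i.succAbove hx)]
  rfl

theorem augment_injective (hU : ∀ x : M, ∃ a, x ∈ U a) {F : SmoothFn E M}
    (hF : augment U F = 0) : F = 0 := by
  ext x
  obtain ⟨a, ha⟩ := hU x
  have := congrArg (fun f : CechFn (E := E) U 0 => f (fun _ => a) ⟨x, mem_inter.2 fun _ => ha⟩) hF
  exact this

theorem cechDiff_augment (F : SmoothFn E M) : cechDiff U 0 (augment U F) = 0 := by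
  funext a
  ext ⟨x, hx⟩
  rw [cechDiff_apply_point, Fin.sum_univ_two,
    cechValue_of_mem _ (inter_le U a (Fin.succAbove 0) hx),
    cechValue_of_mem _ (inter_le U a (Fin.succAbove 1) hx)]
  change (-1 : ℝ) ^ 0 * F x + (-1 : ℝ) ^ 1 * F x = 0
  ring

/-- The contracting homotopy of the Čech complex given by a partition of unity. -/
def cechContraction (ρ : SmoothPartitionOfUnity Λ (modelWithCornersSelf ℝ E) M) {k : ℕ}
    (f : CechFn (E := E) U k) (b : Fin k → Λ) (x : M) : ℝ :=
  ∑ᶠ c, ρ c x • cechValue f x (Fin.cons c b)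

/-- Wherever `ρ c` matters the point lies in `U c`, hence in the domain on which the extension by
zero is smooth. -/
theorem contMDiffAt_cechContraction
    (ρ : SmoothPartitionOfUnity Λ (modelWithCornersSelf ℝ E) M)
    (hρ : ρ.IsSubordinate fun c => (U c : Set M)) {k : ℕ} (f : CechFn (E := E) U k)
    (b : Fin k → Λ) {x : M} (hx : x ∈ inter U b) :
    ContMDiffAt (modelWithCornersSelf ℝ E) 𝓘(ℝ, ℝ) ∞ (cechContraction ρ f b) x := by
  refine ρ.contMDiffAt_finsum fun c hc => contMDiffAt_extendByZero _ ?_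
  rw [mem_inter] at hx ⊢
  exact Fin.cases (hρ c hc) hx

/-- If $\rho_c(x)\ne0$, the cocycle condition at $(c,a_0,\dots,a_k)$ expresses $f_a(x)$ as the
alternating sum of the $f_{c,\dots\hat a_i\dots}(x)$. Averaging over $c$ with weights $\rho_c(x)$
gives the formula. The case `k = 0` is included; there the contraction is a function on $M$. -/
theorem cechContraction_spec
    (ρ : SmoothPartitionOfUnity Λ (modelWithCornersSelf ℝ E) M)
    (hρ : ρ.IsSubordinate fun c => (U c : Set M)) {k : ℕ} {f : CechFn (E := E) U k}
    (hf : cechDiff U k f = 0) (a : Fin (k + 1) → Λ) {x : M} (hx : x ∈ inter U a) :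
    ∑ i : Fin (k + 1), (-1 : ℝ) ^ (i : ℕ) * cechContraction ρ f (a ∘ i.succAbove) x =
      f a ⟨x, hx⟩ := by
  have hfin : (Function.support fun c => ρ c x).Finite := ρ.locallyFinite.point_finite x
  have h1 : ∀ b : Fin k → Λ, cechContraction ρ f b x = ∑ c ∈ hfin.toFinset,
      ρ c x • cechValue f x (Fin.cons c b) := fun b =>
    finsum_eq_sum_of_support_subset _ fun c hc => by
      simp only [Set.Finite.coe_toFinset, Function.mem_support] at hc ⊢
      exact fun h => hc (by rw [h, zero_smul])
  have h2 : ∑ c ∈ hfin.toFinset, ρ c x = 1 := by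
    rw [← ρ.sum_eq_one (Set.mem_univ x)]
    refine (finsum_eq_sum_of_support_subset _ ?_).symm
    simp
  simp only [h1, Finset.mul_sum]
  rw [Finset.sum_comm, show f a ⟨x, hx⟩ = ∑ c ∈ hfin.toFinset, ρ c x * f a ⟨x, hx⟩ by
    rw [← Finset.sum_mul, h2, one_mul]]
  refine Finset.sum_congr rfl fun c hc => ?_
  have hc : x ∈ U c := hρ c (subset_closure (by simpa using hc))
  have hx' : x ∈ inter U (Fin.cons c a : Fin (k + 2) → Λ) := by
    rw [mem_inter] at hx ⊢
    exact Fin.cases hc hx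
  have key := cechDiff_apply_point f (Fin.cons c a) hx'
  rw [hf, Fin.sum_univ_succ] at key
  have e0 : (Fin.cons c a : Fin (k + 2) → Λ) ∘ (0 : Fin (k + 2)).succAbove = a := by
    funext i
    simp
  have e1 : ∀ i : Fin (k + 1), (Fin.cons c a : Fin (k + 2) → Λ) ∘ i.succ.succAbove =
      Fin.cons c (a ∘ i.succAbove) := by
    intro i
    funext l
    refine Fin.cases ?_ (fun l => ?_) l
    · simp
    · simp
  simp only [e0, e1, Fin.val_zero, Fin.val_succ, pow_zero, one_mul, pow_succ, mul_neg_one,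
    neg_mul, Finset.sum_neg_distrib] at key
  rw [cechValue_of_mem _ hx] at key
  have key' : f a ⟨x, hx⟩ = ∑ i : Fin (k + 1), (-1 : ℝ) ^ (i : ℕ) *
      cechValue f x (Fin.cons c (a ∘ i.succAbove)) := by
    have z : (0 : CechFn (E := E) U (k + 1)) (Fin.cons c a) ⟨x, hx'⟩ = 0 := rfl
    rw [z] at key
    linarith
  rw [key', Finset.mul_sum]
  refine Finset.sum_congr rfl fun i _ => ?_
  rw [smul_eq_mul]
  ring

variable [FiniteDimensional ℝ E] [IsManifold (modelWithCornersSelf ℝ E) ∞ M] [T2Space M]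

variable [SigmaCompactSpace M]

theorem exists_subordinate_partition (hU : ∀ x : M, ∃ a, x ∈ U a) :
    ∃ ρ : SmoothPartitionOfUnity Λ (modelWithCornersSelf ℝ E) M,
      ρ.IsSubordinate fun c => (U c : Set M) :=
  SmoothPartitionOfUnity.exists_isSubordinate _ isClosed_univ _ (fun c => (U c).isOpen)
    fun x _ => Set.mem_iUnion.2 (hU x)

/-- Exactness of the Čech complex of smooth functions in positive degrees. -/
theorem cechDiff_exact (hU : ∀ x : M, ∃ a, x ∈ U a) {k : ℕ} {f : CechFn (E := E) U (k + 1)}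
    (hf : cechDiff U (k + 1) f = 0) : ∃ h : CechFn (E := E) U k, cechDiff U k h = f := by
  obtain ⟨ρ, hρ⟩ := exists_subordinate_partition (E := E) hU
  have hs : ∀ b : Fin (k + 1) → Λ, ContMDiff (modelWithCornersSelf ℝ E) 𝓘(ℝ, ℝ) ∞
      fun x : inter U b => cechContraction ρ f b x := fun b x =>
    contMDiffAt_subtype_iff.2 (contMDiffAt_cechContraction ρ hρ f b x.2)
  let h : CechFn (E := E) U k := fun b => ⟨fun x => cechContraction ρ f b x, hs b⟩
  refine ⟨h, ?_⟩
  funext a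
  ext ⟨x, hx⟩
  rw [← cechContraction_spec ρ hρ hf a hx, cechDiff_apply_point h]
  refine Finset.sum_congr rfl fun i _ => ?_
  rw [cechValue_of_mem h (inter_le U a i.succAbove hx)]
  rfl

/-- Functions that agree on overlaps glue. -/
theorem exists_augment_eq (hU : ∀ x : M, ∃ a, x ∈ U a) {f : CechFn (E := E) U 0}
    (hf : cechDiff U 0 f = 0) : ∃ F : SmoothFn E M, augment U F = f := by
  obtain ⟨ρ, hρ⟩ := exists_subordinate_partition (E := E) hU
  -- For the empty multi-index the intersection is all of $M$, so $\sum_c\rho_cf_c$ is a global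
  -- function.
  refine ⟨⟨cechContraction ρ f Fin.elim0, fun x =>
    contMDiffAt_cechContraction ρ hρ f _ (mem_inter.2 fun i => i.elim0)⟩, ?_⟩
  funext a
  ext ⟨x, hx⟩
  rw [← cechContraction_spec ρ hρ hf a hx, Fin.sum_univ_one]
  change cechContraction ρ f Fin.elim0 x = _
  rw [Subsingleton.elim (a ∘ (0 : Fin 1).succAbove) Fin.elim0]
  simp

end CechExactness

/-! ### The components induced by a connection: values, linearity, degrees, symmetry -/

section InducedMorphism

open TopologicalSpace (Opens)

variable {Λ : Type*} {U : Λ → Opens M}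
variable [FiniteDimensional ℝ E] [IsManifold (modelWithCornersSelf ℝ E) ∞ M] [T2Space M]
variable {g : CircleCochain E U (m + 1)} (𝒜 : FullConnection g)

/-- The restriction of the vector field underlying an element of `At_{n-1}(H)`. -/
def resField (V : Opens M) (x : VectorFields E M × SmoothFn E M) : VectorFields E V :=
  resVF V x.1

/-- The form `A^(q+1)` on an intersection of `j + 1` members of the cover, and zero if `A^(q+1)`
is not a form on `Č_j U`. -/
def slotForm (q j : ℕ) (a : Fin (j + 1) → Λ) : DiffForm E (inter U a) (q + 1) :=
  if h : q + j = m then 𝒜.form q j h a else 0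

theorem slotForm_of_eq {q j : ℕ} (h : q + j = m) (a : Fin (j + 1) → Λ) :
    slotForm 𝒜 q j a = 𝒜.form q j h a := dif_pos h

theorem slotForm_of_ne {q j : ℕ} (h : q + j ≠ m) (a : Fin (j + 1) → Λ) :
    slotForm 𝒜 q j a = 0 := dif_neg h

theorem slotForm_eq_zero {q j : ℕ} {a : Fin (j + 1) → Λ}
    {X : Fin (q + 1) → VectorFields E (inter U a)} (i : Fin (q + 1)) (h : X i = 0) :
    slotForm 𝒜 q j a X = 0 :=
  (slotForm 𝒜 q j a).map_coord_zero i h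

/-- The restriction of a function on `M` to a component of `Č_j U`, and zero unless `j = 0`. -/
def augmentSlot (j : ℕ) (a : Fin (j + 1) → Λ) : SmoothFn E M →ₗ[SmoothFn E M] SmoothFn E (inter U a) :=
  LinearMap.proj a ∘ₗ LinearMap.proj j ∘ₗ
    LinearMap.single (SmoothFn E M) (fun k => CechFn (E := E) U k) 0 ∘ₗ augment U

theorem augmentSlot_apply (j : ℕ) (a : Fin (j + 1) → Λ) (f : SmoothFn E M) :
    augmentSlot (U := U) j a f = (Pi.single 0 (augment U f) : CechCochains E U) j a := rfl

theorem augmentSlot_zero (a : Fin 1 → Λ) (f : SmoothFn E M) :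
    augmentSlot (U := U) 0 a f = resFn (inter U a) f := by
  rw [augmentSlot_apply, Pi.single_eq_same]
  rfl

theorem augmentSlot_of_ne {j : ℕ} (hj : j ≠ 0) (a : Fin (j + 1) → Λ) (f : SmoothFn E M) :
    augmentSlot (U := U) j a f = 0 := by
  rw [augmentSlot_apply, Pi.single_eq_of_ne hj]
  rfl

theorem resVF_augmentSlot (j : ℕ) (a : Fin (j + 1) → Λ) (X : VectorFields E M)
    (f : SmoothFn E M) :
    resVF (inter U a) X (augmentSlot (U := U) j a f) = augmentSlot (U := U) j a (X f) := by
  by_cases hj : j = 0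
  · subst hj
    rw [augmentSlot_zero, augmentSlot_zero, resVF_resFn]
  · rw [augmentSlot_of_ne hj, augmentSlot_of_ne hj, map_zero]

theorem inducedMap_succ_fst {q : ℕ} (x : Fin (q + 1) → VectorFields E M × SmoothFn E M) :
    (𝒜.inducedMap (q + 1) x).1 = if q = 0 then (x 0).1 else 0 := add_zero _

theorem inducedMap_succ_apply {q : ℕ} (x : Fin (q + 1) → VectorFields E M × SmoothFn E M) (j : ℕ)
    (a : Fin (j + 1) → Λ) : (𝒜.inducedMap (q + 1) x).2 j a =
      slotForm 𝒜 q j a (resField (inter U a) ∘ x) +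
        if q = 0 then augmentSlot (U := U) j a (x 0).2 else 0 := by
  have e1 : (if h : q + j = m then (𝒜.form q j h).eval fun i => (x i).1 else 0) a =
      slotForm 𝒜 q j a (resField (inter U a) ∘ x) := by
    by_cases h : q + j = m
    · rw [dif_pos h, slotForm_of_eq 𝒜 h]
      rfl
    · rw [dif_neg h, slotForm_of_ne 𝒜 h]
      rfl
  have e2 : (if q = 0 then (Pi.single 0 (augment U (x 0).2) : CechCochains E U) else 0) j a =
      if q = 0 then augmentSlot (U := U) j a (x 0).2 else 0 := by
    split_ifs
    · rfl
    · rfl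
  rw [← e1, ← e2]
  rfl

/-- This is where $\mathrm d\log g=\check\delta A^{(1)}$ is used. If `m = 0` the restriction of a
function also lands in the top entry, but $\check\delta$ kills it. -/
theorem inducedMap_mem (k : ℕ) (x : Fin k → VectorFields E M × SmoothFn E M) :
    𝒜.inducedMap k x ∈ cechAtiyahModule g := by
  cases k with
  | zero => exact Submodule.zero_mem _
  | succ q =>
    refine ⟨fun j hj => ?_, ?_⟩
    · funext a
      rw [inducedMap_succ_apply, slotForm_of_ne 𝒜 (by omega), augmentSlot_of_ne (by omega),
        ite_self]
      exact add_zero _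
    · rw [inducedMap_succ_fst]
      by_cases hq : q = 0
      · subst hq
        rw [if_pos rfl, 𝒜.dlog_eq fun i => (x i).1]
        have : (𝒜.inducedMap 1 x).2 m = ((𝒜.form 0 m (zero_add m)).eval fun i => (x i).1) +
            (Pi.single 0 (augment U (x 0).2) : CechCochains E U) m := by
          funext a
          rw [inducedMap_succ_apply, slotForm_of_eq 𝒜 (zero_add m), if_pos rfl]
          rfl
        rw [this, map_add]
        have z : cechDiff U m ((Pi.single 0 (augment U (x 0).2) : CechCochains E U) m) = 0 := by
          cases m with
          | zero =>
            rw [Pi.single_eq_same]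
            exact cechDiff_augment _
          | succ m => rw [Pi.single_eq_of_ne (by omega), map_zero]
        rw [z, add_zero]
      · rw [if_neg hq, map_zero]
        have : (𝒜.inducedMap (q + 1) x).2 m = 0 := by
          funext a
          rw [inducedMap_succ_apply, slotForm_of_ne 𝒜 (by omega), if_neg hq]
          exact add_zero _
        rw [this, map_zero]

/-- The components of the `∞`-morphism induced by a full connection. -/
def inducedComp (k : ℕ) (x : Fin k → VectorFields E M × SmoothFn E M) : cechAtiyahModule g :=
  ⟨𝒜.inducedMap k x, inducedMap_mem 𝒜 k x⟩

variable (g) in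
/-- A component of an element of `ČAt(g)`. -/
def cechEntry (j : ℕ) (a : Fin (j + 1) → Λ) :
    cechAtiyahModule g →ₗ[SmoothFn E M] SmoothFn E (inter U a) :=
  LinearMap.proj a ∘ₗ LinearMap.proj j ∘ₗ LinearMap.snd _ _ _ ∘ₗ (cechAtiyahModule g).subtype

theorem cech_ext_entry {x y : cechAtiyahModule g} (h : cechField g x = cechField g y)
    (h' : ∀ k a, cechEntry g k a x = cechEntry g k a y) : x = y :=
  Subtype.ext (Prod.ext h (funext fun k => funext fun a => h' k a))

theorem cechField_inducedComp {q : ℕ} (x : Fin (q + 1) → VectorFields E M × SmoothFn E M) :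
    cechField g (inducedComp 𝒜 (q + 1) x) = if q = 0 then (x 0).1 else 0 :=
  inducedMap_succ_fst 𝒜 x

theorem cechField_inducedComp_of_ne {k : ℕ} (hk : k ≠ 1)
    (x : Fin k → VectorFields E M × SmoothFn E M) : cechField g (inducedComp 𝒜 k x) = 0 := by
  rcases k with _ | _ | q
  · rfl
  · exact absurd rfl hk
  · rw [cechField_inducedComp, if_neg (by omega)]

theorem cechEntry_inducedComp {q : ℕ} (x : Fin (q + 1) → VectorFields E M × SmoothFn E M) (j : ℕ)
    (a : Fin (j + 1) → Λ) : cechEntry g j a (inducedComp 𝒜 (q + 1) x) =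
      slotForm 𝒜 q j a (resField (inter U a) ∘ x) +
        if q = 0 then augmentSlot (U := U) j a (x 0).2 else 0 :=
  inducedMap_succ_apply 𝒜 x j a

theorem resField_update (V : Opens M) {n : ℕ} (x : Fin n → VectorFields E M × SmoothFn E M)
    (i : Fin n) (v : VectorFields E M × SmoothFn E M) :
    resField V ∘ Function.update x i v =
      Function.update (resField V ∘ x) i (resField V v) := by
  funext l
  by_cases h : l = i
  · subst h
    simp
  · simp [h]

theorem exists_multilinear_inducedComp (k : ℕ) :
    ∃ F : MultilinearMap (SmoothFn E M) (fun _ : Fin k => VectorFields E M × SmoothFn E M)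
      (cechAtiyahModule g), ⇑F = inducedComp 𝒜 k := by
  refine ⟨MultilinearMap.mk' (inducedComp 𝒜 k) (fun x i u v => ?_) fun x i c v => ?_, rfl⟩
  · cases k with
    | zero => exact i.elim0
    | succ q =>
      refine cech_ext_entry ?_ fun j a => ?_
      · rw [map_add, cechField_inducedComp, cechField_inducedComp, cechField_inducedComp]
        by_cases hq : q = 0
        · subst hq
          obtain rfl : i = 0 := by omega
          simp
        · simp [hq]
      · rw [map_add, cechEntry_inducedComp, cechEntry_inducedComp, cechEntry_inducedComp,
          resField_update, resField_update, resField_update, show resField (inter U a) (u + v) =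
            resField (inter U a) u + resField (inter U a) v from resVF_add _ _ _,
          AlternatingMap.map_update_add, add_add_add_comm]
        congr 1
        by_cases hq : q = 0
        · subst hq
          obtain rfl : i = 0 := by omega
          simp
        · simp [hq]
  · cases k with
    | zero => exact i.elim0
    | succ q =>
      refine cech_ext_entry ?_ fun j a => ?_
      · rw [map_smul, cechField_inducedComp, cechField_inducedComp]
        by_cases hq : q = 0
        · subst hq
          obtain rfl : i = 0 := by omega
          simp
        · simp [hq]
      · rw [map_smul, cechEntry_inducedComp, cechEntry_inducedComp,
          resField_update, resField_update, show resField (inter U a) (c • v) =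
            resFn (inter U a) c • resField (inter U a) v from resVF_smul _ _ _,
          AlternatingMap.map_update_smul, smul_add]
        refine congrArg₂ (· + ·) rfl ?_
        by_cases hq : q = 0
        · subst hq
          obtain rfl : i = 0 := by omega
          exact (by simp : _ = augmentSlot (U := U) j a (c • v).2).trans (map_smul _ c v.2) |>.trans (by simp)
        · simp [hq]

variable (H : DiffForm E M (m + 2))

theorem resField_eq_zero {d : ℤ} {x : VectorFields E M × SmoothFn E M}
    (hx : x ∈ (atiyah H).deg d) (V : Opens M) (h : d ≠ 0) : resField V x = 0 :=
  (congrArg (resVF V) (hx.1 h)).trans (resVF_zero V)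

/-- A value of $A^{(q+1)}$ is nonzero only on tuples of degree zero, so it must have degree `-q`.
This is the entry `j = m - q`, where the form lives. -/
theorem inducedComp_deg (k : ℕ) (d : Fin k → ℤ) (x : Fin k → VectorFields E M × SmoothFn E M)
    (hx : ∀ i, x i ∈ (atiyah H).deg (d i)) :
    inducedComp 𝒜 k x ∈ (cechAtiyah g).deg ((∑ i, d i) + 1 - k) := by
  cases k with
  | zero => exact ⟨fun _ => rfl, fun _ _ => rfl⟩
  | succ q =>
    constructor
    · intro h
      refine (cechField_inducedComp 𝒜 x).trans ?_
      by_cases hq : q = 0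
      · subst hq
        rw [if_pos rfl]
        refine (hx 0).1 fun h0 => h ?_
        simp [h0]
      · rw [if_neg hq]
    · intro j hj
      funext a
      refine (cechEntry_inducedComp 𝒜 x j a).trans ?_
      have h1 : slotForm 𝒜 q j a (resField (inter U a) ∘ x) = 0 := by
        by_cases hd : ∀ i, d i = 0
        · rw [slotForm_of_ne 𝒜]
          · rfl
          · intro h
            simp only [hd, Finset.sum_const_zero] at hj
            push_cast at hj
            omega
        · push Not at hd
          obtain ⟨i, hi⟩ := hd
          exact slotForm_eq_zero 𝒜 i (resField_eq_zero H (hx i) _ hi)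
      rw [h1, zero_add]
      by_cases hq : q = 0
      · subst hq
        rw [if_pos rfl]
        by_cases hj0 : j = 0
        · subst hj0
          rw [(hx 0).2 fun h0 => hj (by simp [h0]), map_zero]
          rfl
        · exact augmentSlot_of_ne hj0 _ _
      · rw [if_neg hq]
        rfl

theorem inducedComp_symmetric (k : ℕ) (d : Fin k → ℤ)
    (x : Fin k → VectorFields E M × SmoothFn E M) (hx : ∀ i, x i ∈ (atiyah H).deg (d i))
    (σ : Equiv.Perm (Fin k)) :
    inducedComp 𝒜 k (x ∘ σ.symm) = koszulSign σ d • inducedComp 𝒜 k x := by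
  by_cases hk : k ≤ 1
  · have : Subsingleton (Fin k) := Fin.subsingleton_iff_le_one.2 hk
    rw [Subsingleton.elim σ 1, show koszulSign (1 : Equiv.Perm (Fin k)) d = 1 from
      koszulSign_of_monotone monotone_id d]
    exact (one_smul ℤˣ (inducedComp 𝒜 k x)).symm
  · obtain ⟨q, rfl⟩ : ∃ q, k = q + 2 := ⟨k - 2, by omega⟩
    refine cech_ext_entry ?_ fun j a => ?_
    · refine Eq.trans ?_ (map_units_smul (cechField g) _ (inducedComp 𝒜 (q + 2) x)).symm
      rw [cechField_inducedComp_of_ne 𝒜 (by omega), cechField_inducedComp_of_ne 𝒜 (by omega),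
        smul_zero]
    · refine Eq.trans ?_ (map_units_smul (cechEntry g j a) _ (inducedComp 𝒜 (q + 2) x)).symm
      rw [cechEntry_inducedComp, cechEntry_inducedComp, if_neg (by omega), if_neg (by omega),
        add_zero, add_zero]
      exact alternating_koszul (slotForm 𝒜 (q + 1) j a) (X := resField (inter U a) ∘ x)
        (fun i hi => resField_eq_zero H (hx i) _ hi) σ

end InducedMorphism

/-! ### The individual terms of the Maurer–Cartan equation -/

section MaurerCartan

open TopologicalSpace (Opens)

variable {Λ : Type*} {U : Λ → Opens M}
variable [FiniteDimensional ℝ E] [IsManifold (modelWithCornersSelf ℝ E) ∞ M] [T2Space M]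
variable {g : CircleCochain E U (m + 1)} (𝒜 : FullConnection g)

/-- The contribution of the brackets with `A^(1)` and of the restrictions of functions to the
Maurer–Cartan equation. -/
theorem cechEntry_bracket_inducedComp (x : Fin 2 → VectorFields E M × SmoothFn E M) (j : ℕ)
    (a : Fin (j + 1) → Λ) :
    cechEntry g j a (cechAtiyahBracket g (inducedComp 𝒜 1 fun _ => x 0)
      (inducedComp 𝒜 1 fun _ => x 1)) =
    (∑ i : Fin 2, (-1 : ℝ) ^ (i : ℕ) • resField (inter U a) (x i)
      (slotForm 𝒜 0 j a (i.removeNth (resField (inter U a) ∘ x)))) +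
    augmentSlot (U := U) j a (atiyahLie m (x 0) (x 1)).2 := by
  have e : ∀ v : VectorFields E M × SmoothFn E M,
      cechEntry g j a (inducedComp 𝒜 1 fun _ => v) =
        slotForm 𝒜 0 j a (fun _ => resField (inter U a) v) + augmentSlot (U := U) j a v.2 :=
    fun v => cechEntry_inducedComp 𝒜 (fun _ : Fin 1 => v) j a
  have f : ∀ v w : VectorFields E M × SmoothFn E M, resField (inter U a) v
      (cechEntry g j a (inducedComp 𝒜 1 fun _ => w)) = resField (inter U a) v
        (slotForm 𝒜 0 j a fun _ => resField (inter U a) w) +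
          augmentSlot (U := U) j a (v.1 w.2) := by
    intro v w
    rw [e, map_add]
    exact congrArg _ (resVF_augmentSlot j a v.1 w.2)
  -- $A^{(1)}$ occupies only the entry `j = m`, where the sign in the bracket of $\check{\mathrm
  -- C}\mathrm{At}(g)$ is `-1`, as needed for $\mathrm dA^{(1)}$.
  have s1 : ∀ v w : VectorFields E M × SmoothFn E M, (-1 : ℝ) ^ (m + 1 + j) •
      resField (inter U a) v (slotForm 𝒜 0 j a fun _ => resField (inter U a) w) =
        -resField (inter U a) v (slotForm 𝒜 0 j a fun _ => resField (inter U a) w) := by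
    intro v w
    by_cases h : 0 + j = m
    · rw [show m + 1 + j = 2 * m + 1 by omega, pow_succ, pow_mul]
      simp
    · rw [slotForm_of_ne 𝒜 h]
      simp
  -- Functions on $M$ occupy only the entry `j = 0`, where the sign is the one in the bracket of
  -- $\mathrm{At}_{n-1}(H)$.
  have s2 : ∀ h : SmoothFn E M, (-1 : ℝ) ^ (m + 1 + j) • augmentSlot (U := U) j a h =
      augmentSlot (U := U) j a ((-1 : ℝ) ^ (m + 1) • h) := by
    intro h
    rw [LinearMap.map_smul_of_tower]
    by_cases hj : j = 0
    · subst hj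
      rfl
    · rw [augmentSlot_of_ne hj, smul_zero, smul_zero]
  have g0 : cechEntry g j a (cechAtiyahBracket g (inducedComp 𝒜 1 fun _ => x 0)
      (inducedComp 𝒜 1 fun _ => x 1)) =
      resField (inter U a) (x 0) (cechEntry g j a (inducedComp 𝒜 1 fun _ => x 1)) +
      (-1 : ℝ) ^ (m + 1 + j) •
        resField (inter U a) (x 1) (cechEntry g j a (inducedComp 𝒜 1 fun _ => x 0)) := by
    have h : ∀ v : VectorFields E M × SmoothFn E M,
        cechField g (inducedComp 𝒜 1 fun _ => v) = v.1 :=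
      fun v => cechField_inducedComp 𝒜 (fun _ : Fin 1 => v)
    rw [resField, resField, ← h (x 0), ← h (x 1)]
    rfl
  have r0 : (0 : Fin 2).removeNth (resField (inter U a) ∘ x) =
      fun _ => resField (inter U a) (x 1) := by
    funext l
    obtain rfl : l = 0 := by omega
    rfl
  have r1 : (1 : Fin 2).removeNth (resField (inter U a) ∘ x) =
      fun _ => resField (inter U a) (x 0) := by
    funext l
    obtain rfl : l = 0 := by omega
    rfl
  have l2 : (atiyahLie m (x 0) (x 1)).2 =
      (x 0).1 (x 1).2 + (-1 : ℝ) ^ (m + 1) • (x 1).1 (x 0).2 := rfl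
  rw [g0, f, f, smul_add, s1, s2, Fin.sum_univ_two, r0, r1, l2, map_add]
  simp only [Fin.val_zero, Fin.val_one, pow_zero, pow_one, one_smul, neg_smul]
  abel

variable (H : DiffForm E M (m + 2))

/-- The contribution of the brackets with `A^(q+2)` to the Maurer–Cartan equation. -/
theorem cechEntry_twoBlockSum {q : ℕ} (d : Fin (q + 3) → ℤ)
    (x : Fin (q + 3) → VectorFields E M × SmoothFn E M) (hx : ∀ i, x i ∈ (atiyah H).deg (d i))
    (j : ℕ) (a : Fin (j + 1) → Λ) :
    cechEntry g j a ((2 : ℝ)⁻¹ • twoBlockSum (fun y => cechAtiyahBracket g (y 0) (y 1))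
      (inducedComp 𝒜) d x) =
    ∑ i : Fin (q + 3), (-1 : ℝ) ^ (i : ℕ) • resField (inter U a) (x i)
      (slotForm 𝒜 (q + 1) j a (i.removeNth (resField (inter U a) ∘ x))) := by
  have key := map_twoBlockSum (cechEntry g j a) (fun y => cechAtiyahBracket g (y 0) (y 1))
    (fun u w => resVF (inter U a) (cechField g u) (cechEntry g j a w))
    (fun u w => (-1 : ℝ) ^ (m + 1 + j) • resVF (inter U a) (cechField g u) (cechEntry g j a w))
    (fun y => rfl) (inducedComp 𝒜)
    (fun k hk y w => by rw [cechField_inducedComp_of_ne 𝒜 hk]; rfl)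
    (fun k hk y w => by rw [cechField_inducedComp_of_ne 𝒜 hk]; exact smul_zero _) d x
  rw [LinearMap.map_smul_of_tower, key, Finset.smul_sum]
  refine Finset.sum_congr rfl fun i _ => ?_
  have e1 : cechField g (inducedComp 𝒜 1 fun _ => x i) = (x i).1 :=
    cechField_inducedComp 𝒜 (fun _ : Fin 1 => x i)
  have e2 : cechEntry g j a (inducedComp 𝒜 (q + 1 + 1) (i.removeNth x)) =
      slotForm 𝒜 (q + 1) j a (i.removeNth (resField (inter U a) ∘ x)) := by
    rw [cechEntry_inducedComp, if_neg (by omega), add_zero]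
    rfl
  rw [e1, e2]
  change (2 : ℝ)⁻¹ • (_ • resField (inter U a) (x i) _ +
    _ • (-1 : ℝ) ^ (m + 1 + j) • resField (inter U a) (x i) _) = _
  by_cases hd : d = 0
  · rw [hd, koszulSign_to_front i (by simp +contextual) (by simp +contextual),
      koszulSign_to_end i (by simp +contextual) (by simp +contextual), neg_one_pow_units_smul,
      neg_one_pow_units_smul, smul_smul ((-1 : ℝ) ^ (q + 2 + (i : ℕ)))]
    -- In the only entry where the form is nonzero, the decompositions with the singleton block
    -- first and those with it second carry the same sign. This cancels the factor 1/2.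
    by_cases h : q + 1 + j = m
    · have : (-1 : ℝ) ^ (q + 2 + (i : ℕ)) * (-1 : ℝ) ^ (m + 1 + j) = (-1 : ℝ) ^ (i : ℕ) := by
        rw [← pow_add, show q + 2 + (i : ℕ) + (m + 1 + j) = 2 * (q + j + 2) + i by omega, pow_add,
          pow_mul]
        simp
      rw [this, ← two_smul ℝ, smul_smul]
      norm_num
    · rw [slotForm_of_ne 𝒜 h]
      simp
  · obtain ⟨b, hb⟩ := Function.ne_iff.1 hd
    have hb := resField_eq_zero H (hx b) (inter U a) hb
    have : resField (inter U a) (x i)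
        (slotForm 𝒜 (q + 1) j a (i.removeNth (resField (inter U a) ∘ x))) = 0 := by
      by_cases hbi : b = i
      · subst hbi
        rw [hb]
        rfl
      · obtain ⟨l, rfl⟩ := Fin.exists_succAbove_eq hbi
        rw [slotForm_eq_zero 𝒜 l hb, map_zero]
    simp only [this, smul_zero, add_zero]

/-- The part of the maps `At_{n-1}(H)^{⊗ k} → ČAt(g)` given by the forms of the connection. -/
def formFamily (j : ℕ) (a : Fin (j + 1) → Λ) :
    ∀ k : ℕ, (Fin k → VectorFields E M × SmoothFn E M) → SmoothFn E (inter U a)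
  | 0, _ => 0
  | q + 1, x => slotForm 𝒜 q j a (resField (inter U a) ∘ x)

/-- Splitting off the restriction of functions leaves operations that are alternating in the vector
fields alone, as required by `shuffleSum_two_alternating`. -/
theorem cechEntry_comp_inducedComp (j : ℕ) (a : Fin (j + 1) → Λ) :
    (fun k x => cechEntry g j a (inducedComp 𝒜 k x)) =
      addFamily (formFamily 𝒜 j a)
        (singleArity 1 fun y => augmentSlot (U := U) j a (y 0).2) := by
  funext k x
  rcases k with _ | q
  · rw [addFamily, singleArity_ne _ (by omega)]
    exact (add_zero _).symm
  · rw [cechEntry_inducedComp]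
    refine congrArg₂ (· + ·) rfl ?_
    by_cases hq : q = 0
    · subst hq
      rw [if_pos rfl, singleArity_self]
    · rw [if_neg hq, singleArity_ne _ (by omega)]

theorem cechField_comp_inducedComp :
    (fun k x => cechField g (inducedComp 𝒜 k x)) = singleArity 1 fun y => (y 0).1 := by
  funext k x
  by_cases hk : k = 1
  · subst hk
    rw [singleArity_self]
    exact cechField_inducedComp 𝒜 x
  · rw [singleArity_ne _ hk, cechField_inducedComp_of_ne 𝒜 hk]

theorem formFamily_cons (j : ℕ) (a : Fin (j + 1) → Λ) (r : ℕ)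
    {v : VectorFields E M × SmoothFn E M} (hv : v.1 = 0)
    (y : Fin r → VectorFields E M × SmoothFn E M) :
    formFamily 𝒜 j a (r + 1) (Fin.cons v y) = 0 :=
  slotForm_eq_zero 𝒜 0 ((congrArg (resVF _) hv).trans (resVF_zero _))

theorem shuffleSum_formFamily {q : ℕ} (d : Fin (q + 2) → ℤ)
    (x : Fin (q + 2) → VectorFields E M × SmoothFn E M) (hx : ∀ i, x i ∈ (atiyah H).deg (d i))
    (j : ℕ) (a : Fin (j + 1) → Λ) :
    shuffleSum (singleArity 2 fun y => atiyahLie m (y 0) (y 1)) (formFamily 𝒜 j a) d x =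
      -∑ j' : Fin (q + 2), ∑ i ∈ Finset.univ.filter (· < j'), (-1 : ℝ) ^ (j' : ℕ) •
        slotForm 𝒜 q j a (j'.removeNth (Function.update (resField (inter U a) ∘ x) i
          ⁅resField (inter U a) (x i), resField (inter U a) (x j')⁆)) :=
  shuffleSum_two_alternating (slotForm 𝒜 q j a) (fun y => atiyahLie m (y 0) (y 1)) (fun r y => formFamily_cons 𝒜 j a r rfl y)
    (resField (inter U a)) (fun y => rfl) (fun X Y => ⁅X, Y⁆) (fun u v => resVF_lie _ u.1 v.1)
    (fun v => zero_lie v) (fun v => lie_zero v) fun i => resField_eq_zero H (hx i) _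

theorem shuffleSum_atiyahLie_one {N : Type*} [AddCommGroup N] [Module ℝ N]
    (C : VectorFields E M × SmoothFn E M →+ N) {q : ℕ} (d : Fin (q + 2) → ℤ)
    (x : Fin (q + 2) → VectorFields E M × SmoothFn E M) :
    shuffleSum (singleArity 2 fun y => atiyahLie m (y 0) (y 1))
      (singleArity 1 fun y => C (y 0)) d x = if q = 0 then C (atiyahLie m (x 0) (x 1)) else 0 := by
  by_cases hq : q = 0
  · subst hq
    rw [if_pos rfl, shuffleSum_univ two_pos, singleArity_self]
    intro r y
    by_cases hr : r = 0
    · subst hr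
      rw [singleArity_self]
      exact map_zero C
    · rw [singleArity_ne _ (by omega)]
  · rw [if_neg hq]
    exact shuffleSum_singleArity_of_ne (r := 0) two_pos _ _ (fun y => map_zero C) (by omega) d x

theorem shuffleSum_atiyahForm_one {N : Type*} [AddCommGroup N] [Module ℝ N]
    (C : VectorFields E M × SmoothFn E M →+ N) {q : ℕ} (d : Fin (q + 2) → ℤ)
    (x : Fin (q + 2) → VectorFields E M × SmoothFn E M) :
    shuffleSum (singleArity (m + 2) (atiyahForm H)) (singleArity 1 fun y => C (y 0)) d x =
      if h : q = m then C (0, H fun i => (x (Fin.cast (by rw [h]) i)).1) else 0 := by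
  by_cases hq : q = m
  · subst hq
    rw [dif_pos rfl, shuffleSum_univ (by omega), singleArity_self]
    · rfl
    intro r y
    by_cases hr : r = 0
    · subst hr
      rw [singleArity_self]
      exact map_zero C
    · rw [singleArity_ne _ (by omega)]
  · rw [dif_neg hq]
    exact shuffleSum_singleArity_of_ne (r := 0) (by omega) _ _ (fun y => map_zero C) (by omega) d x

variable {H}

/-- The relations between the forms of a full connection with curvature `H`. -/
theorem cechEntry_diff_inducedComp (h𝒜 : 𝒜.HasCurvature H) {q : ℕ}
    (x : Fin (q + 2) → VectorFields E M × SmoothFn E M) (j : ℕ) (a : Fin (j + 1) → Λ) :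
    cechEntry g j a (cechAtiyahDiff g (inducedComp 𝒜 (q + 2) x)) +
      exteriorDeriv (slotForm 𝒜 q j a) (resField (inter U a) ∘ x) =
    if h : q = m then augmentSlot (U := U) j a (H fun i => (x (Fin.cast (by rw [h]) i)).1)
      else 0 := by
  have hD : cechEntry g j a (cechAtiyahDiff g (inducedComp 𝒜 (q + 2) x)) =
      if j ≤ m then (-1 : ℝ) ^ (m + j) •
        totalCechDiff U (inducedComp 𝒜 (q + 2) x).1.2 j a else 0 := by
    refine (congrFun (cechAtiyahDiff_apply (inducedComp 𝒜 (q + 2) x) j) a).trans ?_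
    split_ifs <;> rfl
  rw [hD]
  by_cases hqj : q + j = m
  · rw [if_pos (by omega), slotForm_of_eq 𝒜 hqj]
    cases j with
    | zero =>
      -- No Čech differential arrives in $\check C_0\,\mathcal U$, so the relation left over is the
      -- curvature condition.
      obtain rfl : q = m := hqj
      rw [dif_pos rfl, augmentSlot_zero]
      have := congrFun (h𝒜 fun i => (x i).1) a
      exact (congrArg₂ (· + ·) (smul_zero _) rfl).trans ((zero_add _).trans this)
    | succ j =>
      rw [dif_neg (by omega)]
      have := congrFun (𝒜.deligne q j hqj fun i => (x i).1) a
      refine (add_comm _ _).trans ((congrArg₂ (· + ·) rfl ?_).trans this)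
      have e : (inducedComp 𝒜 (q + 2) x).1.2 j =
          (𝒜.form (q + 1) j (by omega)).eval fun i => (x i).1 := by
        funext b
        refine (cechEntry_inducedComp 𝒜 x j b).trans ?_
        rw [if_neg (by omega), add_zero, slotForm_of_eq 𝒜 (by omega)]
        rfl
      change _ • cechDiff U j ((inducedComp 𝒜 (q + 2) x).1.2 j) a = _
      -- Here `m = q + j + 1`, so the sign of the differential is `(-1)^q`, in agreement with the
      -- `(-1)^(q + 2)` of the Deligne equation.
      rw [e, show m + (j + 1) = 2 * (j + 1) + q by omega, pow_add, pow_add _ q 2, pow_mul]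
      simp
  · have e : totalCechDiff U (inducedComp 𝒜 (q + 2) x).1.2 j a = 0 := by
      cases j with
      | zero => rfl
      | succ j =>
        have e : (inducedComp 𝒜 (q + 2) x).1.2 j = 0 := by
          funext b
          refine (cechEntry_inducedComp 𝒜 x j b).trans ?_
          rw [if_neg (by omega), add_zero, slotForm_of_ne 𝒜 (by omega)]
          rfl
        change cechDiff U j ((inducedComp 𝒜 (q + 2) x).1.2 j) a = 0
        rw [e, map_zero]
        rfl
    have r : (if h : q = m then augmentSlot (U := U) j a
        (H fun i => (x (Fin.cast (by rw [h]) i)).1) else 0) = 0 := by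
      split_ifs with h
      · exact augmentSlot_of_ne (by omega) _ _
      · rfl
    rw [r, e, smul_zero, ite_self, zero_add, slotForm_of_ne 𝒜 hqj]
    simp [exteriorDeriv]

end MaurerCartan

/-! ### The Maurer–Cartan equation and the induced morphism -/

section Morphism

open TopologicalSpace (Opens)

variable {Λ : Type*} {U : Λ → Opens M}
variable [FiniteDimensional ℝ E] [IsManifold (modelWithCornersSelf ℝ E) ∞ M] [T2Space M]
variable {g : CircleCochain E U (m + 1)} (𝒜 : FullConnection g) {H : DiffForm E M (m + 2)}

theorem shuffleSum_atiyah_inducedComp (H : DiffForm E M (m + 2)) {k : ℕ} (d : Fin k → ℤ)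
    (x : Fin k → VectorFields E M × SmoothFn E M) :
    shuffleSum (atiyah H).bracket (inducedComp 𝒜) d x =
      shuffleSum (singleArity 2 fun y => atiyahLie m (y 0) (y 1)) (inducedComp 𝒜) d x +
      shuffleSum (singleArity (m + 2) (atiyahForm H)) (inducedComp 𝒜) d x :=
  shuffleSum_add_left _ _ (fun _ u v y =>
    cons_add_of_multilinear (exists_multilinear_inducedComp 𝒜) _ u v y) d x

theorem cechField_shuffleSum (H : DiffForm E M (m + 2)) {q : ℕ} (d : Fin (q + 2) → ℤ)
    (x : Fin (q + 2) → VectorFields E M × SmoothFn E M) :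
    cechField g (shuffleSum (atiyah H).bracket (inducedComp 𝒜) d x) =
      if q = 0 then ⁅(x 0).1, (x 1).1⁆ else 0 := by
  have h1 := shuffleSum_atiyahLie_one (m := m)
    (AddMonoidHom.fst (VectorFields E M) (SmoothFn E M)) d x
  have h2 := shuffleSum_atiyahForm_one H
    (AddMonoidHom.fst (VectorFields E M) (SmoothFn E M)) d x
  rw [shuffleSum_atiyah_inducedComp, map_add, map_shuffleSum, map_shuffleSum,
    cechField_comp_inducedComp]
  refine (congrArg₂ (· + ·) h1 (h2.trans ?_)).trans (add_zero _)
  split_ifs <;> rfl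

theorem cechEntry_shuffleSum {q : ℕ} (d : Fin (q + 2) → ℤ)
    (x : Fin (q + 2) → VectorFields E M × SmoothFn E M) (hx : ∀ i, x i ∈ (atiyah H).deg (d i))
    (j : ℕ) (a : Fin (j + 1) → Λ) :
    cechEntry g j a (shuffleSum (atiyah H).bracket (inducedComp 𝒜) d x) =
      -(∑ j' : Fin (q + 2), ∑ i ∈ Finset.univ.filter (· < j'), (-1 : ℝ) ^ (j' : ℕ) •
        slotForm 𝒜 q j a (j'.removeNth (Function.update (resField (inter U a) ∘ x) i
          ⁅resField (inter U a) (x i), resField (inter U a) (x j')⁆))) +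
      (if q = 0 then augmentSlot (U := U) j a (atiyahLie m (x 0) (x 1)).2 else 0) +
      if h : q = m then augmentSlot (U := U) j a (H fun i => (x (Fin.cast (by rw [h]) i)).1)
        else 0 := by
  let C : VectorFields E M × SmoothFn E M →+ SmoothFn E (inter U a) :=
    (augmentSlot (U := U) j a).toAddMonoidHom.comp
      (AddMonoidHom.snd (VectorFields E M) (SmoothFn E M))
  have h1 := shuffleSum_atiyahLie_one (m := m) C d x
  have h2 := shuffleSum_atiyahForm_one H C d x
  -- A value of $H$ is a function, and a form of the connection vanishes once a function is
  -- inserted.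
  have h3 : shuffleSum (singleArity (m + 2) (atiyahForm H)) (formFamily 𝒜 j a) d x = 0 :=
    Finset.sum_eq_zero fun S _ => by
      rw [formFamily_cons 𝒜 j a _ (singleArity_atiyahForm_fst H _ _), smul_zero]
  rw [shuffleSum_atiyah_inducedComp, map_add, map_shuffleSum, map_shuffleSum,
    cechEntry_comp_inducedComp, shuffleSum_add_right, shuffleSum_add_right,
    shuffleSum_formFamily 𝒜 H d x hx, h3, zero_add]
  exact congrArg₂ (· + ·) (congrArg₂ (· + ·) rfl h1) h2

theorem twoBlockSum_inducedComp_two (d : Fin 2 → ℤ) (x : Fin 2 → VectorFields E M × SmoothFn E M)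
    (hx : ∀ i, x i ∈ (atiyah H).deg (d i)) :
    (2 : ℝ)⁻¹ • twoBlockSum (fun y => cechAtiyahBracket g (y 0) (y 1)) (inducedComp 𝒜) d x =
      cechAtiyahBracket g (inducedComp 𝒜 1 fun _ => x 0) (inducedComp 𝒜 1 fun _ => x 1) := by
  have h : ∀ i, inducedComp 𝒜 1 (fun _ => x i) ∈ (cechAtiyah g).deg (d i) := fun i => by
    have := inducedComp_deg 𝒜 H 1 (fun _ => d i) (fun _ => x i) fun _ => hx i
    simpa using this
  exact twoBlockSum_two (cechAtiyahBracket g) (inducedComp 𝒜) d x (cechAtiyahBracket_swap (h 0) (h 1))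

/-- Only $\Phi_1$ has a vector field component, so the Lie bracket survives only if both blocks are
singletons. -/
theorem cechField_twoBlockSum {q : ℕ} (d : Fin (q + 2) → ℤ)
    (x : Fin (q + 2) → VectorFields E M × SmoothFn E M) (hx : ∀ i, x i ∈ (atiyah H).deg (d i)) :
    cechField g ((2 : ℝ)⁻¹ • twoBlockSum (fun y => cechAtiyahBracket g (y 0) (y 1))
      (inducedComp 𝒜) d x) = if q = 0 then ⁅(x 0).1, (x 1).1⁆ else 0 := by
  by_cases hq : q = 0
  · subst hq
    rw [if_pos rfl, twoBlockSum_inducedComp_two 𝒜 d x hx, cechField_bracket]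
    exact congrArg₂ (fun X Y : VectorFields E M => ⁅X, Y⁆)
      (cechField_inducedComp 𝒜 fun _ : Fin 1 => x 0) (cechField_inducedComp 𝒜 fun _ : Fin 1 => x 1)
  · have key := map_twoBlockSum (cechField g) (fun y => cechAtiyahBracket g (y 0) (y 1))
      (fun u w => ⁅cechField g u, cechField g w⁆) (fun _ _ => 0) (fun y => (add_zero _).symm)
      (inducedComp 𝒜) (fun k hk y w => by
        rw [cechField_inducedComp_of_ne 𝒜 hk]
        exact zero_lie (L := VectorFields E M) (M := VectorFields E M) _)
      (fun _ _ _ _ => rfl) d x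
    rw [if_neg hq, LinearMap.map_smul_of_tower, key, Finset.sum_eq_zero, smul_zero]
    intro i _
    rw [cechField_inducedComp_of_ne 𝒜 (by omega : q + 1 ≠ 1)]
    refine (congrArg₂ (· + ·) (congrArg _ (lie_zero (L := VectorFields E M)
      (M := VectorFields E M) _)) rfl).trans ?_
    rw [smul_zero, smul_zero, add_zero]

theorem cechEntry_blockSum {q : ℕ} (d : Fin (q + 2) → ℤ)
    (x : Fin (q + 2) → VectorFields E M × SmoothFn E M) (hx : ∀ i, x i ∈ (atiyah H).deg (d i))
    (j : ℕ) (a : Fin (j + 1) → Λ) :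
    cechEntry g j a ((2 : ℝ)⁻¹ • twoBlockSum (fun y => cechAtiyahBracket g (y 0) (y 1))
      (inducedComp 𝒜) d x) =
    (∑ i : Fin (q + 2), (-1 : ℝ) ^ (i : ℕ) • resField (inter U a) (x i)
      (slotForm 𝒜 q j a (i.removeNth (resField (inter U a) ∘ x)))) +
    if q = 0 then augmentSlot (U := U) j a (atiyahLie m (x 0) (x 1)).2 else 0 := by
  rcases q with _ | q
  · rw [if_pos rfl, twoBlockSum_inducedComp_two 𝒜 d x hx]
    exact cechEntry_bracket_inducedComp 𝒜 x j a
  · rw [if_neg (by omega), add_zero]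
    exact cechEntry_twoBlockSum 𝒜 H d x hx j a

/-- $A^{(1)}(X)$ sits in the top entry, on which the differential vanishes, and $\check\delta$ kills
restrictions of functions on $M$. -/
theorem cechAtiyahDiff_inducedComp_one (x : Fin 1 → VectorFields E M × SmoothFn E M) :
    cechAtiyahDiff g (inducedComp 𝒜 1 x) = 0 := by
  refine Subtype.ext (Prod.ext rfl (funext fun j => ?_))
  rw [cechAtiyahDiff_apply]
  refine ite_eq_right_iff.2 fun hj => ?_
  rcases j with _ | j
  · exact smul_zero _
  · have e : (inducedComp 𝒜 1 x).1.2 j = (Pi.single 0 (augment U (x 0).2) : CechCochains E U) j := by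
      funext a
      refine (cechEntry_inducedComp 𝒜 x j a).trans ?_
      rw [slotForm_of_ne 𝒜 (by omega), if_pos rfl]
      exact zero_add _
    change _ • cechDiff U j ((inducedComp 𝒜 1 x).1.2 j) = 0
    rw [e]
    by_cases h : j = 0
    · subst h
      rw [Pi.single_eq_same, cechDiff_augment, smul_zero]
    · rw [Pi.single_eq_of_ne h, map_zero, smul_zero]

/-- From arity two on, the term with $H$ is traded for Čech differential plus exterior derivative by
`cechEntry_diff_inducedComp`. The two sums that make up the exterior derivative are then the bracket
terms on the two sides. -/
theorem inducedComp_maurerCartan (h𝒜 : 𝒜.HasCurvature H) (k : ℕ) (d : Fin k → ℤ)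
    (x : Fin k → VectorFields E M × SmoothFn E M) (hx : ∀ i, x i ∈ (atiyah H).deg (d i)) :
    blockSum (addFamily (singleArity 1 fun y => cechAtiyahDiff g (y 0))
      (singleArity 2 fun y => cechAtiyahBracket g (y 0) (y 1))) (inducedComp 𝒜) d x =
      shuffleSum (atiyah H).bracket (inducedComp 𝒜) d x := by
  have h0 : ∀ r (y : Fin r → VectorFields E M × SmoothFn E M),
      inducedComp 𝒜 (r + 1) (Fin.cons 0 y) = 0 :=
    fun r y => apply_eq_zero_of_multilinear (C := inducedComp 𝒜 (r + 1))
      (exists_multilinear_inducedComp 𝒜 (r + 1)) 0 rfl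
  rcases k with _ | _ | q
  · rw [blockSum_zero, shuffleSum_atiyah_inducedComp,
      shuffleSum_singleArity_of_lt _ h0 (by omega), shuffleSum_singleArity_of_lt _ h0 (by omega),
      add_zero]
  · rw [blockSum_succ, cechAtiyahDiff_inducedComp_one, zero_add, twoBlockSum_one, smul_zero,
      shuffleSum_atiyah_inducedComp, shuffleSum_singleArity_of_lt _ h0 (by omega),
      shuffleSum_singleArity_of_lt _ h0 (by omega), add_zero]
  · rw [blockSum_succ]
    refine cech_ext_entry ?_ fun j a => ?_
    · rw [map_add, cechField_twoBlockSum 𝒜 d x hx, cechField_shuffleSum]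
      exact zero_add _
    · rw [map_add, cechEntry_blockSum 𝒜 d x hx, cechEntry_shuffleSum 𝒜 d x hx,
        ← cechEntry_diff_inducedComp 𝒜 h𝒜, exteriorDeriv]
      simp only [Function.comp_apply]
      abel

/-- The `∞`-morphism induced by a full connection. -/
def inducedMorphism (h𝒜 : 𝒜.HasCurvature H) : InfinityMorphism (atiyah H) (cechAtiyah g) where
  comp := inducedComp 𝒜
  comp_zero _ := rfl
  multilinear := exists_multilinear_inducedComp 𝒜
  comp_mem := inducedComp_deg 𝒜 H
  symmetric := inducedComp_symmetric 𝒜 H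
  maurerCartan k d x hx :=
    (congrArg (fun B => blockSum (V := VectorFields E M × SmoothFn E M) (W := cechAtiyahModule g)
      B (inducedComp 𝒜) d x) (cechAtiyah_bracket g)).trans
      (inducedComp_maurerCartan 𝒜 h𝒜 k d x hx)
  anchor_one x := cechField_inducedComp 𝒜 x
  anchor_higher _ hk x := cechField_inducedComp_of_ne 𝒜 (by omega) x

end Morphism

/-! ### The linear part is a quasi-isomorphism -/

section QuasiIsomorphism

open TopologicalSpace (Opens)

variable {Λ : Type*} {U : Λ → Opens M}
variable [FiniteDimensional ℝ E] [IsManifold (modelWithCornersSelf ℝ E) ∞ M] [T2Space M]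
variable {g : CircleCochain E U (m + 1)} (𝒜 : FullConnection g)

theorem atiyah_diff (H : DiffForm E M (m + 2)) (x : VectorFields E M × SmoothFn E M) :
    (atiyah H).diff x = (0 : VectorFields E M × SmoothFn E M) := by
  have h1 : 1 ≠ m + 2 := by omega
  exact (congrArg₂ (· + ·) (singleArity_ne (fun y => atiyahLie m (y 0) (y 1)) (by omega : 1 ≠ 2)
    fun _ => x) (singleArity_ne (atiyahForm H) h1 fun _ => x)).trans (add_zero _)

theorem inducedComp_one_add (v w : VectorFields E M × SmoothFn E M) :
    inducedComp 𝒜 1 (fun _ => v + w) =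
      inducedComp 𝒜 1 (fun _ => v) + inducedComp 𝒜 1 fun _ => w := by
  have e : ∀ (u : VectorFields E M × SmoothFn E M) (y : Fin 0 → VectorFields E M × SmoothFn E M),
      (Fin.cons u y : Fin 1 → VectorFields E M × SmoothFn E M) = fun _ => u := by
    intro u y
    funext l
    exact Fin.cases rfl (fun l => l.elim0) l
  have := cons_add_of_multilinear (C := inducedComp 𝒜)
    (exists_multilinear_inducedComp 𝒜) 0 v w Fin.elim0
  rwa [e, e, e] at this

/-- A closed element of `ČAt(g)` with vanishing vector field consists of Čech cocycles. -/
theorem cechDiff_eq_zero_of_closed {v : cechAtiyahModule g} (h : cechField g v = 0)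
    (hv : cechAtiyahDiff g v = 0) (k : ℕ) : cechDiff U k (v.1.2 k) = 0 := by
  rcases lt_trichotomy k m with hk | rfl | hk
  · have := congrArg (fun u : cechAtiyahModule g => u.1.2 (k + 1)) hv
    refine (smul_eq_zero_iff_right (pow_ne_zero (m + (k + 1)) (by norm_num : (-1 : ℝ) ≠ 0))).1
      (Eq.trans ?_ this)
    exact (if_pos hk).symm
  -- Closedness says nothing about the top entry; there the cocycle condition is the constraint of
  -- $E_{n-1}(g)$ for the zero vector field.
  · rw [← v.2.2]
    exact (congrArg (cechDlog g) h).trans (map_zero _)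
  · rw [v.2.1 k hk, map_zero]

/-- A closed element of `ČAt(g)` with vanishing vector field is cohomologous to a function
on `M`. -/
theorem exists_eq_of_closed [SigmaCompactSpace M] (hU : ∀ x : M, ∃ a, x ∈ U a) {i : ℤ}
    {v : cechAtiyahModule g} (hi : v ∈ (cechAtiyah g).deg i) (h : cechField g v = 0)
    (hv : cechAtiyahDiff g v = 0) :
    ∃ f : SmoothFn E M, (i ≠ -m → f = 0) ∧ ∃ w : cechAtiyahModule g,
      w ∈ (cechAtiyah g).deg (i - 1) ∧
      v = inducedComp 𝒜 1 (fun _ => (0, f)) + cechAtiyahDiff g w := by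
  have hL : ∀ f : SmoothFn E M, cechField g (inducedComp 𝒜 1 fun _ => (0, f)) = 0 := fun f =>
    cechField_inducedComp 𝒜 fun _ : Fin 1 => ((0, f) : VectorFields E M × SmoothFn E M)
  have hE : ∀ (f : SmoothFn E M) (j : ℕ) (a : Fin (j + 1) → Λ),
      cechEntry g j a (inducedComp 𝒜 1 fun _ => (0, f)) = augmentSlot (U := U) j a f := by
    intro f j a
    refine (cechEntry_inducedComp 𝒜 (fun _ : Fin 1 => ((0, f) : VectorFields E M × SmoothFn E M))
      j a).trans ?_
    rw [slotForm_eq_zero 𝒜 0 (resVF_zero _), if_pos rfl, zero_add]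
  have hL0 : inducedComp 𝒜 1 (fun _ => (0, 0)) = 0 := by
    refine cech_ext_entry (hL 0) fun j a => ?_
    rw [hE, map_zero, map_zero]
  by_cases hj : ∃ j : ℕ, (j : ℤ) = m + i ∧ j ≤ m
  · obtain ⟨j, hj, hjm⟩ := hj
    rcases j with _ | p
    -- In the lowest degree a cocycle glues to a function on $M$ and no correction by a boundary is
    -- needed.
    · obtain ⟨f, hf⟩ := exists_augment_eq hU (cechDiff_eq_zero_of_closed h hv 0)
      refine ⟨f, fun h => absurd (by push_cast at hj; omega) h, 0, Submodule.zero_mem _, ?_⟩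
      rw [cechAtiyahDiff_zero, add_zero]
      refine cech_ext_entry (h.trans (hL f).symm) fun j a => ?_
      rw [hE]
      by_cases h0 : j = 0
      · subst h0
        rw [augmentSlot_zero]
        exact (congrFun hf a).symm
      · rw [augmentSlot_of_ne h0]
        exact congrFun (hi.2 j (by push_cast at hj; omega)) a
    · obtain ⟨b, hb⟩ := cechDiff_exact hU (cechDiff_eq_zero_of_closed h hv (p + 1))
      -- The sign undoes the one in the differential. As `p < m`, the top entry of `w` is zero, so
      -- the constraint holds with zero vector field.
      let w : cechAtiyahModule g := ⟨(0, Pi.single p ((-1 : ℝ) ^ (m + (p + 1)) • b)), by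
        refine ⟨fun k hk => Pi.single_eq_of_ne (by omega) _, ?_⟩
        change _ = cechDiff U m ((Pi.single p ((-1 : ℝ) ^ (m + (p + 1)) • b) : CechCochains E U) m)
        rw [Pi.single_eq_of_ne (by omega), map_zero, map_zero]⟩
      refine ⟨0, fun _ => rfl, w, ⟨fun _ => rfl, fun k hk => Pi.single_eq_of_ne
        (by push_cast at hj; omega) _⟩, ?_⟩
      rw [hL0, zero_add]
      refine Subtype.ext (Prod.ext h (funext fun k => ?_))
      rw [cechAtiyahDiff_apply]
      by_cases hk : k = p + 1
      · subst hk
        rw [if_pos hjm]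
        change _ = _ • cechDiff U p ((Pi.single p ((-1 : ℝ) ^ (m + (p + 1)) • b) :
          CechCochains E U) p)
        rw [Pi.single_eq_same, LinearMap.map_smul_of_tower, smul_smul, hb, ← pow_add, ← two_mul,
          pow_mul]
        simp
      · have : totalCechDiff U w.1.2 k = 0 := by
          rcases k with _ | k
          · rfl
          · change cechDiff U k ((Pi.single p ((-1 : ℝ) ^ (m + (p + 1)) • b) :
              CechCochains E U) k) = 0
            rw [Pi.single_eq_of_ne (by omega), map_zero]
        rw [this, smul_zero, ite_self]
        exact hi.2 k (by push_cast at hj; omega)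
  -- Outside the degrees `-m, …, 0` the element `v` itself is zero.
  · refine ⟨0, fun _ => rfl, 0, Submodule.zero_mem _, ?_⟩
    rw [hL0, cechAtiyahDiff_zero, add_zero]
    refine Subtype.ext (Prod.ext h (funext fun k => ?_))
    by_cases hk : (k : ℤ) = m + i
    · exact v.2.1 k (by_contra fun hkm => hj ⟨k, hk, by omega⟩)
    · exact hi.2 k hk

/-- A boundary has neither a vector field component nor an entry over $\check C_0\,\mathcal U$. So
the vector field of `x` is zero, and then its function restricts to zero on a cover. -/
theorem eq_zero_of_inducedComp_eq_diff (hU : ∀ x : M, ∃ a, x ∈ U a)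
    {x : VectorFields E M × SmoothFn E M} {w : cechAtiyahModule g}
    (h : inducedComp 𝒜 1 (fun _ => x) = cechAtiyahDiff g w) : x = 0 := by
  have h1 : x.1 = 0 :=
    (cechField_inducedComp 𝒜 fun _ : Fin 1 => x).symm.trans (congrArg (cechField g) h)
  refine Prod.ext h1 (augment_injective hU (funext fun a => ?_))
  have h2 := (cechEntry_inducedComp 𝒜 (fun _ : Fin 1 => x) 0 a).symm.trans
    (congrArg (cechEntry g 0 a) h)
  rw [slotForm_eq_zero 𝒜 0 ((congrArg (resVF _) h1).trans (resVF_zero _)), if_pos rfl] at h2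
  refine ((augmentSlot_zero a x.2).symm.trans (zero_add _).symm).trans (h2.trans ?_)
  refine (congrFun (cechAtiyahDiff_apply w 0) a).trans ?_
  rw [if_pos (Nat.zero_le _)]
  exact smul_zero (A := SmoothFn E (inter U a)) ((-1 : ℝ) ^ (m + 0))

/-- The lift $(X,A^{(1)}(X))$ of the vector field of `z` is closed. Subtracting it leaves a closed
element without vector field, to which `exists_eq_of_closed` applies. -/
theorem exists_eq_inducedComp_add_diff [SigmaCompactSpace M] (hU : ∀ x : M, ∃ a, x ∈ U a)
    (H : DiffForm E M (m + 2)) {i : ℤ} {z : cechAtiyahModule g} (hz : z ∈ (cechAtiyah g).deg i)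
    (hz0 : cechAtiyahDiff g z = 0) :
    ∃ x ∈ (atiyah H).deg i, ∃ w : cechAtiyahModule g, w ∈ (cechAtiyah g).deg (i - 1) ∧
      z = inducedComp 𝒜 1 (fun _ => x) + cechAtiyahDiff g w := by
  let X : VectorFields E M × SmoothFn E M := (cechField g z, 0)
  have hX : X ∈ (atiyah H).deg i := ⟨fun h => hz.1 h, fun _ => rfl⟩
  have hd : inducedComp 𝒜 1 (fun _ => X) ∈ (cechAtiyah g).deg i := by
    have := inducedComp_deg 𝒜 H 1 (fun _ => i) (fun _ => X) fun _ => hX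
    simpa using this
  let y : cechAtiyahModule g := inducedComp 𝒜 1 fun _ => X
  -- The difference is written with a real scalar so that additivity and homogeneity of the
  -- differential apply.
  obtain ⟨v, hv⟩ : ∃ v : cechAtiyahModule g, v = z + (-1 : ℝ) • y := ⟨_, rfl⟩
  have hv' : v = z - y :=
    hv.trans ((congrArg (z + ·) (neg_one_smul ℝ y)).trans (sub_eq_add_neg z y).symm)
  have hv0 : cechAtiyahDiff g v = 0 := by
    rw [hv, cechAtiyahDiff_add, cechAtiyahDiff_real_smul, hz0, cechAtiyahDiff_inducedComp_one,
      smul_zero, add_zero]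
  have hvd : v ∈ (cechAtiyah g).deg i := by
    rw [hv']
    exact ((cechAtiyah g).deg i).sub_mem hz hd
  have hvf : cechField g v = 0 := by
    have hy : cechField g y = cechField g z := cechField_inducedComp 𝒜 fun _ : Fin 1 => X
    rw [hv']
    exact ((cechField g).map_sub z y).trans (sub_eq_zero.2 hy.symm)
  obtain ⟨f, hf, w, hw, e⟩ := exists_eq_of_closed 𝒜 hU hvd hvf hv0
  refine ⟨X + (0, f), ((atiyah H).deg i).add_mem hX ⟨fun _ => rfl, hf⟩, w, hw, ?_⟩
  refine Eq.trans ?_ (congrArg (· + cechAtiyahDiff g w) (inducedComp_one_add 𝒜 X (0, f)).symm)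
  exact (add_sub_cancel y z).symm.trans ((congrArg (y + ·) (hv'.symm.trans e)).trans
    (add_assoc y _ _).symm)

theorem inducedMorphism_isQuasiIso [SigmaCompactSpace M] (hU : ∀ x : M, ∃ a, x ∈ U a)
    {H : DiffForm E M (m + 2)} (h𝒜 : 𝒜.HasCurvature H) :
    (inducedMorphism 𝒜 h𝒜).IsQuasiIso where
  injective _ _ _ _ h := by
    obtain ⟨w, -, hw⟩ := h
    exact ⟨0, Submodule.zero_mem _,
      (eq_zero_of_inducedComp_eq_diff 𝒜 hU hw).trans (atiyah_diff H 0).symm⟩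
  surjective _ _ hz hz0 := by
    obtain ⟨x, hx, w, hw, e⟩ := exists_eq_inducedComp_add_diff 𝒜 hU H hz hz0
    exact ⟨x, hx, atiyah_diff H x, w, hw, e⟩

end QuasiIsomorphism

end CechAtiyah

end

theorem theorem5p8
    {E : Type*} [NormedAddCommGroup E] [NormedSpace ℝ E] [FiniteDimensional ℝ E]
    {M : Type*} [TopologicalSpace M] [ChartedSpace E M]
    [IsManifold (modelWithCornersSelf ℝ E) ∞ M] [T2Space M] [SigmaCompactSpace M]
    {Λ : Type*} (U : Λ → TopologicalSpace.Opens M) (hU : ∀ x : M, ∃ a, x ∈ U a)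
    (m : ℕ) (g : CechAtiyah.CircleCochain E U (m + 1)) (hg : CechAtiyah.IsCocycle g)
    (H : CechAtiyah.DiffForm E M (m + 2)) (hH : ∀ X, CechAtiyah.exteriorDeriv H X = 0)
    (𝒜 : CechAtiyah.FullConnection g) (h𝒜 : 𝒜.HasCurvature H) :
    (CechAtiyah.atiyah H).IsLInftyAlgebroid ∧
    (CechAtiyah.cechAtiyah g).IsLInftyAlgebroid ∧
    ∃ Φ : CechAtiyah.InfinityMorphism (CechAtiyah.atiyah H) (CechAtiyah.cechAtiyah g),
      (∀ (k : ℕ) (x : Fin k → CechAtiyah.VectorFields E M × CechAtiyah.SmoothFn E M),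
        (Φ.comp k x).1 = 𝒜.inducedMap k x) ∧
      Φ.IsQuasiIso :=
  ⟨CechAtiyah.atiyah_isLInftyAlgebroid H hH, CechAtiyah.cechAtiyah_isLInftyAlgebroid g,
    CechAtiyah.inducedMorphism 𝒜 h𝒜, fun _ _ => rfl,
    CechAtiyah.inducedMorphism_isQuasiIso 𝒜 hU h𝒜⟩
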